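/- Let $K$ be a commutative ring. A size-$n$ polynomial is a polynomial of degree $\le n-1$; $F_{[a..b[}$ denotes the polynomial $\sum_{i=a}^{b-1}f_iX^{i-a}$ (or the registers that hold it), and $\mathrm{rev}$ reverses the list of coefficients of a polynomial of given size. Model. Algorithms run on an algebraic random access machine: inputs are read-only, outputs are pre-allocated and can be read and written, and the extra space is the number of further registers, each holding an element of $K$ or a pointer. Time is the number of operations in $K$. A routine is in place if it uses $O(1)$ extra registers. Let $\mathsf M:\mathbb N\to\mathbb R$ satisfy $\alpha\,\mathsf M(a)\le \mathsf M(\alpha a)$ for all real $\alpha\ge 1$ and integers $a\ge1$ with $\alpha a$ an integer. Let $\lambda_m,\lambda_s>0$, $c_m,c_s\ge 0$ and $c=\max(c_m+3,c_s+2)$. Suppose given * a routine for the middle product $\mathrm{MP}(F,G)=(FG \operatorname{div} X^{n-1})\bmod X^n$ of polynomials of sizes $2n-1$ and $n$, using at most $\lambda_m\mathsf M(n)$ operations and $c_mn+O(1)$ extra registers; * a routine for the short product $\mathrm{SP}(F,G)=FG\bmod X^n$ of polynomials of size $n$, using at most $\lambda_s\mathsf M(n)$ operations and $c_sn+O(1)$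 extra registers; * an in-place routine for the short product, using at most $\lambda_s\mathsf M(n)$ operations and $O(1)$ extra registers. Algorithm InPlaceEuclDiv. Input: $A,B\in K[X]$ of sizes $m+n$ and $n$, where $m\ge n\ge1$ and the leading coefficient $B_{[n-1]}$ is invertible. Output: $Q,R$ of sizes $m+1$ and $n-1$. It uses the in-place short product routine $\mathrm{SP}$, and an in-place routine $\mathrm{DivErase}(F,G,\ell)$ that computes $F/G\bmod X^\ell$ for $F,G$ of size $\ell$ with $G_{[0]}$ invertible and may erase $F$. Let $H$ be the size-$n$ polynomial stored in the space of $R$ (for $H_{[0..n-1[}$) and one extra register (for $H_{[n-1]}$). 1. $H\leftarrow A_{[m..m+n[}$; $k\leftarrow m+1$. 2. While $k>n$: $Q_{[k-n..k[}\leftarrow\mathrm{rev}(\mathrm{DivErase}(\mathrm{rev}(H),\mathrm{rev}(B),n))$; $H_{[0..n-1[}\leftarrow \mathrm{SP}(Q_{[k-n..k-1[},B_{[0..n-1[})$; $H_{[1..n[}\leftarrow A_{[k-n..k-1[}-H_{[0..n-1[}$; $H_{[0]}\leftarrow A_{[k-n-1]}$; $k\leftarrow k-n$. 3. $Q_{[0..k[}\leftarrow\mathrm{rev}(\mathrm{DivErase}(\mathrm{rev}(H_{[n-k..n[}),\mathrm{rev}(B_{[n-k..n[}),k))$;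 $H_{[0..n-1[}\leftarrow \mathrm{SP}(Q_{[0..n-1[},B_{[0..n-1[})$; $H_{[0..n-1[}\leftarrow A_{[0..n-1[}-H_{[0..n-1[}$; return $(Q,H_{[0..n-1[})$. Theorem. (i) With any in-place $\mathrm{DivErase}$ routine (whose number of operations is bounded in terms of the size), InPlaceEuclDiv is correct, that is, $A=BQ+R$ with $Q$ of size $m+1$ and $R$ of size $n-1$, and it uses $O(1)$ extra space. (ii) There is an in-place $\mathrm{DivErase}$ routine, using at most $$\Bigl(\lambda_m\bigl(\tfrac{c+1}{2}+\tfrac1c\bigr)+\lambda_s\bigl(1+\tfrac1c\bigr)\Bigr)\mathsf M(\ell)+O(\ell)$$ operations in $K$ in size $\ell$, with which InPlaceEuclDiv is correct, uses $O(1)$ extra space and at most $$\Bigl(\lambda_m\bigl(\tfrac{c+1}{2}+\tfrac1c\bigr)+\lambda_s\bigl(2+\tfrac1c\bigr)\Bigr)\mathsf M(m)+O(m\log n)$$ operations in $K$, for all $m\ge n\ge 1$ (for $n=1$, read $O(m)$ for the last term). The $O$-constants do not depend on $m$, $n$, $A$, $B$. -/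

import Mathlib

open Polynomial

/-!
A uniform algebraic random access machine over a commutative ring `K`.

* The ring memory is `μ : ℕ → K`. A program sees it only through its *areas* (array parameters).
  An area is a bounded, indexed family of memory cells which is read-only or writable.
  There are no other ring registers: all auxiliary ring registers of a program are cells of an
  explicit work area, whose length is therefore the extra space in ring elements.
* Pointers are the natural number registers `ν : ℕ → ℕ` of a program. A program is a finite term
  without recursion, so it has a fixed number of them (and of pending calls), whatever its input.
  Every value stored in a pointer must be at most the word bound `W`, or the machine is stuck.
* Accesses out of bounds, writes to read-only areas and inversions of non-units are stuck as well.
* The cost is the number of operations in `K` (`+`, `-`, `*`, inversions, tests to zero).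
-/
namespace PolyRAM

/-- Pointer expressions (`minus` is truncated, `quot` is integer division). -/
inductive NExpr where
  | var (i : ℕ)
  | lit (a : ℕ)
  | plus (e f : NExpr)
  | minus (e f : NExpr)
  | times (e f : NExpr)
  | quot (e f : NExpr)

def NExpr.eval (ν : ℕ → ℕ) : NExpr → ℕ
  | .var i => ν i
  | .lit a => a
  | .plus e f => e.eval ν + f.eval ν
  | .minus e f => e.eval ν - f.eval ν
  | .times e f => e.eval ν * f.eval ν
  | .quot e f => e.eval ν / f.eval ν

/-- An array of memory cells: entry `i < len` is the cell with address `addr i`. -/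
structure Area where
  len : ℕ
  addr : ℕ → ℕ
  writable : Bool

namespace Area

def empty : Area := ⟨0, fun i => i, false⟩

/-- The set of the addresses that belong to the area. -/
def cells (a : Area) : Set ℕ := {l | ∃ i, i < a.len ∧ a.addr i = l}

/-- A writable area whose entries are pairwise distinct cells. -/
def Free (a : Area) : Prop :=
  a.writable = true ∧ ∀ i j, i < a.len → j < a.len → a.addr i = a.addr j → i = j

/-- The polynomial of size `a.len` that is stored in the area. -/
noncomputable def poly {K : Type*} [CommRing K] (a : Area) (μ : ℕ → K) : K[X] :=
  ∑ i ∈ Finset.range a.len, C (μ (a.addr i)) * X ^ i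

end Area

/-- Descriptions of the areas that are passed to a subroutine, in terms of the areas of the
calling program: chunks, reversals, concatenations, and a single cell repeated (read-only). -/
inductive View where
  | param (a : ℕ)
  | readOnly (v : View)
  | take (v : View) (e : NExpr)
  | drop (v : View) (e : NExpr)
  | reverse (v : View)
  | append (v w : View)
  | fill (v : View) (e : NExpr)

def View.eval (ρ : ℕ → Area) (ν : ℕ → ℕ) : View → Area
  | .param a => ρ a
  | .readOnly v => ⟨(v.eval ρ ν).len, (v.eval ρ ν).addr, false⟩
  | .take v e => ⟨min (e.eval ν) (v.eval ρ ν).len, (v.eval ρ ν).addr, (v.eval ρ ν).writable⟩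
  | .drop v e => ⟨(v.eval ρ ν).len - e.eval ν, fun i => (v.eval ρ ν).addr (e.eval ν + i),
      (v.eval ρ ν).writable⟩
  | .reverse v => ⟨(v.eval ρ ν).len, fun i => (v.eval ρ ν).addr ((v.eval ρ ν).len - 1 - i),
      (v.eval ρ ν).writable⟩
  | .append v w => ⟨(v.eval ρ ν).len + (w.eval ρ ν).len,
      fun i => if i < (v.eval ρ ν).len then (v.eval ρ ν).addr i
        else (w.eval ρ ν).addr (i - (v.eval ρ ν).len),
      (v.eval ρ ν).writable && (w.eval ρ ν).writable⟩
  | .fill v e => ⟨if (v.eval ρ ν).len = 0 then 0 else e.eval ν, fun _ => (v.eval ρ ν).addr 0,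
      false⟩

/-- The chunk `v_{[s..t[}`. -/
def View.chunk (v : View) (s t : NExpr) : View := .take (.drop v s) (.minus t s)

/-- A reference to entry `idx` of the area number `arr`. -/
structure Ref where
  arr : ℕ
  idx : NExpr

namespace Ref

def addr (ρ : ℕ → Area) (ν : ℕ → ℕ) (r : Ref) : ℕ := (ρ r.arr).addr (r.idx.eval ν)

def CanRead (ρ : ℕ → Area) (ν : ℕ → ℕ) (r : Ref) : Prop := r.idx.eval ν < (ρ r.arr).len

def CanWrite (ρ : ℕ → Area) (ν : ℕ → ℕ) (r : Ref) : Prop :=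
  r.idx.eval ν < (ρ r.arr).len ∧ (ρ r.arr).writable = true

end Ref

inductive Op where
  | add
  | sub
  | mul

def Op.eval {K : Type*} [CommRing K] : Op → K → K → K
  | .add, x, y => x + y
  | .sub, x, y => x - y
  | .mul, x, y => x * y

/-- Programs. `ifLt e f p q` and `whileLt e f p` test `e < f` on pointers, `ifZero r p q` tests a
ring element; `call p args views` runs `p` with its own pointers, initialised with `args`, on the
areas described by `views`. -/
inductive Prog (K : Type*) where
  | skip
  | seq (p q : Prog K)
  | setPtr (x : ℕ) (e : NExpr)
  | const (d : Ref) (a : K)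
  | copy (d r : Ref)
  | op (o : Op) (d r s : Ref)
  | inv (d r : Ref)
  | ifLt (e f : NExpr) (p q : Prog K)
  | ifZero (r : Ref) (p q : Prog K)
  | whileLt (e f : NExpr) (p : Prog K)
  | call (p : Prog K) (args : List NExpr) (views : List View)

def frame (l : List Area) : ℕ → Area := fun i => l.getD i Area.empty

def pointers (l : List ℕ) : ℕ → ℕ := fun i => l.getD i 0

/-- `Exec W p ρ ν μ ν' μ' t`: with word bound `W`, on the areas `ρ`, program `p` started with
pointers `ν` and memory `μ` halts with pointers `ν'` and memory `μ'` after `t` operations in `K`. -/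
inductive Exec {K : Type*} [CommRing K] (W : ℕ) :
    Prog K → (ℕ → Area) → (ℕ → ℕ) → (ℕ → K) → (ℕ → ℕ) → (ℕ → K) → ℕ → Prop
  | skip (ρ : ℕ → Area) (ν : ℕ → ℕ) (μ : ℕ → K) : Exec W .skip ρ ν μ ν μ 0
  | seq {p q : Prog K} {ρ : ℕ → Area} {ν ν' ν'' : ℕ → ℕ} {μ μ' μ'' : ℕ → K} {t t' : ℕ} :
      Exec W p ρ ν μ ν' μ' t → Exec W q ρ ν' μ' ν'' μ'' t' →
      Exec W (.seq p q) ρ ν μ ν'' μ'' (t + t')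
  | setPtr (x : ℕ) (e : NExpr) (ρ : ℕ → Area) (ν : ℕ → ℕ) (μ : ℕ → K) :
      e.eval ν ≤ W → Exec W (.setPtr x e) ρ ν μ (Function.update ν x (e.eval ν)) μ 0
  | const (d : Ref) (a : K) (ρ : ℕ → Area) (ν : ℕ → ℕ) (μ : ℕ → K) :
      d.CanWrite ρ ν → Exec W (.const d a) ρ ν μ ν (Function.update μ (d.addr ρ ν) a) 0
  | copy (d r : Ref) (ρ : ℕ → Area) (ν : ℕ → ℕ) (μ : ℕ → K) :
      d.CanWrite ρ ν → r.CanRead ρ ν →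
      Exec W (.copy d r) ρ ν μ ν (Function.update μ (d.addr ρ ν) (μ (r.addr ρ ν))) 0
  | op (o : Op) (d r s : Ref) (ρ : ℕ → Area) (ν : ℕ → ℕ) (μ : ℕ → K) :
      d.CanWrite ρ ν → r.CanRead ρ ν → s.CanRead ρ ν →
      Exec W (.op o d r s) ρ ν μ ν
        (Function.update μ (d.addr ρ ν) (o.eval (μ (r.addr ρ ν)) (μ (s.addr ρ ν)))) 1
  | inv (d r : Ref) (ρ : ℕ → Area) (ν : ℕ → ℕ) (μ : ℕ → K) (x : K) :
      d.CanWrite ρ ν → r.CanRead ρ ν → μ (r.addr ρ ν) * x = 1 →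
      Exec W (.inv d r) ρ ν μ ν (Function.update μ (d.addr ρ ν) x) 1
  | ifLtTrue {e f : NExpr} {p q : Prog K} {ρ : ℕ → Area} {ν ν' : ℕ → ℕ} {μ μ' : ℕ → K} {t : ℕ} :
      e.eval ν < f.eval ν → Exec W p ρ ν μ ν' μ' t → Exec W (.ifLt e f p q) ρ ν μ ν' μ' t
  | ifLtFalse {e f : NExpr} {p q : Prog K} {ρ : ℕ → Area} {ν ν' : ℕ → ℕ} {μ μ' : ℕ → K} {t : ℕ} :
      ¬ e.eval ν < f.eval ν → Exec W q ρ ν μ ν' μ' t → Exec W (.ifLt e f p q) ρ ν μ ν' μ' t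
  | ifZeroTrue {r : Ref} {p q : Prog K} {ρ : ℕ → Area} {ν ν' : ℕ → ℕ} {μ μ' : ℕ → K} {t : ℕ} :
      r.CanRead ρ ν → μ (r.addr ρ ν) = 0 → Exec W p ρ ν μ ν' μ' t →
      Exec W (.ifZero r p q) ρ ν μ ν' μ' (t + 1)
  | ifZeroFalse {r : Ref} {p q : Prog K} {ρ : ℕ → Area} {ν ν' : ℕ → ℕ} {μ μ' : ℕ → K} {t : ℕ} :
      r.CanRead ρ ν → μ (r.addr ρ ν) ≠ 0 → Exec W q ρ ν μ ν' μ' t →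
      Exec W (.ifZero r p q) ρ ν μ ν' μ' (t + 1)
  | whileDone {e f : NExpr} {p : Prog K} {ρ : ℕ → Area} {ν : ℕ → ℕ} {μ : ℕ → K} :
      ¬ e.eval ν < f.eval ν → Exec W (.whileLt e f p) ρ ν μ ν μ 0
  | whileStep {e f : NExpr} {p : Prog K} {ρ : ℕ → Area} {ν ν' ν'' : ℕ → ℕ} {μ μ' μ'' : ℕ → K}
      {t t' : ℕ} :
      e.eval ν < f.eval ν → Exec W p ρ ν μ ν' μ' t → Exec W (.whileLt e f p) ρ ν' μ' ν'' μ'' t' →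
      Exec W (.whileLt e f p) ρ ν μ ν'' μ'' (t + t')
  | call {p : Prog K} {args : List NExpr} {views : List View} {ρ : ℕ → Area} {ν ν' : ℕ → ℕ}
      {μ μ' : ℕ → K} {t : ℕ} :
      (∀ e ∈ args, e.eval ν ≤ W) →
      Exec W p (frame (views.map (View.eval ρ ν))) (pointers (args.map (NExpr.eval ν))) μ ν' μ' t →
      Exec W (.call p args views) ρ ν μ ν μ' t

/-- `ins` are read-only areas; `outs` are writable areas, pairwise disjoint and disjoint from the
read-only ones. -/
def Layout (ins outs : List Area) : Prop :=
  (∀ a ∈ ins, a.writable = false) ∧ (∀ a ∈ outs, a.Free) ∧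
    outs.Pairwise (fun a b => Disjoint a.cells b.cells) ∧
    ∀ a ∈ ins, ∀ b ∈ outs, Disjoint a.cells b.cells

/-- Called with arguments `args` on the areas `ins` and `outs`, program `p` halts after at most `T`
operations in `K` in a memory that satisfies `post` and is unchanged outside of `outs`. -/
def Runs {K : Type*} [CommRing K] (W : ℕ) (p : Prog K) (args : List ℕ) (ins outs : List Area)
    (μ : ℕ → K) (T : ℝ) (post : (ℕ → K) → Prop) : Prop :=
  ∃ (ν' : ℕ → ℕ) (μ' : ℕ → K) (t : ℕ),
    Exec W p (frame (ins ++ outs)) (pointers args) μ ν' μ' t ∧ (t : ℝ) ≤ T ∧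
    (∀ l, (∀ b ∈ outs, l ∉ b.cells) → μ' l = μ l) ∧ post μ'

/-- The short product `F G mod X^n`. -/
noncomputable def shortProduct {K : Type*} [CommRing K] (n : ℕ) (F G : K[X]) : K[X] :=
  (F * G) %ₘ (X ^ n)

/-- The middle product `(F G div X^(n-1)) mod X^m`. -/
noncomputable def middleProduct {K : Type*} [CommRing K] (m n : ℕ) (F G : K[X]) : K[X] :=
  ((F * G) /ₘ (X ^ (n - 1))) %ₘ (X ^ m)

/-- `p` computes short products in size `n` with at most `T n` operations in `K` and `S n + O(1)`
extra registers; its pointers are `O(n)`. -/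
def IsShortProduct {K : Type*} [CommRing K] (p : Prog K) (T S : ℕ → ℝ) : Prop :=
  ∃ d w : ℕ, ∀ n W : ℕ, 1 ≤ n → w * n ≤ W → ∀ (F G O E : Area) (μ : ℕ → K),
    F.len = n → G.len = n → O.len = n → S n + d ≤ E.len → Layout [F, G] [O, E] →
    Runs W p [n] [F, G] [O, E] μ (T n)
      (fun μ' => O.poly μ' = shortProduct n (F.poly μ) (G.poly μ))

/-- `p` computes middle products in size `(2n-1, n)` with at most `T n` operations in `K` and
`S n + O(1)` extra registers; its pointers are `O(n)`. -/
def IsMiddleProduct {K : Type*} [CommRing K] (p : Prog K) (T S : ℕ → ℝ) : Prop :=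
  ∃ d w : ℕ, ∀ n W : ℕ, 1 ≤ n → w * n ≤ W → ∀ (F G O E : Area) (μ : ℕ → K),
    F.len = 2 * n - 1 → G.len = n → O.len = n → S n + d ≤ E.len → Layout [F, G] [O, E] →
    Runs W p [n] [F, G] [O, E] μ (T n)
      (fun μ' => O.poly μ' = middleProduct n n (F.poly μ) (G.poly μ))

/-- `p` computes `F / G mod X^n`, for `F` and `G` of size `n` with `G_{[0]}` invertible, with at most
`T n` operations in `K` and `O(1)` extra registers. The area of `F` is writable (it is erased). -/
def IsDivErase {K : Type*} [CommRing K] (p : Prog K) (T : ℕ → ℝ) : Prop :=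
  ∃ d w : ℕ, ∀ n W : ℕ, 1 ≤ n → w * n ≤ W → ∀ (G F Q E : Area) (μ : ℕ → K),
    G.len = n → F.len = n → Q.len = n → d ≤ E.len → Layout [G] [F, Q, E] →
    IsUnit (μ (G.addr 0)) →
    Runs W p [n] [G] [F, Q, E] μ (T n)
      (fun μ' => X ^ n ∣ G.poly μ * Q.poly μ' - F.poly μ)

/-- `p` performs the Euclidean division of `A` of size `m + n` by `B` of size `n`, where `m ≥ n` and
the leading coefficient `B_{[n-1]}` is invertible, with at most `T m n` operations in `K`: the inputs
`A`, `B` are read-only, the outputs are the quotient `Q` of size `m + 1` and the remainder `R` of size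
`n - 1`, and besides the output space only `O(1)` extra registers (the area `E`, and pointers bounded
by `O(m + n)`) are used. -/
def IsEuclDiv {K : Type*} [CommRing K] (p : Prog K) (T : ℕ → ℕ → ℝ) : Prop :=
  ∃ d w : ℕ, ∀ m n W : ℕ, 1 ≤ n → n ≤ m → w * (m + n) ≤ W →
    ∀ (A B Q R E : Area) (μ : ℕ → K),
    A.len = m + n → B.len = n → Q.len = m + 1 → R.len = n - 1 → d ≤ E.len →
    Layout [A, B] [Q, R, E] → IsUnit (μ (B.addr (n - 1))) →
    Runs W p [m, n] [A, B] [Q, R, E] μ (T m n)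
      (fun μ' => A.poly μ = B.poly μ * Q.poly μ' + R.poly μ')

/-- `Y ← Z`, where `Z` and `Y` are the areas 0 and 1, of size `var 0`. -/
def copyProg (K : Type*) : Prog K :=
  .whileLt (.lit 0) (.var 0)
    (.seq (.setPtr 0 (.minus (.var 0) (.lit 1)))
      (.copy ⟨1, .var 0⟩ ⟨0, .var 0⟩))

/-- `Y ← U - V`, where `U`, `V`, `Y` are the areas 0, 1, 2, of size `var 0`. The coefficients are
treated in descending order, so `Y` may be `V` shifted up by one cell. -/
def subProg (K : Type*) : Prog K :=
  .whileLt (.lit 0) (.var 0)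
    (.seq (.setPtr 0 (.minus (.var 0) (.lit 1)))
      (.op .sub ⟨2, .var 0⟩ ⟨0, .var 0⟩ ⟨1, .var 0⟩))

section Algorithm

def ptrM : NExpr := .var 0
def ptrN : NExpr := .var 1
def ptrK : NExpr := .var 2
def viewA : View := .param 0
def viewB : View := .param 1
def viewQ : View := .param 2
def viewR : View := .param 3

/-- The size-`n` polynomial `H`: the remainder space followed by one extra register. -/
def viewH : View := .append viewR (.take (.param 4) (.lit 1))

/-- The other extra registers, used by the subroutines. -/
def viewE : View := .drop (.param 4) (.lit 1)

/-- `Q_{[s..t[} ← rev (DivErase (rev H', rev B', t - s))`. -/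
def divStep {K : Type*} (divErase : Prog K) (s t : NExpr) (vH vB : View) : Prog K :=
  .call divErase [.minus t s]
    [.readOnly (.reverse vB), .reverse vH, .reverse (viewQ.chunk s t), viewE]

/-- `H_{[0..n-1[} ← SP (Q_{[s..s+n-1[}, B_{[0..n-1[})` (nothing to do when `n = 1`). -/
def spStep {K : Type*} (sp : Prog K) (s : NExpr) : Prog K :=
  .ifLt (.lit 1) ptrN
    (.call sp [.minus ptrN (.lit 1)]
      [.readOnly (viewQ.chunk s (.plus s (.minus ptrN (.lit 1)))),
       .readOnly (viewB.chunk (.lit 0) (.minus ptrN (.lit 1))), viewR, viewE])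
    .skip

/-- The body of the main loop. -/
def euclLoopBody {K : Type*} (divErase sp : Prog K) : Prog K :=
  .seq (divStep divErase (.minus ptrK ptrN) ptrK viewH viewB) <|
  .seq (spStep sp (.minus ptrK ptrN)) <|
  -- `H_{[1..n[} ← A_{[k-n..k-1[} - H_{[0..n-1[}`
  .seq (.call (subProg K) [.minus ptrN (.lit 1)]
    [viewA.chunk (.minus ptrK ptrN) (.minus ptrK (.lit 1)),
     viewH.chunk (.lit 0) (.minus ptrN (.lit 1)), viewH.chunk (.lit 1) ptrN]) <|
  -- `H_{[0]} ← A_{[k-n-1]}`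
  .seq (.call (copyProg K) [.lit 1]
    [viewA.chunk (.minus (.minus ptrK ptrN) (.lit 1)) (.minus ptrK ptrN),
     viewH.chunk (.lit 0) (.lit 1)])
  (.setPtr 2 (.minus ptrK ptrN))

/-- Algorithm `InPlaceEuclDiv`, with subroutines `divErase` and `sp`. Its areas are `A`, `B`
(inputs), `Q`, `R` (outputs) and the extra registers; its arguments are `m` and `n`. -/
def inPlaceEuclDiv {K : Type*} (divErase sp : Prog K) : Prog K :=
  -- `H ← A_{[m..m+n[}`
  .seq (.call (copyProg K) [ptrN] [viewA.chunk ptrM (.plus ptrM ptrN), viewH]) <|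
  .seq (.setPtr 2 (.plus ptrM (.lit 1))) <|
  .seq (.whileLt ptrN ptrK (euclLoopBody divErase sp)) <|
  .seq (divStep divErase (.lit 0) ptrK (viewH.chunk (.minus ptrN ptrK) ptrN)
    (viewB.chunk (.minus ptrN ptrK) ptrN)) <|
  .seq (spStep sp (.lit 0)) <|
  -- `R ← A_{[0..n-1[} - R`
  .call (subProg K) [.minus ptrN (.lit 1)]
    [viewA.chunk (.lit 0) (.minus ptrN (.lit 1)), viewR, viewR]

end Algorithm

end PolyRAM

/-! Part (i) is block-wise schoolbook division. Between two turns of the loop, A − BQ, taken with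
the quotient coefficients from index k on, has no term of degree ≥ k+n−1, and H holds its n
coefficients from degree k−1 on. Reversal of coefficients turns a power series quotient of leading
coefficients into the next block of Q (`wp_divStep`), which clears as many further degrees
(`EuclInv.high`). A quotient coefficient of index u contributes nothing below degree u, so the next
H depends only on A and the new block, and the short product may overwrite the old H
(`EuclInv.step`, `runs_inPlaceEuclDiv`).

For part (ii), F/G is computed in blocks of length l = ⌊n/q⌋ with q = ⌈c_m⌉+2. The inverse of G
modulo X^l is found by Newton iteration (`runs_inverseProg`) and replaces F_{[0..l[} as soon as the
first block of the quotient is known. A later block requires one middle product of G with each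
earlier block, subtracted from F, and one short product with the inverse (`quotient_extend`,
`wp_blockStep`). The consumed part of F and the unfilled part of Q always amount to n−2l idle cells,
and q ≥ c_m+2 gives n−2l ≥ c_m l: the work space of the products fits there, up to O(1) cells. The
at most q remaining coefficients take O(n) operations each (`runs_extendProg`).

In all this is worth q(q−1)/2+1 middle and q+1 short products of size l, where Newton iteration
accounts for one of each. As M(a) ≤ a·M(n)/n for a ≤ n, the rate is δ = λ_m((q−1)/2+1/q) + λ(1+1/q).
Here λ = min(λ_m, λ_s), since a short product is also a middle product with zero padding
(`ComputesMP.computesSP`).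

In the Euclidean division the blocks have total size m+1, and the accompanying short products have
total size at most 2m and cost at most 2λ_s M(m). So δ has to be compared with δ' = λ_m((c+1)/2+1/c)
+ λ_s/c, a full λ_s below the rate allowed for the division with erasing. Since q < c, even δ < δ'
holds (`divErase_rate_lt`); the strict gap pays for the size m+1 instead of m, and the error term is
in fact O(m). -/

namespace PolyRAM

variable {K : Type*} [CommRing K]

/-! ### Operations on areas -/

namespace Area

/-- The area without the right to write. -/
def ro (a : Area) : Area := ⟨a.len, a.addr, false⟩

/-- The `n` entries of an area from entry `s` on. -/
def slice (a : Area) (s n : ℕ) : Area := ⟨n, fun i => a.addr (s + i), a.writable⟩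

/-- The entries in reverse order. -/
def rev (a : Area) : Area := ⟨a.len, fun i => a.addr (a.len - 1 - i), a.writable⟩

/-- Concatenation. -/
def app (a b : Area) : Area :=
  ⟨a.len + b.len, fun i => if i < a.len then a.addr i else b.addr (i - a.len),
    a.writable && b.writable⟩

/-- The first entry of `a`, repeated `n` times. -/
def rep (a : Area) (n : ℕ) : Area := ⟨n, fun _ => a.addr 0, false⟩

@[simp] lemma ro_len (a : Area) : a.ro.len = a.len := rfl
@[simp] lemma ro_addr (a : Area) (i : ℕ) : a.ro.addr i = a.addr i := rfl
@[simp] lemma ro_writable (a : Area) : a.ro.writable = false := rfl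
@[simp] lemma slice_len (a : Area) (s n : ℕ) : (a.slice s n).len = n := rfl
@[simp] lemma slice_addr (a : Area) (s n i : ℕ) : (a.slice s n).addr i = a.addr (s + i) := rfl
@[simp] lemma slice_writable (a : Area) (s n : ℕ) : (a.slice s n).writable = a.writable := rfl
@[simp] lemma rev_len (a : Area) : a.rev.len = a.len := rfl
@[simp] lemma rev_addr (a : Area) (i : ℕ) : a.rev.addr i = a.addr (a.len - 1 - i) := rfl
@[simp] lemma rev_writable (a : Area) : a.rev.writable = a.writable := rfl
@[simp] lemma app_len (a b : Area) : (a.app b).len = a.len + b.len := rfl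
@[simp] lemma app_writable (a b : Area) : (a.app b).writable = (a.writable && b.writable) := rfl
@[simp] lemma rep_len (a : Area) (n : ℕ) : (a.rep n).len = n := rfl
@[simp] lemma rep_addr (a : Area) (n i : ℕ) : (a.rep n).addr i = a.addr 0 := rfl
@[simp] lemma rep_writable (a : Area) (n : ℕ) : (a.rep n).writable = false := rfl

lemma app_addr_left (a b : Area) {i : ℕ} (h : i < a.len) : (a.app b).addr i = a.addr i := by
  simp [app, h]

lemma app_addr_right (a b : Area) {i : ℕ} (h : a.len ≤ i) :
    (a.app b).addr i = b.addr (i - a.len) := by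
  simp [app, h]

lemma addr_mem (a : Area) {i : ℕ} (h : i < a.len) : a.addr i ∈ a.cells := ⟨i, h, rfl⟩

@[simp] lemma cells_ro (a : Area) : a.ro.cells = a.cells := rfl

@[simp] lemma cells_rev (a : Area) : a.rev.cells = a.cells := by
  ext l
  constructor
  · rintro ⟨i, hi, rfl⟩
    exact a.addr_mem (by simp at hi; omega)
  · rintro ⟨i, hi, rfl⟩
    refine ⟨a.len - 1 - i, by simp; omega, ?_⟩
    simp only [rev_addr]
    congr 1
    omega

@[simp] lemma cells_app (a b : Area) : (a.app b).cells = a.cells ∪ b.cells := by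
  ext l
  constructor
  · rintro ⟨i, hi, rfl⟩
    rcases lt_or_ge i a.len with h | h
    · rw [app_addr_left a b h]; exact Or.inl (a.addr_mem h)
    · rw [app_addr_right a b h]; exact Or.inr (b.addr_mem (by simp at hi; omega))
  · rintro (⟨i, hi, rfl⟩ | ⟨i, hi, rfl⟩)
    · exact ⟨i, by simp; omega, app_addr_left a b hi⟩
    · refine ⟨a.len + i, by simp; omega, ?_⟩
      rw [app_addr_right a b (by omega)]
      congr 1
      omega

lemma cells_slice_subset (a : Area) {s n : ℕ} (h : s + n ≤ a.len) :
    (a.slice s n).cells ⊆ a.cells := by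
  rintro l ⟨i, hi, rfl⟩
  exact a.addr_mem (by simp at hi; omega)

lemma slice_subset_slice (a : Area) {s n s' n' : ℕ} (h : s ≤ s') (h' : s' + n' ≤ s + n) :
    (a.slice s' n').cells ⊆ (a.slice s n).cells := by
  rintro l ⟨i, hi, rfl⟩
  simp only [slice_len, slice_addr] at hi ⊢
  refine ⟨s' - s + i, by simp only [slice_len]; omega, ?_⟩
  simp only [slice_addr]
  congr 1
  omega

lemma cells_rep_subset (a : Area) {n : ℕ} (h : 0 < a.len) : (a.rep n).cells ⊆ a.cells := by
  rintro l ⟨i, hi, rfl⟩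
  exact a.addr_mem h

lemma Free.slice {a : Area} (ha : a.Free) {s n : ℕ} (h : s + n ≤ a.len) : (a.slice s n).Free := by
  refine ⟨ha.1, fun i j hi hj hij => ?_⟩
  simp only [slice_len, slice_addr] at hi hj hij
  have := ha.2 _ _ (by omega) (by omega) hij
  omega

lemma Free.rev {a : Area} (ha : a.Free) : a.rev.Free := by
  refine ⟨ha.1, fun i j hi hj hij => ?_⟩
  simp only [rev_len, rev_addr] at hi hj hij
  have := ha.2 _ _ (by omega) (by omega) hij
  omega

lemma Free.app {a b : Area} (ha : a.Free) (hb : b.Free) (h : Disjoint a.cells b.cells) :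
    (a.app b).Free := by
  refine ⟨by simp [ha.1, hb.1], fun i j hi hj hij => ?_⟩
  simp only [app_len] at hi hj
  rcases lt_or_ge i a.len with h1 | h1 <;> rcases lt_or_ge j a.len with h2 | h2
  · rw [app_addr_left a b h1, app_addr_left a b h2] at hij
    exact ha.2 _ _ h1 h2 hij
  · rw [app_addr_left a b h1, app_addr_right a b h2] at hij
    exact absurd (hij ▸ a.addr_mem h1)
      (Set.disjoint_right.1 h (b.addr_mem (by omega : j - a.len < b.len)))
  · rw [app_addr_right a b h1, app_addr_left a b h2] at hij
    exact absurd (hij ▸ a.addr_mem h2)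
      (Set.disjoint_right.1 h (b.addr_mem (by omega : i - a.len < b.len)))
  · rw [app_addr_right a b h1, app_addr_right a b h2] at hij
    have := hb.2 _ _ (by omega) (by omega) hij
    omega

lemma Free.addr_notMem_slice {a : Area} (ha : a.Free) {s n j : ℕ} (hs : s + n ≤ a.len)
    (hj : j < a.len) (h : j < s ∨ s + n ≤ j) : a.addr j ∉ (a.slice s n).cells := by
  rintro ⟨i, hi, hij⟩
  simp only [slice_len, slice_addr] at hi hij
  have := ha.2 _ _ (by omega) hj hij
  omega

lemma Free.disjoint_slice {a : Area} (ha : a.Free) {s n s' n' : ℕ} (hs : s + n ≤ a.len)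
    (hs' : s' + n' ≤ a.len) (h : s + n ≤ s' ∨ s' + n' ≤ s) :
    Disjoint (a.slice s n).cells (a.slice s' n').cells := by
  rw [Set.disjoint_left]
  rintro l ⟨i, hi, rfl⟩
  simp only [slice_len, slice_addr] at hi ⊢
  exact ha.addr_notMem_slice hs' (by omega) (by omega)

lemma addr_notMem {a b : Area} (h : Disjoint a.cells b.cells) {i : ℕ} (hi : i < a.len) :
    a.addr i ∉ b.cells :=
  Set.disjoint_left.1 h (a.addr_mem hi)

lemma notMem_slice {a : Area} {l s n : ℕ} (h : l ∉ a.cells) (hs : s + n ≤ a.len) :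
    l ∉ (a.slice s n).cells :=
  fun h' => h (a.cells_slice_subset hs h')

lemma slice_disjoint {a b : Area} (h : Disjoint a.cells b.cells) {s n : ℕ} (hs : s + n ≤ a.len) :
    Disjoint (a.slice s n).cells b.cells :=
  h.mono_left (a.cells_slice_subset hs)

lemma disjoint_slice {a b : Area} (h : Disjoint a.cells b.cells) {s n : ℕ} (hs : s + n ≤ b.len) :
    Disjoint a.cells (b.slice s n).cells :=
  h.mono_right (b.cells_slice_subset hs)

lemma coeff_poly (a : Area) (μ : ℕ → K) (i : ℕ) :
    (a.poly μ).coeff i = if i < a.len then μ (a.addr i) else 0 := by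
  simp [poly, Polynomial.coeff_X_pow]

end Area

/-! ### Views as operations on areas -/

section EvalView

variable {ρ : ℕ → Area} {ν : ℕ → ℕ}

lemma eval_readOnly (v : View) : (View.readOnly v).eval ρ ν = (v.eval ρ ν).ro := rfl

lemma eval_append (v w : View) :
    (View.append v w).eval ρ ν = (v.eval ρ ν).app (w.eval ρ ν) := rfl

lemma eval_take {v : View} {e : NExpr} {A : Area} {n : ℕ} (hv : v.eval ρ ν = A)
    (he : e.eval ν = n) (h : n ≤ A.len) : (View.take v e).eval ρ ν = A.slice 0 n := by
  subst hv he
  simp [View.eval, Area.slice, h]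

lemma eval_drop {v : View} {e : NExpr} {A : Area} {s : ℕ} (hv : v.eval ρ ν = A)
    (he : e.eval ν = s) : (View.drop v e).eval ρ ν = A.slice s (A.len - s) := by
  subst hv he
  rfl

lemma eval_fill {v : View} {e : NExpr} {A : Area} {n : ℕ} (hv : v.eval ρ ν = A)
    (he : e.eval ν = n) (h : 0 < A.len) : (View.fill v e).eval ρ ν = A.rep n := by
  subst hv he
  simp [View.eval, Area.rep, h.ne']

lemma eval_chunk {v : View} {s t : NExpr} {A : Area} {a n : ℕ} (hv : v.eval ρ ν = A)
    (hs : s.eval ν = a) (ht : t.eval ν = a + n) (h : a + n ≤ A.len) :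
    (v.chunk s t).eval ρ ν = A.slice a n := by
  subst hv hs
  simp only [View.chunk, View.eval, Area.slice, NExpr.eval]
  congr 1
  omega

end EvalView

lemma layout_iff {ins outs : List Area} : Layout ins outs ↔
    (∀ a ∈ ins, a.writable = false) ∧ (∀ a ∈ outs, a.Free) ∧
    outs.Pairwise (fun a b => Disjoint a.cells b.cells) ∧
    ∀ a ∈ ins, ∀ b ∈ outs, Disjoint a.cells b.cells := Iff.rfl

/-! ### Total correctness -/

/-- `p` halts in a state, and after a number of operations, that satisfy `Φ`. -/
def Wp (W : ℕ) (p : Prog K) (ρ : ℕ → Area) (ν : ℕ → ℕ) (μ : ℕ → K)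
    (Φ : (ℕ → ℕ) → (ℕ → K) → ℕ → Prop) : Prop :=
  ∃ ν' μ' t, Exec W p ρ ν μ ν' μ' t ∧ Φ ν' μ' t

section Rules

variable {W : ℕ} {ρ : ℕ → Area} {ν : ℕ → ℕ} {μ : ℕ → K} {Φ Ψ : (ℕ → ℕ) → (ℕ → K) → ℕ → Prop}
  {p q : Prog K}

lemma Wp.mono (h : Wp W p ρ ν μ Φ) (h' : ∀ ν' μ' t, Φ ν' μ' t → Ψ ν' μ' t) : Wp W p ρ ν μ Ψ := by
  obtain ⟨ν', μ', t, he, hΦ⟩ := h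
  exact ⟨ν', μ', t, he, h' _ _ _ hΦ⟩

lemma Wp.skip (h : Φ ν μ 0) : Wp W .skip ρ ν μ Φ := ⟨_, _, _, .skip _ _ _, h⟩

lemma Wp.seq (h : Wp W p ρ ν μ fun ν' μ' t => Wp W q ρ ν' μ' fun ν'' μ'' t' => Φ ν'' μ'' (t + t')) :
    Wp W (.seq p q) ρ ν μ Φ := by
  obtain ⟨ν', μ', t, he, ν'', μ'', t', he', hΦ⟩ := h
  exact ⟨_, _, _, .seq he he', hΦ⟩

lemma Wp.setPtr {x : ℕ} {e : NExpr} (hW : e.eval ν ≤ W)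
    (h : Φ (Function.update ν x (e.eval ν)) μ 0) : Wp W (.setPtr x e) ρ ν μ Φ :=
  ⟨_, _, _, .setPtr _ _ _ _ _ hW, h⟩

lemma Wp.const {d : Ref} {a : K} (hd : d.CanWrite ρ ν)
    (h : Φ ν (Function.update μ (d.addr ρ ν) a) 0) : Wp W (.const d a) ρ ν μ Φ :=
  ⟨_, _, _, .const _ _ _ _ _ hd, h⟩

lemma Wp.copy {d r : Ref} (hd : d.CanWrite ρ ν) (hr : r.CanRead ρ ν)
    (h : Φ ν (Function.update μ (d.addr ρ ν) (μ (r.addr ρ ν))) 0) : Wp W (.copy d r) ρ ν μ Φ :=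
  ⟨_, _, _, .copy _ _ _ _ _ hd hr, h⟩

lemma Wp.op {o : Op} {d r s : Ref} (hd : d.CanWrite ρ ν) (hr : r.CanRead ρ ν) (hs : s.CanRead ρ ν)
    (h : Φ ν (Function.update μ (d.addr ρ ν) (o.eval (μ (r.addr ρ ν)) (μ (s.addr ρ ν)))) 1) :
    Wp W (.op o d r s) ρ ν μ Φ :=
  ⟨_, _, _, .op _ _ _ _ _ _ _ hd hr hs, h⟩

lemma Wp.inv {d r : Ref} (hd : d.CanWrite ρ ν) (hr : r.CanRead ρ ν) (hu : IsUnit (μ (r.addr ρ ν)))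
    (h : ∀ x, μ (r.addr ρ ν) * x = 1 → Φ ν (Function.update μ (d.addr ρ ν) x) 1) :
    Wp W (.inv d r) ρ ν μ Φ := by
  obtain ⟨x, hx⟩ := hu.exists_right_inv
  exact ⟨_, _, _, .inv _ _ _ _ _ x hd hr hx, h x hx⟩

lemma Wp.ifLt {e f : NExpr} (ht : e.eval ν < f.eval ν → Wp W p ρ ν μ Φ)
    (hf : ¬ e.eval ν < f.eval ν → Wp W q ρ ν μ Φ) : Wp W (.ifLt e f p q) ρ ν μ Φ := by
  by_cases h : e.eval ν < f.eval ν
  · obtain ⟨ν', μ', t, he, hΦ⟩ := ht h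
    exact ⟨_, _, _, .ifLtTrue h he, hΦ⟩
  · obtain ⟨ν', μ', t, he, hΦ⟩ := hf h
    exact ⟨_, _, _, .ifLtFalse h he, hΦ⟩

/-- A loop with `N` turns; `Inv i ν μ s` holds after `i` turns that took `s` operations. -/
lemma Wp.whileLt {e f : NExpr} (N : ℕ) (Inv : ℕ → (ℕ → ℕ) → (ℕ → K) → ℕ → Prop)
    (h0 : Inv 0 ν μ 0)
    (hstep : ∀ i < N, ∀ ν μ s, Inv i ν μ s → e.eval ν < f.eval ν ∧
      Wp W p ρ ν μ fun ν' μ' t => Inv (i + 1) ν' μ' (s + t))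
    (hend : ∀ ν μ s, Inv N ν μ s → ¬ e.eval ν < f.eval ν ∧ Φ ν μ s) :
    Wp W (.whileLt e f p) ρ ν μ Φ := by
  -- Induction on the number j of turns still to come, because an execution of a loop is decomposed
  -- at its first turn.
  have key : ∀ j ≤ N, ∀ ν μ s, Inv (N - j) ν μ s →
      Wp W (.whileLt e f p) ρ ν μ fun ν' μ' t => Φ ν' μ' (s + t) := by
    intro j
    induction j with
    | zero =>
      intro _ ν μ s h
      obtain ⟨h1, h2⟩ := hend ν μ s h
      exact ⟨_, _, _, .whileDone h1, h2⟩
    | succ j ih =>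
      intro hj ν μ s h
      obtain ⟨h1, ν', μ', t, he, hI⟩ := hstep _ (by omega) ν μ s h
      rw [show N - (j + 1) + 1 = N - j by omega] at hI
      obtain ⟨ν'', μ'', t', he', hΦ⟩ := ih (by omega) _ _ _ hI
      exact ⟨_, _, _, .whileStep h1 he he', by simpa only [← add_assoc] using hΦ⟩
  have := key N le_rfl ν μ 0 (by rwa [Nat.sub_self])
  simpa using this

lemma Wp.call {args : List NExpr} {views : List View} {as : List ℕ} {l : List Area}
    (hW : ∀ e ∈ args, e.eval ν ≤ W) (ha : args.map (NExpr.eval ν) = as)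
    (hv : views.map (View.eval ρ ν) = l)
    (h : Wp W p (frame l) (pointers as) μ fun _ μ' t => Φ ν μ' t) :
    Wp W (.call p args views) ρ ν μ Φ := by
  subst ha hv
  obtain ⟨ν', μ', t, he, hΦ⟩ := h
  exact ⟨_, _, _, .call hW he, hΦ⟩

lemma Wp.call_runs {args : List NExpr} {views : List View} {as : List ℕ} {ins outs : List Area}
    {T : ℝ} {post : (ℕ → K) → Prop}
    (hr : Runs W p as ins outs μ T post)
    (hW : ∀ e ∈ args, e.eval ν ≤ W) (ha : args.map (NExpr.eval ν) = as)
    (hv : views.map (View.eval ρ ν) = ins ++ outs)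
    (h : ∀ μ' (t : ℕ), (t : ℝ) ≤ T → (∀ l, (∀ b ∈ outs, l ∉ b.cells) → μ' l = μ l) → post μ' →
      Φ ν μ' t) :
    Wp W (.call p args views) ρ ν μ Φ := by
  obtain ⟨ν', μ', t, he, ht, hf, hp⟩ := hr
  exact Wp.call hW ha hv ⟨ν', μ', t, he, h μ' t ht hf hp⟩

lemma Wp.call_two {args : List NExpr} {views : List View} {as : List ℕ} {a b o e : Area}
    {T : ℝ} {post : (ℕ → K) → Prop}
    (hr : Runs W p as [a, b] [o, e] μ T post)
    (hW : ∀ e ∈ args, e.eval ν ≤ W) (ha : args.map (NExpr.eval ν) = as)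
    (hv : views.map (View.eval ρ ν) = [a, b, o, e])
    (h : ∀ μ' (t : ℕ), (t : ℝ) ≤ T → (∀ l, l ∉ o.cells → l ∉ e.cells → μ' l = μ l) → post μ' →
      Φ ν μ' t) :
    Wp W (.call p args views) ρ ν μ Φ :=
  Wp.call_runs hr hW ha hv fun μ' t ht hf hp => h μ' t ht
    (fun l h1 h2 => hf l (by simpa using ⟨h1, h2⟩)) hp

lemma map_three {α β : Type*} {f : α → β} {a b c : α} {a' b' c' : β} (ha : f a = a')
    (hb : f b = b') (hc : f c = c') : [a, b, c].map f = [a', b', c'] := by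
  simp [ha, hb, hc]

lemma map_four {α β : Type*} {f : α → β} {a b c d : α} {a' b' c' d' : β} (ha : f a = a')
    (hb : f b = b') (hc : f c = c') (hd : f d = d') : [a, b, c, d].map f = [a', b', c', d'] := by
  simp [ha, hb, hc, hd]

lemma Runs.mono {as : List ℕ} {ins outs : List Area} {T T' : ℝ} {post post' : (ℕ → K) → Prop}
    (hr : Runs W p as ins outs μ T post) (hT : T ≤ T') (h : ∀ μ', post μ' → post' μ') :
    Runs W p as ins outs μ T' post' := by
  obtain ⟨ν', μ', t, he, ht, hf, hp⟩ := hr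
  exact ⟨ν', μ', t, he, ht.trans hT, hf, h _ hp⟩

lemma Runs.of_wp {as : List ℕ} {ins outs : List Area} {T : ℝ} {post : (ℕ → K) → Prop}
    (h : Wp W p (frame (ins ++ outs)) (pointers as) μ fun _ μ' t =>
      (t : ℝ) ≤ T ∧ (∀ l, (∀ b ∈ outs, l ∉ b.cells) → μ' l = μ l) ∧ post μ') :
    Runs W p as ins outs μ T post := by
  obtain ⟨ν', μ', t, he, h1, h2, h3⟩ := h
  exact ⟨ν', μ', t, he, h1, h2, h3⟩

end Rules

@[simp] lemma frame_zero (a : Area) (l : List Area) : frame (a :: l) 0 = a := rfl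
@[simp] lemma frame_one (a b : Area) (l : List Area) : frame (a :: b :: l) 1 = b := rfl
@[simp] lemma frame_two (a b c : Area) (l : List Area) : frame (a :: b :: c :: l) 2 = c := rfl
@[simp] lemma frame_three (a b c d : Area) (l : List Area) :
    frame (a :: b :: c :: d :: l) 3 = d := rfl
@[simp] lemma pointers_zero (n : ℕ) (l : List ℕ) : pointers (n :: l) 0 = n := rfl
@[simp] lemma pointers_one (m n : ℕ) (l : List ℕ) : pointers (m :: n :: l) 1 = n := rfl

/-! ### Copies and differences -/

section Loops

variable {W n : ℕ} {μ : ℕ → K} {ν : ℕ → ℕ} {Φ : (ℕ → ℕ) → (ℕ → K) → ℕ → Prop}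
  {ρ : ℕ → Area}

/-- Copies and pointer arithmetic are free in this cost model, hence time 0. -/
lemma wp_copyProg {Z Y : Area} (hW : n ≤ W) (hZ : n ≤ Z.len) (hY : n ≤ Y.len) (hf : Y.Free)
    (hd : ∀ i < n, ∀ j < n, Y.addr i ≠ Z.addr j)
    (hΦ : ∀ ν' μ', (∀ i < n, μ' (Y.addr i) = μ (Z.addr i)) →
      (∀ l, l ∉ (Y.slice 0 n).cells → μ' l = μ l) → Φ ν' μ' 0) :
    Wp W (copyProg K) (frame [Z, Y]) (pointers [n]) μ Φ := by
  refine Wp.whileLt n (fun i ν' μ' s => ν' 0 = n - i ∧ s = 0 ∧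
    (∀ j < n, n - i ≤ j → μ' (Y.addr j) = μ (Z.addr j)) ∧
    ∀ l, l ∉ (Y.slice 0 n).cells → μ' l = μ l) ?_ ?_ ?_
  · refine ⟨rfl, rfl, fun j h1 h2 => by omega, fun _ _ => rfl⟩
  · rintro i hi ν' μ' s ⟨h0, rfl, h1, h2⟩
    refine ⟨by simp [NExpr.eval, h0]; omega, Wp.seq (Wp.setPtr (by simp [NExpr.eval, h0]; omega) ?_)⟩
    have e0 : ν' 0 - 1 = n - (i + 1) := by omega
    refine Wp.copy ?_ ?_ ⟨by simp [NExpr.eval, e0], rfl, ?_, ?_⟩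
    · refine ⟨?_, hf.1⟩
      simp [NExpr.eval, e0]; omega
    · simp [Ref.CanRead, NExpr.eval, e0]; omega
    · intro j hj hij
      simp only [Ref.addr, NExpr.eval, Function.update_self, e0, frame_zero, frame_one]
      by_cases hji : j = n - (i + 1)
      · subst hji
        rw [Function.update_self]
        refine h2 _ ?_
        rintro ⟨j', hj', h⟩
        exact hd _ (by simpa using hj') _ hj (by simpa using h)
      · rw [Function.update_of_ne]
        · exact h1 j hj (by omega)
        · intro h
          exact hji (hf.2 _ _ (by omega) (by omega) h)
    · intro l hl
      simp only [Ref.addr, NExpr.eval, Function.update_self, e0, frame_zero, frame_one]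
      rw [Function.update_of_ne]
      · exact h2 l hl
      · rintro rfl
        exact hl ⟨n - (i + 1), by simp; omega, by simp⟩
  · rintro ν' μ' s ⟨h0, rfl, h1, h2⟩
    refine ⟨by simp [NExpr.eval, h0], hΦ _ _ (fun i hi => h1 i hi (by omega)) h2⟩

/-- In descending order, the write to entry i can only damage what is read afterwards, namely
entries j < i of U and V. Disjointness is required for these alone, which admits Y = U, Y = V and V
shifted up by one cell. -/
lemma wp_subProg {U V Y : Area} (hW : n ≤ W) (hU : n ≤ U.len) (hV : n ≤ V.len) (hY : n ≤ Y.len)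
    (hf : Y.Free) (hdU : ∀ i < n, ∀ j < i, Y.addr i ≠ U.addr j)
    (hdV : ∀ i < n, ∀ j < i, Y.addr i ≠ V.addr j)
    (hΦ : ∀ ν' μ', (∀ i < n, μ' (Y.addr i) = μ (U.addr i) - μ (V.addr i)) →
      (∀ l, l ∉ (Y.slice 0 n).cells → μ' l = μ l) → Φ ν' μ' n) :
    Wp W (subProg K) (frame [U, V, Y]) (pointers [n]) μ Φ := by
  refine Wp.whileLt n (fun i ν' μ' s => ν' 0 = n - i ∧ s = i ∧
    (∀ j < n, n - i ≤ j → μ' (Y.addr j) = μ (U.addr j) - μ (V.addr j)) ∧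
    ∀ l, (∀ j < n, n - i ≤ j → Y.addr j ≠ l) → μ' l = μ l) ?_ ?_ ?_
  · refine ⟨rfl, rfl, fun j h1 h2 => by omega, fun _ _ => rfl⟩
  · rintro i hi ν' μ' s ⟨h0, rfl, h1, h2⟩
    refine ⟨by simp [NExpr.eval, h0]; omega, Wp.seq (Wp.setPtr (by simp [NExpr.eval, h0]; omega) ?_)⟩
    have e0 : ν' 0 - 1 = n - (s + 1) := by omega
    refine Wp.op ?_ ?_ ?_ ⟨by simp [NExpr.eval, e0], by simp, ?_, ?_⟩
    · refine ⟨?_, hf.1⟩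
      simp [NExpr.eval, e0]; omega
    · simp [Ref.CanRead, NExpr.eval, e0]; omega
    · simp [Ref.CanRead, NExpr.eval, e0]; omega
    · intro j hj hij
      simp only [Ref.addr, NExpr.eval, Function.update_self, e0, frame_zero, frame_one, frame_two, Op.eval]
      by_cases hji : j = n - (s + 1)
      · subst hji
        rw [Function.update_self, h2 _ fun j' hj' hs => hdU _ hj' _ (by omega),
          h2 _ fun j' hj' hs => hdV _ hj' _ (by omega)]
      · rw [Function.update_of_ne]
        · exact h1 j hj (by omega)
        · intro h
          exact hji (hf.2 _ _ (by omega) (by omega) h)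
    · intro l hl
      simp only [Ref.addr, NExpr.eval, Function.update_self, e0, frame_zero, frame_one, frame_two]
      rw [Function.update_of_ne]
      · exact h2 l fun j hj hs => hl j hj (by omega)
      · exact (hl _ (by omega) (by omega)).symm
  · rintro ν' μ' s ⟨h0, rfl, h1, h2⟩
    refine ⟨by simp [NExpr.eval, h0], hΦ _ _ (fun i hi => h1 i hi (by omega)) fun l hl => ?_⟩
    exact h2 l fun j hj _ h => hl ⟨j, hj, by simpa using h⟩

end Loops

/-! ### Coefficients of products -/

lemma coeff_mod_X_pow (p : K[X]) {n i : ℕ} (h : i < n) : (p %ₘ X ^ n).coeff i = p.coeff i := by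
  conv_rhs => rw [← modByMonic_add_div p (X ^ n)]
  rw [coeff_add, coeff_X_pow_mul', if_neg (by omega), add_zero]

lemma coeff_div_X_pow (p : K[X]) (n i : ℕ) : (p /ₘ X ^ n).coeff i = p.coeff (n + i) := by
  nontriviality K
  have h0 : (p %ₘ X ^ n).coeff (n + i) = 0 := by
    refine coeff_eq_zero_of_degree_lt ((degree_modByMonic_lt _ (monic_X_pow n)).trans_le ?_)
    rw [degree_X_pow]
    exact_mod_cast Nat.le_add_right _ _
  conv_rhs => rw [← modByMonic_add_div p (X ^ n)]
  rw [coeff_add, coeff_X_pow_mul', if_pos (by omega), h0, zero_add, Nat.add_sub_cancel_left]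

lemma coeff_poly_mul_poly (F G : Area) (μ μ' : ℕ → K) {i : ℕ} (hF : i < F.len) (hG : i < G.len) :
    (F.poly μ * G.poly μ').coeff i =
      ∑ j ∈ Finset.range (i + 1), μ (F.addr j) * μ' (G.addr (i - j)) := by
  rw [coeff_mul, Finset.Nat.sum_antidiagonal_eq_sum_range_succ
    (fun a b => (F.poly μ).coeff a * (G.poly μ').coeff b)]
  refine Finset.sum_congr rfl fun j hj => ?_
  rw [Finset.mem_range] at hj
  rw [Area.coeff_poly, Area.coeff_poly, if_pos (by omega), if_pos (by omega)]

/-- In the degrees n−1, …, 2n−2 every coefficient of G meets an existing coefficient of F, so the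
sum always has exactly n terms. -/
lemma coeff_poly_mul_poly_middle (F G : Area) (μ : ℕ → K) {i n : ℕ} (hF : F.len = 2 * n - 1)
    (hG : G.len = n) (hi : i < n) :
    (F.poly μ * G.poly μ).coeff (n - 1 + i) =
      ∑ j ∈ Finset.range n, μ (G.addr j) * μ (F.addr (n - 1 + i - j)) := by
  rw [mul_comm, coeff_mul, Finset.Nat.sum_antidiagonal_eq_sum_range_succ
    (fun a b => (G.poly μ).coeff a * (F.poly μ).coeff b)]
  rw [← Finset.sum_subset (Finset.range_subset_range.2 (by omega : n ≤ n - 1 + i + 1))]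
  · refine Finset.sum_congr rfl fun j hj => ?_
    rw [Finset.mem_range] at hj
    rw [Area.coeff_poly, Area.coeff_poly, if_pos (by omega), if_pos (by omega)]
  · intro j _ hj
    rw [Finset.mem_range] at hj
    rw [Area.coeff_poly, if_neg (by omega), zero_mul]

/-- Extension of a power series quotient `q = f / g` from precision `k` to precision `k + n`, given
the inverse `r` of `g` to precision `n`. -/
lemma quotient_extend (g f q r : ℕ → K) (k n : ℕ)
    (hr : ∀ u < n, ∑ v ∈ Finset.range (u + 1), r v * g (u - v) = if u = 0 then 1 else 0)
    (hq : ∀ u < n, q (k + u) = ∑ v ∈ Finset.range (u + 1),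
      (f (k + v) - ∑ j ∈ Finset.range k, q j * g (k + v - j)) * r (u - v)) :
    ∀ u < n, ∑ j ∈ Finset.range (k + u + 1), q j * g (k + u - j) = f (k + u) := by
  -- F is the residual of f after the known k coefficients, shifted down by k. Modulo X^n the
  -- hypotheses read Q = FR and RG = 1, whence QG = F.
  set F := PowerSeries.mk fun v => f (k + v) - ∑ j ∈ Finset.range k, q j * g (k + v - j) with hF
  set Q := PowerSeries.mk fun v => q (k + v) with hQ
  set R := PowerSeries.mk r with hR
  set G := PowerSeries.mk g with hG
  have h1 : PowerSeries.X ^ n ∣ Q - F * R := by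
    rw [PowerSeries.X_pow_dvd_iff]
    intro u hu
    rw [map_sub, PowerSeries.coeff_mul, Finset.Nat.sum_antidiagonal_eq_sum_range_succ
      (fun a b => PowerSeries.coeff a F * PowerSeries.coeff b R)]
    simp only [hF, hQ, hR, PowerSeries.coeff_mk]
    rw [hq u hu, sub_self]
  have h2 : PowerSeries.X ^ n ∣ R * G - 1 := by
    rw [PowerSeries.X_pow_dvd_iff]
    intro u hu
    rw [map_sub, PowerSeries.coeff_mul, Finset.Nat.sum_antidiagonal_eq_sum_range_succ
      (fun a b => PowerSeries.coeff a R * PowerSeries.coeff b G), PowerSeries.coeff_one]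
    simp only [hR, hG, PowerSeries.coeff_mk]
    rw [hr u hu, sub_self]
  have h3 : PowerSeries.X ^ n ∣ Q * G - F := by
    have : Q * G - F = (Q - F * R) * G + F * (R * G - 1) := by ring
    rw [this]
    exact dvd_add (h1.mul_right _) (h2.mul_left _)
  intro u hu
  have h4 := PowerSeries.X_pow_dvd_iff.1 h3 u hu
  rw [map_sub, PowerSeries.coeff_mul, Finset.Nat.sum_antidiagonal_eq_sum_range_succ
      (fun a b => PowerSeries.coeff a Q * PowerSeries.coeff b G)] at h4
  simp only [hF, hQ, hG, PowerSeries.coeff_mk] at h4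
  rw [add_assoc, Finset.sum_range_add]
  have h5 : ∑ x ∈ Finset.range (u + 1), q (k + x) * g (k + u - (k + x)) =
      ∑ x ∈ Finset.range (u + 1), q (k + x) * g (u - x) :=
    Finset.sum_congr rfl fun x _ => by rw [Nat.add_sub_add_left]
  rw [h5]
  linear_combination h4

/-! ### Specifications in terms of coefficients -/

/-- Short products, with explicit constants for the extra space and the word size. -/
def ComputesSP (p : Prog K) (T S : ℕ → ℝ) (d w : ℕ) : Prop :=
  ∀ n W : ℕ, 1 ≤ n → w * n ≤ W → ∀ (F G O E : Area) (μ : ℕ → K),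
    F.len = n → G.len = n → O.len = n → S n + d ≤ E.len → Layout [F, G] [O, E] →
    Runs W p [n] [F, G] [O, E] μ (T n) fun μ' => ∀ i < n,
      μ' (O.addr i) = ∑ j ∈ Finset.range (i + 1), μ (F.addr j) * μ (G.addr (i - j))

/-- Middle products, with explicit constants for the extra space and the word size. -/
def ComputesMP (p : Prog K) (T S : ℕ → ℝ) (d w : ℕ) : Prop :=
  ∀ n W : ℕ, 1 ≤ n → w * n ≤ W → ∀ (F G O E : Area) (μ : ℕ → K),
    F.len = 2 * n - 1 → G.len = n → O.len = n → S n + d ≤ E.len → Layout [F, G] [O, E] →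
    Runs W p [n] [F, G] [O, E] μ (T n) fun μ' => ∀ i < n,
      μ' (O.addr i) = ∑ j ∈ Finset.range n, μ (G.addr j) * μ (F.addr (n - 1 + i - j))

/-- Coefficient sums mention the cells themselves, so they carry over directly to slices and
reversals of areas. -/
lemma IsShortProduct.computesSP {p : Prog K} {T S : ℕ → ℝ} (h : IsShortProduct p T S) :
    ∃ d w, ComputesSP p T S d w := by
  obtain ⟨d, w, h⟩ := h
  refine ⟨d, w, fun n W h1 h2 F G O E μ hF hG hO hE hL =>
    (h n W h1 h2 F G O E μ hF hG hO hE hL).mono le_rfl fun μ' hp i hi => ?_⟩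
  have := congrArg (fun P => coeff P i) hp
  simp only [shortProduct] at this
  rwa [Area.coeff_poly, if_pos (by omega), coeff_mod_X_pow _ hi,
    coeff_poly_mul_poly _ _ _ _ (by omega) (by omega)] at this

lemma IsMiddleProduct.computesMP {p : Prog K} {T S : ℕ → ℝ} (h : IsMiddleProduct p T S) :
    ∃ d w, ComputesMP p T S d w := by
  obtain ⟨d, w, h⟩ := h
  refine ⟨d, w, fun n W h1 h2 F G O E μ hF hG hO hE hL =>
    (h n W h1 h2 F G O E μ hF hG hO hE hL).mono le_rfl fun μ' hp i hi => ?_⟩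
  have := congrArg (fun P => coeff P i) hp
  simp only [middleProduct] at this
  rwa [Area.coeff_poly, if_pos (by omega), coeff_mod_X_pow _ hi, coeff_div_X_pow,
    coeff_poly_mul_poly_middle _ _ _ hF hG hi] at this

/-- The division with erasing, in terms of coefficients. -/
lemma isDivErase_iff {p : Prog K} {T : ℕ → ℝ} : IsDivErase p T ↔
    ∃ d w : ℕ, ∀ n W : ℕ, 1 ≤ n → w * n ≤ W → ∀ (G F Q E : Area) (μ : ℕ → K),
      G.len = n → F.len = n → Q.len = n → d ≤ E.len → Layout [G] [F, Q, E] →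
      IsUnit (μ (G.addr 0)) →
      Runs W p [n] [G] [F, Q, E] μ (T n) fun μ' => ∀ i < n,
        ∑ j ∈ Finset.range (i + 1), μ' (Q.addr j) * μ (G.addr (i - j)) = μ (F.addr i) := by
  have key : ∀ (n : ℕ) (G F Q : Area) (μ μ' : ℕ → K), G.len = n → F.len = n → Q.len = n →
      (X ^ n ∣ G.poly μ * Q.poly μ' - F.poly μ ↔ ∀ i < n,
        ∑ j ∈ Finset.range (i + 1), μ' (Q.addr j) * μ (G.addr (i - j)) = μ (F.addr i)) := by
    intro n G F Q μ μ' hG hF hQ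
    rw [X_pow_dvd_iff]
    refine forall₂_congr fun i hi => ?_
    rw [coeff_sub, mul_comm, coeff_poly_mul_poly _ _ _ _ (by omega) (by omega), Area.coeff_poly,
      if_pos (by omega), sub_eq_zero]
  constructor
  · rintro ⟨d, w, h⟩
    exact ⟨d, w, fun n W h1 h2 G F Q E μ hG hF hQ hE hL hu =>
      (h n W h1 h2 G F Q E μ hG hF hQ hE hL hu).mono le_rfl fun μ' =>
        (key n G F Q μ μ' hG hF hQ).1⟩
  · rintro ⟨d, w, h⟩
    exact ⟨d, w, fun n W h1 h2 G F Q E μ hG hF hQ hE hL hu =>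
      (h n W h1 h2 G F Q E μ hG hF hQ hE hL hu).mono le_rfl fun μ' =>
        (key n G F Q μ μ' hG hF hQ).2⟩

/-! ### Layouts -/

lemma layout_two_two {a b o e : Area} (ha : a.writable = false) (hb : b.writable = false)
    (ho : o.Free) (he : e.Free) (hoe : Disjoint o.cells e.cells)
    (hao : Disjoint a.cells o.cells) (hae : Disjoint a.cells e.cells)
    (hbo : Disjoint b.cells o.cells) (hbe : Disjoint b.cells e.cells) :
    Layout [a, b] [o, e] := by
  simp only [layout_iff, List.mem_cons, List.not_mem_nil, or_false, forall_eq_or_imp, forall_eq,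
    List.pairwise_cons, List.Pairwise.nil, and_true, IsEmpty.forall_iff, implies_true]
  exact ⟨⟨ha, hb⟩, ⟨ho, he⟩, hoe, ⟨hao, hae⟩, hbo, hbe⟩

lemma layout_two_two_iff {a b o e : Area} : Layout [a, b] [o, e] ↔
    (a.writable = false ∧ b.writable = false) ∧ (o.Free ∧ e.Free) ∧ Disjoint o.cells e.cells ∧
    (Disjoint a.cells o.cells ∧ Disjoint a.cells e.cells) ∧
    Disjoint b.cells o.cells ∧ Disjoint b.cells e.cells := by
  simp [layout_iff]

lemma layout_one_three_iff {g a b c : Area} : Layout [g] [a, b, c] ↔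
    g.writable = false ∧ (a.Free ∧ b.Free ∧ c.Free) ∧
    ((Disjoint a.cells b.cells ∧ Disjoint a.cells c.cells) ∧ Disjoint b.cells c.cells) ∧
    Disjoint g.cells a.cells ∧ Disjoint g.cells b.cells ∧ Disjoint g.cells c.cells := by
  simp [layout_iff]

/-! ### Quadratic extension of a quotient -/

/-- Adds to the accumulator, entry 1 of area 3, the products of the quotient with the divisor. -/
def accumulateProg (K : Type*) : Prog K :=
  .whileLt (.var 2) (.var 0) <|
    .seq (.op .mul ⟨3, .lit 2⟩ ⟨2, .var 2⟩ ⟨0, .minus (.var 0) (.var 2)⟩) <|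
    .seq (.op .sub ⟨3, .lit 1⟩ ⟨3, .lit 1⟩ ⟨3, .lit 2⟩) <|
    .setPtr 2 (.plus (.var 2) (.lit 1))

/-- `Q_{[k..e[}` of the quotient `F / G`, from `Q_{[0..k[}`, where `G`, `F`, `Q` are the areas 0, 1,
2, where `k` and `e` are the arguments, and where area 3 has three auxiliary cells. -/
def extendProg (K : Type*) : Prog K :=
  .seq (.inv ⟨3, .lit 0⟩ ⟨0, .lit 0⟩) <|
  .whileLt (.var 0) (.var 1) <|
    .seq (.copy ⟨3, .lit 1⟩ ⟨1, .var 0⟩) <|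
    .seq (.setPtr 2 (.lit 0)) <|
    .seq (accumulateProg K) <|
    .seq (.op .mul ⟨2, .var 0⟩ ⟨3, .lit 1⟩ ⟨3, .lit 0⟩) <|
    .setPtr 0 (.plus (.var 0) (.lit 1))

section

variable {W : ℕ} {G F Q E : Area} {μ : ℕ → K}

lemma wp_accumulateProg {Φ : (ℕ → ℕ) → (ℕ → K) → ℕ → Prop} {ν : ℕ → ℕ} (hW : ν 0 ≤ W)
    (hG : ν 0 < G.len) (hQ : ν 0 < Q.len) (hE : 3 ≤ E.len) (h2 : ν 2 = 0)
    (hL : Layout [G, F] [Q, E])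
    (hΦ : ∀ ν' μ', ν' 0 = ν 0 → ν' 1 = ν 1 → μ' (E.addr 1) =
      μ (E.addr 1) - ∑ j ∈ Finset.range (ν 0), μ (Q.addr j) * μ (G.addr (ν 0 - j)) →
      (∀ l, l ≠ E.addr 1 → l ≠ E.addr 2 → μ' l = μ l) → Φ ν' μ' (2 * ν 0)) :
    Wp W (accumulateProg K) (frame [G, F, Q, E]) ν μ Φ := by
  obtain ⟨-, ⟨hQf, hEf⟩, hQE, ⟨hGQ, hGE⟩, -⟩ := layout_two_two_iff.1 hL
  have hne : E.addr 1 ≠ E.addr 2 := fun h => by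
    have := hEf.2 _ _ (by omega) (by omega) h; omega
  refine Wp.whileLt (ν 0) (fun i ν' μ' s => ν' 0 = ν 0 ∧ ν' 1 = ν 1 ∧ ν' 2 = i ∧ s = 2 * i ∧
    μ' (E.addr 1) = μ (E.addr 1) - ∑ j ∈ Finset.range i, μ (Q.addr j) * μ (G.addr (ν 0 - j)) ∧
    ∀ l, l ≠ E.addr 1 → l ≠ E.addr 2 → μ' l = μ l) ?_ ?_ ?_
  · exact ⟨rfl, rfl, h2, rfl, by simp, fun _ _ _ => rfl⟩
  · rintro i hi ν' μ' s ⟨h0, h1, rfl, rfl, h3, h4⟩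
    refine ⟨by simpa [NExpr.eval, h0] using hi, Wp.seq (Wp.op ?_ ?_ ?_ (Wp.seq (Wp.op ?_ ?_ ?_
      (Wp.setPtr ?_ ?_))))⟩
    · exact ⟨by simp [NExpr.eval]; omega, hEf.1⟩
    · simp [Ref.CanRead, NExpr.eval]; omega
    · simp [Ref.CanRead, NExpr.eval]; omega
    · exact ⟨by simp [NExpr.eval]; omega, hEf.1⟩
    · simp [Ref.CanRead, NExpr.eval]; omega
    · simp [Ref.CanRead, NExpr.eval]; omega
    · simp [NExpr.eval]; omega
    · have e1 : ∀ l, l ∉ E.cells → μ' l = μ l := fun l hl => h4 l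
        (fun h => hl (h ▸ E.addr_mem (by omega))) (fun h => hl (h ▸ E.addr_mem (by omega)))
      have eQ : μ' (Q.addr (ν' 2)) = μ (Q.addr (ν' 2)) :=
        e1 _ (Set.disjoint_left.1 hQE (Q.addr_mem (by omega)))
      have eG : μ' (G.addr (ν 0 - ν' 2)) = μ (G.addr (ν 0 - ν' 2)) :=
        e1 _ (Set.disjoint_left.1 hGE (G.addr_mem (by omega)))
      refine ⟨by simpa using h0, by simpa using h1, by simp [NExpr.eval], by ring, ?_, ?_⟩
      · simp only [Ref.addr, NExpr.eval, frame_zero, frame_two, frame_three, Op.eval,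
          Function.update_self]
        rw [Function.update_of_ne hne, h3, h0, eQ, eG, Finset.sum_range_succ]
        ring
      · intro l hl1 hl2
        simp only [Ref.addr, NExpr.eval, frame_zero, frame_two, frame_three]
        rw [Function.update_of_ne hl1, Function.update_of_ne hl2, h4 l hl1 hl2]
  · rintro ν' μ' s ⟨h0, h1, h2, rfl, h3, h4⟩
    exact ⟨by simp [NExpr.eval, h0, h2], hΦ _ _ h0 h1 h3 h4⟩

/-- The coefficient of index t is (f_t − Σ_{j<t} q_j g_{t−j})/g_0 and takes 2t+1 ≤ 2e operations;
the last summand 1 is the inversion of g_0. The cost is quadratic in general, but linear in e when e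
− k is bounded. -/
lemma runs_extendProg {k e : ℕ} (hke : k ≤ e) (he : 1 ≤ e) (hW : e ≤ W) (hG : e ≤ G.len)
    (hF : e ≤ F.len) (hQ : e ≤ Q.len) (hE : 3 ≤ E.len) (hL : Layout [G, F] [Q, E])
    (hu : IsUnit (μ (G.addr 0))) :
    Runs W (extendProg K) [k, e] [G, F] [Q, E] μ ((e - k : ℕ) * (2 * e) + 1) fun μ' =>
      (∀ j < k, μ' (Q.addr j) = μ (Q.addr j)) ∧ ∀ t, k ≤ t → t < e →
        ∑ j ∈ Finset.range (t + 1), μ' (Q.addr j) * μ (G.addr (t - j)) = μ (F.addr t) := by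
  have hL' := hL
  obtain ⟨-, ⟨hQf, hEf⟩, hQE, ⟨hGQ, hGE⟩, hFQ, hFE⟩ := layout_two_two_iff.1 hL
  have hEn : ∀ i j, i < 3 → j < 3 → i ≠ j → E.addr i ≠ E.addr j := fun i j hi hj hij h =>
    hij (hEf.2 _ _ (by omega) (by omega) h)
  have hQEn : ∀ i j, i < e → j < 3 → Q.addr i ≠ E.addr j := fun i j hi hj h =>
    Set.disjoint_left.1 hQE (Q.addr_mem (by omega : i < Q.len))
      (h ▸ E.addr_mem (by omega : j < E.len))
  refine Runs.of_wp (Wp.seq (Wp.inv ?_ ?_ hu fun x hx => ?_))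
  · exact ⟨by simp [NExpr.eval]; omega, hEf.1⟩
  · simp [Ref.CanRead, NExpr.eval]; omega
  simp only [Ref.addr, NExpr.eval, List.cons_append, List.nil_append, frame_zero, frame_three] at hx ⊢
  have hframe : ∀ (μ' : ℕ → K), (∀ l, l ∉ Q.cells → l ∉ E.cells → μ' l = μ l) →
      (∀ t < e, μ' (G.addr t) = μ (G.addr t)) ∧ ∀ t < e, μ' (F.addr t) = μ (F.addr t) :=
    fun μ' h => ⟨fun t ht => h _ (Set.disjoint_left.1 hGQ (G.addr_mem (by omega)))
      (Set.disjoint_left.1 hGE (G.addr_mem (by omega))), fun t ht => h _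
      (Set.disjoint_left.1 hFQ (F.addr_mem (by omega)))
      (Set.disjoint_left.1 hFE (F.addr_mem (by omega)))⟩
  refine Wp.whileLt (e - k) (fun i ν' μ' s => ν' 0 = k + i ∧ ν' 1 = e ∧ s ≤ i * (2 * e) ∧
    μ' (E.addr 0) = x ∧ (∀ l, l ∉ Q.cells → l ∉ E.cells → μ' l = μ l) ∧
    (∀ j < k, μ' (Q.addr j) = μ (Q.addr j)) ∧ ∀ t, k ≤ t → t < k + i →
        ∑ j ∈ Finset.range (t + 1), μ' (Q.addr j) * μ (G.addr (t - j)) = μ (F.addr t)) ?_ ?_ ?_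
  · refine ⟨rfl, rfl, by simp, by simp, fun l _ hl => ?_, fun j hj => ?_, fun t _ _ => by omega⟩
    · rw [Function.update_of_ne]
      rintro rfl
      exact hl (E.addr_mem (by omega))
    · rw [Function.update_of_ne (hQEn _ _ (by omega) (by omega))]
  · rintro i hi ν μ1 s ⟨h0, h1, hs, hx1, hfr, hQk, hsol⟩
    refine ⟨by simp [NExpr.eval, h0, h1]; omega, Wp.seq (Wp.copy ?_ ?_ (Wp.seq (Wp.setPtr ?_
      (Wp.seq ?_))))⟩
    · exact ⟨by simp [NExpr.eval]; omega, hEf.1⟩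
    · simp [Ref.CanRead, NExpr.eval, h0]; omega
    · simp [NExpr.eval]
    refine wp_accumulateProg (F := F) ?_ ?_ ?_ hE (by simp [NExpr.eval]) hL' ?_
    · simp [h0]; omega
    · simp [h0]; omega
    · simp [h0]; omega
    intro ν2 μ2 h20 h21 hacc hfr2
    simp only [Ref.addr, NExpr.eval, frame_one, frame_three, h0, Function.update_self,
      Function.update_of_ne (show (0 : ℕ) ≠ 2 by omega),
      Function.update_of_ne (show (1 : ℕ) ≠ 2 by omega)] at h20 h21 hacc hfr2 ⊢
    have hμ2 : ∀ l, l ≠ E.addr 1 → l ≠ E.addr 2 → μ2 l = μ1 l := fun l hl hl' => by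
      rw [hfr2 l hl hl', Function.update_of_ne hl]
    have hfr2' : ∀ l, l ∉ Q.cells → l ∉ E.cells → μ2 l = μ l := fun l hl hl' => by
      rw [hμ2 l (fun h => hl' (h ▸ E.addr_mem (by omega)))
        (fun h => hl' (h ▸ E.addr_mem (by omega))), hfr l hl hl']
    refine Wp.seq (Wp.op ?_ ?_ ?_ (Wp.setPtr ?_ ?_))
    · exact ⟨by simp [NExpr.eval, h20]; omega, hQf.1⟩
    · simp [Ref.CanRead, NExpr.eval]; omega
    · simp [Ref.CanRead, NExpr.eval]; omega
    · simp [NExpr.eval, h20]; omega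
    have hold : ∀ j < k + i, μ2 (Q.addr j) = μ1 (Q.addr j) := fun j hj =>
      hμ2 _ (hQEn _ _ (by omega) (by omega)) (hQEn _ _ (by omega) (by omega))
    have hQne : ∀ j < k + i, Q.addr j ≠ Q.addr (k + i) := fun j hj h => by
      have := hQf.2 _ _ (by omega) (by omega) h; omega
    refine ⟨by simp [NExpr.eval, h20]; omega, by simp [h21, h1], ?_, ?_, ?_, ?_, ?_⟩
    · have : k + i + 1 ≤ e := by omega
      nlinarith
    · simp only [Ref.addr, NExpr.eval, frame_two, frame_three, h20]
      rw [Function.update_of_ne (hQEn _ _ (by omega) (by omega)).symm,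
        hμ2 _ (hEn _ _ (by omega) (by omega) (by omega)) (hEn _ _ (by omega) (by omega) (by omega)),
        hx1]
    · intro l hl hl'
      simp only [Ref.addr, NExpr.eval, frame_two, frame_three, h20]
      rw [Function.update_of_ne, hfr2' l hl hl']
      rintro rfl
      exact hl (Q.addr_mem (by omega))
    · intro j hj
      simp only [Ref.addr, NExpr.eval, frame_two, frame_three, h20]
      rw [Function.update_of_ne (hQne j (by omega)), hold j (by omega), hQk j hj]
    · intro t hkt ht
      simp only [Ref.addr, NExpr.eval, frame_two, frame_three, h20, Op.eval]
      have hsum : ∀ t' ≤ k + i, ∑ j ∈ Finset.range t', Function.update μ2 (Q.addr (k + i))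
          (μ2 (E.addr 1) * μ2 (E.addr 0)) (Q.addr j) * μ (G.addr (t - j)) =
          ∑ j ∈ Finset.range t', μ1 (Q.addr j) * μ (G.addr (t - j)) := by
        intro t' ht'
        refine Finset.sum_congr rfl fun j hj => ?_
        rw [Finset.mem_range] at hj
        rw [Function.update_of_ne (hQne j (by omega)), hold j (by omega)]
      rcases (by omega : t < k + i ∨ t = k + i) with h | rfl
      · rw [hsum _ (by omega), hsol t hkt h]
      · rw [Finset.sum_range_succ, hsum _ le_rfl, Function.update_self, Nat.sub_self, hacc,
          hμ2 _ (hEn _ _ (by omega) (by omega) (by omega))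
            (hEn _ _ (by omega) (by omega) (by omega)), hx1, (hframe μ1 hfr).2 _ (by omega)]
        have : ∑ j ∈ Finset.range (k + i), Function.update μ1 (E.addr 1) (μ (F.addr (k + i)))
            (Q.addr j) * Function.update μ1 (E.addr 1) (μ (F.addr (k + i)))
              (G.addr (k + i - j)) =
            ∑ j ∈ Finset.range (k + i), μ1 (Q.addr j) * μ (G.addr (k + i - j)) := by
          refine Finset.sum_congr rfl fun j hj => ?_
          rw [Finset.mem_range] at hj
          rw [Function.update_of_ne (hQEn _ _ (by omega) (by omega)), Function.update_of_ne,
            (hframe μ1 hfr).1 _ (by omega)]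
          intro h
          exact Set.disjoint_left.1 hGE (G.addr_mem (by omega : k + i - j < G.len))
            (h ▸ E.addr_mem (by omega))
        rw [this]
        -- The new coefficient is the residual times x, and g_0 x = 1.
        linear_combination (μ (F.addr (k + i)) - ∑ j ∈ Finset.range (k + i),
          μ1 (Q.addr j) * μ (G.addr (k + i - j))) * hx
  · rintro ν' μ' s ⟨h0, h1, hs, hx1, hfr, hQk, hsol⟩
    refine ⟨by simp [NExpr.eval, h0, h1]; omega, ?_, ?_, hQk, fun t h1 h2 => hsol t h1 (by omega)⟩
    · push_cast
      have : (s : ℝ) ≤ ((e - k : ℕ) : ℝ) * (2 * e) := by exact_mod_cast hs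
      linarith
    · intro l hl
      simp only [List.mem_cons, List.not_mem_nil, or_false, forall_eq_or_imp, forall_eq] at hl
      exact hfr l hl.1 hl.2

end

/-- Together with `ComputesMP.mono`, this gives the two product routines common constants for space
and word size. -/
lemma ComputesSP.mono {p : Prog K} {T T' S S' : ℕ → ℝ} {d d' w w' : ℕ}
    (h : ComputesSP p T S d w) (hT : ∀ n, 1 ≤ n → T n ≤ T' n) (hS : ∀ n, S n ≤ S' n) (hd : d ≤ d')
    (hw : w ≤ w') : ComputesSP p T' S' d' w' := by
  intro n W hn hW F G O E μ hF hG hO hE hL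
  refine (h n W hn ((Nat.mul_le_mul_right n hw).trans hW) F G O E μ hF hG hO ?_ hL).mono (hT n hn)
    fun _ => id
  have : (d : ℝ) ≤ d' := by exact_mod_cast hd
  linarith [hS n]

lemma ComputesMP.mono {p : Prog K} {T T' S S' : ℕ → ℝ} {d d' w w' : ℕ}
    (h : ComputesMP p T S d w) (hT : ∀ n, 1 ≤ n → T n ≤ T' n) (hS : ∀ n, S n ≤ S' n) (hd : d ≤ d')
    (hw : w ≤ w') : ComputesMP p T' S' d' w' := by
  intro n W hn hW F G O E μ hF hG hO hE hL
  refine (h n W hn ((Nat.mul_le_mul_right n hw).trans hW) F G O E μ hF hG hO ?_ hL).mono (hT n hn)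
    fun _ => id
  have : (d : ℝ) ≤ d' := by exact_mod_cast hd
  linarith [hS n]

/-! ### Short products as middle products -/

/-- The short product as a middle product, where the first factor is preceded by zeros. -/
def shortOfMiddle (mp : Prog K) : Prog K :=
  .seq (.const ⟨3, .lit 0⟩ 0) <|
  .call mp [.var 0]
    [.append (.fill (.param 3) (.minus (.var 0) (.lit 1))) (.param 0), .param 1, .param 2,
      .drop (.param 3) (.lit 1)]

/-- The degrees n−1, …, 2n−2 of (X^{n−1}F)·G are the degrees 0, …, n−1 of FG. The n−1 padding zeros
are one cell seen repeatedly through `fill`, which is the extra cell in d + 1. -/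
lemma ComputesMP.computesSP {mp : Prog K} {T S : ℕ → ℝ} {d w : ℕ} (hS : ∀ n, 0 ≤ S n)
    (h : ComputesMP mp T S d w) : ComputesSP (shortOfMiddle mp) T S (d + 1) (w + 1) := by
  intro n W hn hW F G O E μ hF hG hO hE hL
  obtain ⟨⟨hFw, hGw⟩, ⟨hOf, hEf⟩, hOE, ⟨hFO, hFE⟩, hGO, hGE⟩ := layout_two_two_iff.1 hL
  have hE' : 1 ≤ E.len := by
    have : (1 : ℝ) ≤ E.len := by
      push_cast at hE
      linarith [hS n, (Nat.cast_nonneg d : (0 : ℝ) ≤ d)]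
    exact_mod_cast this
  have hE1 : S n + d ≤ (E.slice 1 (E.len - 1)).len := by
    simp only [Area.slice_len]
    rw [Nat.cast_sub hE']
    push_cast at hE ⊢
    linarith
  have hdis : Disjoint (E.rep (n - 1)).cells (E.slice 1 (E.len - 1)).cells := by
    rw [Set.disjoint_left]
    rintro l ⟨i, hi, rfl⟩
    exact hEf.addr_notMem_slice (by omega) (by omega) (by omega)
  refine Runs.of_wp (Wp.seq (Wp.const ⟨by simp [NExpr.eval]; omega, hEf.1⟩ ?_))
  simp only [List.cons_append, List.nil_append, Ref.addr, NExpr.eval, frame_three]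
  refine Wp.call_two (h n W hn (le_trans (by gcongr; omega) hW)
    ((E.rep (n - 1)).app F) G O (E.slice 1 (E.len - 1)) _ ?_ hG hO hE1 ?_) ?_ ?_
    (map_four ?_ rfl rfl (eval_drop rfl rfl)) ?_
  · simp [hF]; omega
  · refine layout_two_two rfl hGw hOf (hEf.slice (by omega))
      (Area.disjoint_slice hOE (by omega)) ?_ ?_ hGO (Area.disjoint_slice hGE (by omega))
    · rw [Area.cells_app, Set.disjoint_union_left]
      exact ⟨(hOE.symm).mono_left (E.cells_rep_subset hE'), hFO⟩
    · rw [Area.cells_app, Set.disjoint_union_left]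
      exact ⟨hdis, Area.disjoint_slice hFE (by omega)⟩
  · simp only [List.mem_singleton, forall_eq, NExpr.eval, pointers_zero]
    nlinarith
  · simp [NExpr.eval]
  · rw [eval_append, eval_fill (A := E) (n := n - 1) rfl (by simp [NExpr.eval]) hE']
    rfl
  · intro μ' t ht hf hp
    have hupd : ∀ l, l ∉ E.cells → Function.update μ (E.addr 0) 0 l = μ l := fun l hl => by
      rw [Function.update_of_ne]
      rintro rfl
      exact hl (E.addr_mem hE')
    refine ⟨by simpa using ht, fun l hl => ?_, fun i hi => ?_⟩
    · simp only [List.mem_cons, List.not_mem_nil, or_false, forall_eq_or_imp, forall_eq] at hl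
      rw [hf l hl.1 (Area.notMem_slice hl.2 (by omega)), hupd l hl.2]
    · rw [hp i hi, ← Finset.sum_flip,
        ← Finset.sum_subset (Finset.range_subset_range.2 (by omega : i + 1 ≤ n))]
      · refine Finset.sum_congr rfl fun j hj => ?_
        rw [Finset.mem_range] at hj
        rw [Area.app_addr_right _ _ (by simp; omega), hupd _ (Area.addr_notMem hGE (by omega)),
          hupd _ (Area.addr_notMem hFE (by simp; omega)), mul_comm, Area.rep_len,
          show n - 1 + i - j - (n - 1) = i - j by omega, show i - (i - j) = j by omega]
      -- The terms with j > i fall into the zero padding.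
      · intro j hj hj'
        rw [Finset.mem_range] at hj hj'
        rw [Area.app_addr_left _ _ (by simp; omega)]
        simp

/-! ### Inversion of power series -/

/-- One Newton step of `inverseProg`, from precision `var 2` to precision `var 0 / (var 1 / 2)`. -/
def inverseStep (mp sp : Prog K) : Prog K :=
  .seq (.call mp [.var 2]
    [(View.param 0).chunk (.lit 1) (.times (.lit 2) (.var 2)),
      .readOnly ((View.param 1).chunk (.lit 0) (.var 2)),
      (View.param 2).chunk (.lit 4) (.plus (.lit 4) (.var 2)),
      .drop (.param 2) (.plus (.lit 4) (.var 2))]) <|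
  .seq (.call sp [.var 2]
    [.readOnly ((View.param 2).chunk (.lit 4) (.plus (.lit 4) (.var 2))),
      .readOnly ((View.param 1).chunk (.lit 0) (.var 2)),
      (View.param 1).chunk (.var 2) (.times (.lit 2) (.var 2)),
      .drop (.param 2) (.plus (.lit 4) (.var 2))]) <|
  .seq (.call (subProg K) [.var 2]
    [.fill (.param 2) (.var 2), (View.param 1).chunk (.var 2) (.times (.lit 2) (.var 2)),
      (View.param 1).chunk (.var 2) (.times (.lit 2) (.var 2))]) <|
  .seq (.setPtr 1 (.quot (.var 1) (.lit 2))) <|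
  .seq (.call (extendProg K) [.times (.lit 2) (.var 2), .quot (.var 0) (.var 1)]
    [.param 0, .fill (.param 2) (.var 0), .param 1, (View.param 2).chunk (.lit 1) (.lit 4)]) <|
  .setPtr 2 (.quot (.var 0) (.var 1))

/-- The inverse of the power series in area 0, in area 1, to the precision given by the argument;
area 2 is the work space. -/
def inverseProg (mp sp : Prog K) : Prog K :=
  .seq (.const ⟨2, .lit 0⟩ 0) <|
  .seq (.inv ⟨1, .lit 0⟩ ⟨0, .lit 0⟩) <|
  .seq (.setPtr 1 (.lit 1)) <|
  .seq (.whileLt (.times (.lit 2) (.var 1)) (.plus (.var 0) (.lit 1))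
    (.setPtr 1 (.times (.lit 2) (.var 1)))) <|
  .seq (.setPtr 2 (.lit 1)) <|
  .whileLt (.lit 1) (.var 1) (inverseStep mp sp)

/-- `r` is the inverse of `g` to precision `n`. -/
def IsInverse (g r : ℕ → K) (n : ℕ) : Prop :=
  ∀ u < n, ∑ v ∈ Finset.range (u + 1), r v * g (u - v) = if u = 0 then 1 else 0

section

variable {mp sp : Prog K} {T T' : ℕ → ℝ} {cm α β : ℝ} {d w W n : ℕ} {G O E : Area} {μ : ℕ → K}

/-- Newton iteration: if Gr = 1 + X^k s, then r − X^k(rs mod X^k) is the inverse to precision 2k,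
and s mod X^k is the middle product of G_{[1..2k[} with r. When k' = 2k+1, the missing coefficient
comes from `extendProg`. The cells of E are a zero, three auxiliary cells for `extendProg`, k cells
for s, and work space for the products. -/
lemma wp_inverseStep (hcm : 0 ≤ cm) (hmp : ComputesMP mp T (fun n => cm * n) d w)
    (hsp : ComputesSP sp T' (fun n => cm * n) d w)
    (hT : ∀ a, 1 ≤ a → a ≤ n → T a ≤ α * a) (hT' : ∀ a, 1 ≤ a → a ≤ n → T' a ≤ β * a)
    (hW : n ≤ W) (hwW : w * n ≤ W) (hG : n ≤ G.len) (hO : n ≤ O.len)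
    (hE : 4 + n + cm * n + d ≤ E.len) (hGw : G.writable = false) (hOf : O.Free) (hEf : E.Free)
    (hOE : Disjoint O.cells E.cells) (hGO : Disjoint G.cells O.cells)
    (hGE : Disjoint G.cells E.cells) (hu : IsUnit (μ (G.addr 0))) {ν : ℕ → ℕ} {P k k' : ℕ}
    (h0 : ν 0 = n) (h1 : ν 1 = P) (h2 : ν 2 = k) (hk : 1 ≤ k) (hP : P ≤ n)
    (hk' : n / (P / 2) = k') (hk1 : 2 * k ≤ k') (hk2 : k' ≤ 2 * k + 1) (hkn : k' ≤ n)
    (hz : μ (E.addr 0) = 0) (hr : IsInverse (fun i => μ (G.addr i)) (fun i => μ (O.addr i)) k) :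
    Wp W (inverseStep mp sp) (frame [G, O, E]) ν μ fun ν' μ' t =>
      ν' 0 = n ∧ ν' 1 = P / 2 ∧ ν' 2 = k' ∧ (t : ℝ) ≤ (α + β + 8) * k ∧ μ' (E.addr 0) = 0 ∧
      (∀ l, l ∉ O.cells → l ∉ E.cells → μ' l = μ l) ∧
      IsInverse (fun i => μ (G.addr i)) (fun i => μ' (O.addr i)) k' := by
  have hEl : 4 + n ≤ E.len := by
    have : (4 + n : ℝ) ≤ E.len := by
      have := mul_nonneg hcm (Nat.cast_nonneg (α := ℝ) n)
      linarith [(Nat.cast_nonneg d : (0 : ℝ) ≤ d)]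
    exact_mod_cast this
  have hwk : w * k ≤ W := (Nat.mul_le_mul_left w (by omega)).trans hwW
  have hE' : cm * k + d ≤ (E.slice (4 + k) (E.len - (4 + k))).len := by
    rw [Area.slice_len, Nat.cast_sub (by omega)]
    have h3 : (2 * k : ℝ) ≤ n := by exact_mod_cast (by omega : 2 * k ≤ n)
    have h4 : cm * k ≤ cm * n := mul_le_mul_of_nonneg_left (by linarith) hcm
    push_cast
    linarith
  have hGE' : ∀ {i}, i < n → G.addr i ∉ E.cells := fun hi => Area.addr_notMem hGE (by omega)
  have hGO' : ∀ {i}, i < n → G.addr i ∉ O.cells := fun hi => Area.addr_notMem hGO (by omega)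
  have hOE' : ∀ {i}, i < n → O.addr i ∉ E.cells := fun hi => Area.addr_notMem hOE (by omega)
  have hEO' : ∀ {i}, i < 4 → E.addr i ∉ O.cells := fun hi => Area.addr_notMem hOE.symm (by omega)
  have ws : 4 + k + (E.len - (4 + k)) ≤ E.len := by omega
  have vT : ((View.param 2).chunk (.lit 4) (.plus (.lit 4) (.var 2))).eval (frame [G, O, E]) ν =
      E.slice 4 k := eval_chunk rfl rfl (by simp [NExpr.eval, h2]) (by omega)
  have vI : ((View.param 1).chunk (.lit 0) (.var 2)).eval (frame [G, O, E]) ν = O.slice 0 k :=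
    eval_chunk rfl rfl (by simp [NExpr.eval, h2]) (by omega)
  have vJ : ((View.param 1).chunk (.var 2) (.times (.lit 2) (.var 2))).eval (frame [G, O, E]) ν =
      O.slice k k := eval_chunk rfl h2 (by simp [NExpr.eval, h2]; ring) (by omega)
  have vE : (View.drop (.param 2) (.plus (.lit 4) (.var 2))).eval (frame [G, O, E]) ν =
      E.slice (4 + k) (E.len - (4 + k)) := eval_drop rfl (by simp [NExpr.eval, h2])
  have hd1 : Disjoint (E.slice 4 k).cells (E.slice (4 + k) (E.len - (4 + k))).cells :=
    hEf.disjoint_slice (by omega) ws (by omega)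
  refine Wp.seq (Wp.call_two (hmp k W hk hwk (G.slice 1 (2 * k - 1)) (O.slice 0 k).ro
    (E.slice 4 k) (E.slice (4 + k) (E.len - (4 + k))) μ rfl rfl rfl hE' ?_) ?_ ?_
    (map_four (eval_chunk (A := G) rfl rfl (by simp [NExpr.eval, h2]; omega) (by omega)) ?_ vT vE) ?_)
  · refine layout_two_two hGw rfl (hEf.slice (by omega)) (hEf.slice ws) hd1
      ?_ ?_ ?_ ?_
    · exact Area.slice_disjoint (Area.disjoint_slice hGE (by omega)) (by omega)
    · exact Area.slice_disjoint (Area.disjoint_slice hGE ws) (by omega)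
    · rw [Area.cells_ro]
      exact Area.slice_disjoint (Area.disjoint_slice hOE (by omega)) (by omega)
    · rw [Area.cells_ro]
      exact Area.slice_disjoint (Area.disjoint_slice hOE ws) (by omega)
  · simp [NExpr.eval, h2]; omega
  · simp [NExpr.eval, h2]
  · rw [eval_readOnly, vI]
  intro μ1 t1 ht1 hf1 hp1
  refine Wp.seq (Wp.call_two (hsp k W hk hwk (E.slice 4 k).ro (O.slice 0 k).ro
    (O.slice k k) (E.slice (4 + k) (E.len - (4 + k))) μ1 rfl rfl rfl hE' ?_) ?_ ?_
    (map_four ?_ ?_ vJ vE) ?_)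
  · refine layout_two_two rfl rfl (hOf.slice (by omega)) (hEf.slice ws) ?_ ?_ hd1 ?_ ?_
    · exact Area.slice_disjoint (Area.disjoint_slice hOE ws) (by omega)
    · rw [Area.cells_ro]
      exact (Area.slice_disjoint (Area.disjoint_slice hOE (by omega)) (by omega)).symm
    · rw [Area.cells_ro]
      exact hOf.disjoint_slice (by omega) (by omega) (by omega)
    · rw [Area.cells_ro]
      exact Area.slice_disjoint (Area.disjoint_slice hOE ws) (by omega)
  · simp [NExpr.eval, h2]; omega
  · simp [NExpr.eval, h2]
  · rw [eval_readOnly, vT]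
  · rw [eval_readOnly, vI]
  intro μ2 t2 ht2 hf2 hp2
  refine Wp.seq (Wp.call (as := [k]) (l := [E.rep k, O.slice k k, O.slice k k]) ?_ ?_
    (map_three (eval_fill (A := E) rfl h2 (by omega)) vJ vJ)
    (wp_subProg (n := k) (by omega) (by simp) (by simp) (by simp) (hOf.slice (by omega)) ?_ ?_ ?_))
  · simp [NExpr.eval, h2]; omega
  · simp [NExpr.eval, h2]
  · intro i hi j hj h
    exact hOE' (i := k + i) (by omega) (by simp at h; exact h ▸ E.addr_mem (by omega))
  · intro i hi j hj h
    have := hOf.2 _ _ (by omega) (by omega) h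
    omega
  intro _ μ3 hp3 hf3
  refine Wp.seq (Wp.setPtr (by simp [NExpr.eval, h1]; omega) ?_)
  have e1 : NExpr.eval ν (.quot (.var 1) (.lit 2)) = P / 2 := by simp [NExpr.eval, h1]
  rw [e1]
  set ν3 := Function.update ν 1 (P / 2) with hν3
  have h30 : ν3 0 = n := by simp [hν3, h0]
  have h31 : ν3 1 = P / 2 := by simp [hν3]
  have h32 : ν3 2 = k := by simp [hν3, h2]
  -- the memory before the extension
  have fO : ∀ l, l ∉ E.cells → μ1 l = μ l := fun l hl =>
    hf1 l (Area.notMem_slice hl (by omega)) (Area.notMem_slice hl ws)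
  have fO2 : ∀ l, l ∉ E.cells → l ∉ (O.slice k k).cells → μ3 l = μ l := fun l hl hl' => by
    rw [hf3 l (fun h => hl' (by simpa [Area.slice] using h)),
      hf2 l hl' (Area.notMem_slice hl ws), fO l hl]
  have fz : μ2 (E.addr 0) = 0 := by
    rw [hf2 _ (Area.notMem_slice (hEO' (by omega)) (by omega))
      (hEf.addr_notMem_slice ws (by omega) (by omega)),
      hf1 _ (hEf.addr_notMem_slice (by omega) (by omega) (by omega))
      (hEf.addr_notMem_slice ws (by omega) (by omega)), hz]
  have fz3 : μ3 (E.addr 0) = 0 := by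
    rw [hf3 _ (Area.notMem_slice (Area.notMem_slice (hEO' (by omega)) (by omega)) (by simp)), fz]
  have fOk : ∀ j < k, μ3 (O.addr j) = μ (O.addr j) := fun j hj => fO2 _ (hOE' (by omega))
    (hOf.addr_notMem_slice (by omega) (by omega) (by omega))
  have hG3 : ∀ j < n, μ3 (G.addr j) = μ (G.addr j) := fun j hj => fO2 _ (hGE' hj)
    (Area.notMem_slice (hGO' hj) (by omega))
  -- An inverse is a quotient with dividend 1, whose coefficients from index k ≥ 1 on vanish; so the
  -- new block is minus a short product.
  have hext : ∀ u < k, ∑ j ∈ Finset.range (k + u + 1), μ3 (O.addr j) * μ (G.addr (k + u - j)) =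
      if k + u = 0 then 1 else 0 := by
    refine quotient_extend (fun i => μ (G.addr i)) (fun t => if t = 0 then 1 else 0)
      (fun i => μ3 (O.addr i)) (fun i => μ (O.addr i)) k k hr fun u hu => ?_
    have h3 := hp3 u hu
    simp only [Area.slice_addr, Area.rep_addr] at h3
    rw [h3, fz, zero_sub]
    have h4 := hp2 u hu
    simp only [Area.slice_addr, Area.ro_addr, zero_add] at h4
    rw [h4, ← Finset.sum_neg_distrib]
    refine Finset.sum_congr rfl fun v hv => ?_
    rw [Finset.mem_range] at hv
    have h5 := hp1 v (by omega)
    simp only [Area.slice_addr, Area.ro_addr, zero_add] at h5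
    rw [h5, fO _ (hOE' (by omega)), if_neg (by omega), zero_sub, neg_mul]
    congr 2
    refine Finset.sum_congr rfl fun j hj => ?_
    rw [Finset.mem_range] at hj
    rw [fOk j hj]
    congr 3
    omega
  refine Wp.seq (Wp.call_two (runs_extendProg (k := 2 * k) (e := k') (G := G) (F := E.rep n)
    (Q := O) (E := E.slice 1 3) hk1 (by omega) (by omega) (by omega) (by simp; omega)
    (by omega) (by simp) ?_ ?_) ?_ ?_ (map_four rfl
      (eval_fill (A := E) rfl h30 (by omega)) rfl
      (eval_chunk (A := E) rfl rfl rfl (by omega))) ?_)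
  · refine layout_two_two hGw rfl hOf (hEf.slice (by omega)) (Area.disjoint_slice hOE (by omega))
      hGO (Area.disjoint_slice hGE (by omega))
      ((hOE.mono_right (E.cells_rep_subset (by omega))).symm) ?_
    rw [Set.disjoint_left]
    rintro l ⟨i, hi, rfl⟩
    exact hEf.addr_notMem_slice (by omega) (by omega) (by omega)
  · rwa [hG3 0 (by omega)]
  · simp [NExpr.eval, h30, h31, h32, hk']; omega
  · simp [NExpr.eval, h30, h31, h32, hk']
  intro μ4 t4 ht4 hf4 hp4
  have e4 : NExpr.eval ν3 (.quot (.var 0) (.var 1)) = k' := by simp [NExpr.eval, h30, h31, hk']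
  refine Wp.setPtr (by rw [e4]; omega) ?_
  rw [e4]
  refine ⟨by simp [h30], by simp [h31], by simp, ?_, ?_, ?_, ?_⟩
  -- Besides the two products there are k subtractions and at most 2(2k+1)+1 operations of
  -- `extendProg`: 5k+3 ≤ 8k.
  · have b1 := hT k hk (by omega)
    have b2 := hT' k hk (by omega)
    have b3 : ((k' - 2 * k : ℕ) : ℝ) * (2 * k') ≤ 1 * (2 * (2 * k + 1)) := by
      have : ((k' - 2 * k : ℕ) : ℝ) ≤ 1 := by exact_mod_cast (by omega : k' - 2 * k ≤ 1)
      have : (k' : ℝ) ≤ 2 * k + 1 := by exact_mod_cast hk2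
      gcongr
    have b4 : (1 : ℝ) ≤ k := by exact_mod_cast hk
    push_cast
    linarith
  · rw [hf4 _ (hEO' (by omega)) (hEf.addr_notMem_slice (by omega) (by omega) (by omega)), fz3]
  · intro l hl hl'
    rw [hf4 l hl (Area.notMem_slice hl' (by omega)), fO2 l hl' (Area.notMem_slice hl (by omega))]
  · intro u hu
    rcases lt_or_ge u (2 * k) with h | h
    · have : ∑ v ∈ Finset.range (u + 1), μ4 (O.addr v) * μ (G.addr (u - v)) =
          ∑ v ∈ Finset.range (u + 1), μ3 (O.addr v) * μ (G.addr (u - v)) := by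
        refine Finset.sum_congr rfl fun v hv => ?_
        rw [Finset.mem_range] at hv
        rw [hp4.1 v (by omega)]
      rw [this]
      rcases lt_or_ge u k with h' | h'
      · rw [← hr u h']
        refine Finset.sum_congr rfl fun v hv => ?_
        rw [Finset.mem_range] at hv
        rw [fOk v (by omega)]
      · have := hext (u - k) (by omega)
        rwa [show k + (u - k) = u by omega] at this
    · rw [if_neg (by omega)]
      have := hp4.2 u h hu
      rw [Area.rep_addr, fz3] at this
      rw [← this]
      refine Finset.sum_congr rfl fun v hv => ?_
      rw [Finset.mem_range] at hv
      rw [hG3 _ (by omega)]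

/-- The precisions are ⌊n/2^j⌋ for decreasing j, so each is at least twice the previous one. The
sizes of the products therefore sum to at most n, and the whole inversion costs no more than one
middle and one short product of size n, up to O(n). -/
lemma runs_inverseProg (hcm : 0 ≤ cm) (hmp : ComputesMP mp T (fun n => cm * n) d w)
    (hsp : ComputesSP sp T' (fun n => cm * n) d w) (hα : 0 ≤ α) (hβ : 0 ≤ β)
    (hT : ∀ a, 1 ≤ a → a ≤ n → T a ≤ α * a) (hT' : ∀ a, 1 ≤ a → a ≤ n → T' a ≤ β * a)
    (hn : 1 ≤ n) (hW : n ≤ W) (hwW : w * n ≤ W) (hG : n ≤ G.len) (hO : n ≤ O.len)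
    (hE : 4 + n + cm * n + d ≤ E.len) (hGw : G.writable = false) (hOf : O.Free) (hEf : E.Free)
    (hOE : Disjoint O.cells E.cells) (hGO : Disjoint G.cells O.cells)
    (hGE : Disjoint G.cells E.cells) (hu : IsUnit (μ (G.addr 0))) :
    Runs W (inverseProg mp sp) [n] [G] [O, E] μ ((α + β + 8) * n) fun μ' =>
      IsInverse (fun i => μ (G.addr i)) (fun i => μ' (O.addr i)) n := by
  have hEl : 4 + n ≤ E.len := by
    have : (4 + n : ℝ) ≤ E.len := by
      have := mul_nonneg hcm (Nat.cast_nonneg (α := ℝ) n)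
      linarith [(Nat.cast_nonneg d : (0 : ℝ) ≤ d)]
    exact_mod_cast this
  have hG0E : G.addr 0 ∉ E.cells := Area.addr_notMem hGE (by omega)
  have hO0E : O.addr 0 ∉ E.cells := Area.addr_notMem hOE (by omega)
  have hGO' : ∀ {i}, i < n → G.addr i ∉ O.cells := fun hi => Area.addr_notMem hGO (by omega)
  have hGE' : ∀ {i}, i < n → G.addr i ∉ E.cells := fun hi => Area.addr_notMem hGE (by omega)
  have hE0 : E.addr 0 ∈ E.cells := E.addr_mem (by omega)
  have hne : E.addr 0 ≠ G.addr 0 := fun h => hG0E (h ▸ hE0)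
  have hpow : 2 ^ Nat.log 2 n ≤ n := Nat.pow_log_le_self 2 (by omega)
  have hpow' : n < 2 ^ (Nat.log 2 n + 1) := Nat.lt_pow_succ_log_self (by omega) n
  set N := Nat.log 2 n with hN
  refine Runs.of_wp (Wp.seq (Wp.const ⟨by simp [NExpr.eval]; omega, hEf.1⟩ (Wp.seq (Wp.inv
    ⟨by simp [NExpr.eval]; omega, hOf.1⟩ (by simp [Ref.CanRead, NExpr.eval]; omega) ?_
    fun x hx => Wp.seq (Wp.setPtr (by simp [NExpr.eval]; omega) (Wp.seq ?_))))))
  · simp only [List.cons_append, List.nil_append, Ref.addr, frame_zero, frame_two, NExpr.eval]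
    rwa [Function.update_of_ne hne.symm]
  simp only [List.cons_append, List.nil_append, Ref.addr, frame_zero, frame_one, frame_two,
    NExpr.eval] at hx ⊢
  rw [Function.update_of_ne hne.symm] at hx
  set μ0 := Function.update (Function.update μ (E.addr 0) 0) (O.addr 0) x with hμ0
  -- This loop moves only pointers: it finds the largest power of two not exceeding n.
  refine Wp.whileLt N (fun i ν' μ' s => ν' 0 = n ∧ ν' 1 = 2 ^ i ∧ μ' = μ0 ∧ s = 0) ?_ ?_ ?_
  · simp
  · rintro i hi ν' μ' s ⟨h0, h1, rfl, rfl⟩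
    have hi' : 2 * 2 ^ i ≤ n := by
      rw [← pow_succ']
      exact (Nat.pow_le_pow_right (by omega) (by omega : i + 1 ≤ N)).trans hpow
    exact ⟨by simp [NExpr.eval, h0, h1]; omega, Wp.setPtr (by simp [NExpr.eval, h1]; omega)
      (by simp [NExpr.eval, h0, h1, pow_succ'])⟩
  rintro ν' μ' s ⟨h0, h1, rfl, rfl⟩
  rw [pow_succ'] at hpow'
  refine ⟨by simp [NExpr.eval, h0, h1]; omega, Wp.seq (Wp.setPtr (by simp [NExpr.eval]; omega) ?_)⟩
  have hfr0 : ∀ l, l ∉ O.cells → l ∉ E.cells → μ0 l = μ l := fun l hl hl' => by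
    rw [hμ0, Function.update_of_ne, Function.update_of_ne]
    · rintro rfl; exact hl' hE0
    · rintro rfl; exact hl (O.addr_mem (by omega))
  -- The 1 in the time bound is reserved for the initial inversion of G_{[0]}, which s does not
  -- count.
  refine Wp.whileLt N (fun i ν' μ' s => ν' 0 = n ∧ ν' 1 = 2 ^ (N - i) ∧
    ν' 2 = n / 2 ^ (N - i) ∧ (s : ℝ) + 1 ≤ (α + β + 8) * (n / 2 ^ (N - i) : ℕ) ∧
    μ' (E.addr 0) = 0 ∧ (∀ l, l ∉ O.cells → l ∉ E.cells → μ' l = μ l) ∧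
    IsInverse (fun i => μ (G.addr i)) (fun i => μ' (O.addr i)) (n / 2 ^ (N - i))) ?_ ?_ ?_
  · have hq : n / 2 ^ N = 1 := by
      rw [Nat.div_eq_iff (by positivity)]
      omega
    simp only [Nat.sub_zero, hq]
    refine ⟨by simp [h0], by simp [h1], by simp [NExpr.eval], by push_cast; linarith, ?_, hfr0, ?_⟩
    · rw [hμ0, Function.update_of_ne, Function.update_self]
      intro h
      exact hO0E (h ▸ hE0)
    · intro u hu
      obtain rfl : u = 0 := by omega
      simp [hμ0, mul_comm x, hx]
  · rintro i hi ν' μ' s ⟨h0, h1, h2, hs, hz, hfr, hr⟩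
    have hgμ : ∀ j < n, μ' (G.addr j) = μ (G.addr j) := fun j hj => hfr _ (hGO' hj) (hGE' hj)
    have hP : 2 ^ (N - i) / 2 = 2 ^ (N - (i + 1)) := by
      rw [show N - i = N - (i + 1) + 1 by omega, pow_succ]
      omega
    have hPn : 2 ^ (N - i) ≤ n := (Nat.pow_le_pow_right (by omega) (by omega)).trans hpow
    have hPn' : 2 ^ (N - (i + 1)) ≤ n := (Nat.pow_le_pow_right (by omega) (by omega)).trans hpow
    set p := 2 ^ (N - (i + 1)) with hp
    have hp0 : 0 < p := by positivity
    have hPp : 2 ^ (N - i) = p * 2 := by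
      rw [show N - i = N - (i + 1) + 1 by omega, pow_succ]
    -- The old precision is ⌊⌊n/p⌋/2⌋ and the new one ⌊n/p⌋, so the latter is twice the former or
    -- one more.
    rw [hPp, ← Nat.div_div_eq_div_mul] at h2 hs hr
    rw [hPp] at h1 hPn
    have hk : 1 ≤ n / p / 2 := by
      rw [Nat.div_div_eq_div_mul]
      exact Nat.div_pos hPn (by omega)
    have inv_congr : ∀ (f : ℕ → K) (m : ℕ), m ≤ n →
        (IsInverse (fun i => μ' (G.addr i)) f m ↔ IsInverse (fun i => μ (G.addr i)) f m) := by
      intro f m hm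
      refine forall₂_congr fun u hu => ?_
      rw [Finset.sum_congr rfl fun v hv => ?_]
      show f v * μ' (G.addr (u - v)) = f v * μ (G.addr (u - v))
      rw [hgμ _ (by omega)]
    have hkn := Nat.div_le_self n p
    refine ⟨by simp [NExpr.eval, h1]; omega, (wp_inverseStep hcm hmp hsp hT hT' hW hwW hG hO hE hGw
      hOf hEf hOE hGO hGE ?_ h0 h1 h2 hk hPn (k' := n / p) (by rw [Nat.mul_div_cancel _ (by omega)])
      (by omega) (by omega) hkn hz ((inv_congr _ _ (by omega)).2 hr)).mono ?_⟩
    · rwa [hgμ 0 (by omega)]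
    · rintro ν'' μ'' t ⟨g0, g1, g2, gt, gz, gf, gr⟩
      refine ⟨g0, by rw [g1]; omega, g2, ?_, gz, fun l hl hl' => by rw [gf l hl hl', hfr l hl hl'],
        (inv_congr _ _ hkn).1 gr⟩
      have : (2 * (n / p / 2 : ℕ) : ℝ) ≤ (n / p : ℕ) := by
        exact_mod_cast (by omega : 2 * (n / p / 2) ≤ n / p)
      have hc : 0 ≤ α + β + 8 := by linarith
      push_cast at this hs gt ⊢
      nlinarith
  · rintro ν'' μ'' s ⟨g0, g1, g2, gs, gz, gf, gr⟩
    simp only [Nat.sub_self, pow_zero, Nat.div_one] at g1 g2 gs gr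
    refine ⟨by simp [NExpr.eval, g1], by push_cast; linarith, fun l hl => ?_, gr⟩
    simp only [List.mem_cons, List.not_mem_nil, or_false, forall_eq_or_imp, forall_eq] at hl
    exact gf l hl.1 hl.2

end

/-! ### Division with erasing -/

/-- The work space once `Q_{[0..k[}` is known, when `Q_{[k..k+l[}` is about to be computed and
`F_{[0..l[}` holds the inverse of the divisor: the pointers 0, 1, 2 are `n`, `l`, `k`. -/
def workView : View :=
  .append (.append ((View.param 2).chunk (.plus (.var 2) (.var 1)) (.var 0))
    ((View.param 1).chunk (.var 1) (.var 2))) (.param 3)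

/-- Subtracts the contribution of `Q_{[i..i+l[}` from `F_{[k..k+l[}`. -/
def updateStep (mp : Prog K) : Prog K :=
  .seq (.call mp [.var 1]
    [(View.param 0).chunk (.plus (.minus (.minus (.var 2) (.var 3)) (.var 1)) (.lit 1))
        (.plus (.minus (.var 2) (.var 3)) (.var 1)),
      .readOnly ((View.param 2).chunk (.var 3) (.plus (.var 3) (.var 1))),
      (View.param 2).chunk (.var 2) (.plus (.var 2) (.var 1)), workView]) <|
  .seq (.call (subProg K) [.var 1]
    [(View.param 1).chunk (.var 2) (.plus (.var 2) (.var 1)),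
      (View.param 2).chunk (.var 2) (.plus (.var 2) (.var 1)),
      (View.param 1).chunk (.var 2) (.plus (.var 2) (.var 1))]) <|
  .setPtr 3 (.plus (.var 3) (.var 1))

/-- Computes `Q_{[k..k+l[}`. -/
def blockStep (mp sp : Prog K) : Prog K :=
  .seq (.setPtr 3 (.lit 0)) <|
  .seq (.whileLt (.var 3) (.var 2) (updateStep mp)) <|
  .seq (.call sp [.var 1]
    [.readOnly ((View.param 1).chunk (.var 2) (.plus (.var 2) (.var 1))),
      .readOnly ((View.param 1).chunk (.lit 0) (.var 1)),
      (View.param 2).chunk (.var 2) (.plus (.var 2) (.var 1)), workView]) <|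
  .setPtr 2 (.plus (.var 2) (.var 1))

/-- Division of power series by blocks of size `n / q`, then coefficient by coefficient. -/
def divEraseProg (mp sp : Prog K) (q : ℕ) : Prog K :=
  .ifLt (.var 0) (.lit q)
    (.call (extendProg K) [.lit 0, .var 0]
      [.param 0, .readOnly (.param 1), .param 2, .param 3]) <|
  .seq (.setPtr 1 (.quot (.var 0) (.lit q))) <|
  .seq (.call (inverseProg mp sp) [.var 1]
    [.param 0, (View.param 2).chunk (.minus (.var 0) (.var 1)) (.var 0),
      .append ((View.param 2).chunk (.lit 0) (.minus (.var 0) (.var 1))) (.param 3)]) <|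
  .seq (.call sp [.var 1]
    [.readOnly ((View.param 1).chunk (.lit 0) (.var 1)),
      .readOnly ((View.param 2).chunk (.minus (.var 0) (.var 1)) (.var 0)),
      (View.param 2).chunk (.lit 0) (.var 1),
      .append ((View.param 2).chunk (.var 1) (.minus (.var 0) (.var 1))) (.param 3)]) <|
  .seq (.call (copyProg K) [.var 1]
    [(View.param 2).chunk (.minus (.var 0) (.var 1)) (.var 0),
      (View.param 1).chunk (.lit 0) (.var 1)]) <|
  .seq (.setPtr 2 (.var 1)) <|
  .seq (.whileLt (.var 2) (.times (.lit q) (.var 1)) (blockStep mp sp)) <|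
  .call (extendProg K) [.var 2, .var 0] [.param 0, .readOnly (.param 1), .param 2, .param 3]

/-- The area described by `workView`. -/
def workArea (n l k : ℕ) (F Q E : Area) : Area :=
  ((Q.slice (k + l) (n - (k + l))).app (F.slice l (k - l))).app E

/-- `x` is not one of the cells that may change while `Q_{[k..k+l[}` is computed. -/
def Kept (n l k : ℕ) (F Q E : Area) (x : ℕ) : Prop :=
  x ∉ (Q.slice k (n - k)).cells ∧ x ∉ (F.slice l k).cells ∧ x ∉ E.cells

/-! ### One block of the power series quotient -/

section

variable {mp sp : Prog K} {T T' : ℕ → ℝ} {cm α β : ℝ} {d w W n l k : ℕ} {G F Q E : Area}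
  {μ : ℕ → K}

section Work

variable (hF : F.len = n) (hQ : Q.len = n) (hL : Layout [G] [F, Q, E]) (hlk : l ≤ k)
  (hk : k + l ≤ n)

include hF hQ hL hlk hk

lemma free_workArea : (workArea n l k F Q E).Free := by
  obtain ⟨-, ⟨hFf, hQf, hEf⟩, ⟨⟨hFQ, hFE⟩, hQE⟩, -⟩ := layout_one_three_iff.1 hL
  refine Area.Free.app (Area.Free.app (hQf.slice (by omega)) (hFf.slice (by omega)) ?_) hEf ?_
  · exact Area.slice_disjoint (Area.disjoint_slice hFQ.symm (by omega)) (by omega)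
  · rw [Area.cells_app, Set.disjoint_union_left]
    exact ⟨Area.slice_disjoint hQE (by omega), Area.slice_disjoint hFE (by omega)⟩

lemma disjoint_workArea_Q {s t : ℕ} (h : s + t ≤ k + l) :
    Disjoint (Q.slice s t).cells (workArea n l k F Q E).cells := by
  obtain ⟨-, ⟨hFf, hQf, hEf⟩, ⟨⟨hFQ, hFE⟩, hQE⟩, -⟩ := layout_one_three_iff.1 hL
  rw [workArea, Area.cells_app, Area.cells_app, Set.disjoint_union_right, Set.disjoint_union_right]
  exact ⟨⟨hQf.disjoint_slice (by omega) (by omega) (by omega),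
    Area.slice_disjoint (Area.disjoint_slice hFQ.symm (by omega)) (by omega)⟩,
    Area.slice_disjoint hQE (by omega)⟩

/-- Of F, only the range from l to k is recycled: below it lies the inverse, above it the part of
the dividend still to be used. -/
lemma disjoint_workArea_F {s t : ℕ} (ht : s + t ≤ n) (h : s + t ≤ l ∨ k ≤ s) :
    Disjoint (F.slice s t).cells (workArea n l k F Q E).cells := by
  obtain ⟨-, ⟨hFf, hQf, hEf⟩, ⟨⟨hFQ, hFE⟩, hQE⟩, -⟩ := layout_one_three_iff.1 hL
  rw [workArea, Area.cells_app, Area.cells_app, Set.disjoint_union_right, Set.disjoint_union_right]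
  exact ⟨⟨Area.slice_disjoint (Area.disjoint_slice hFQ (by omega)) (by omega),
    hFf.disjoint_slice (by omega) (by omega) (by omega)⟩, Area.slice_disjoint hFE (by omega)⟩

lemma disjoint_workArea_G : Disjoint G.cells (workArea n l k F Q E).cells := by
  obtain ⟨-, -, -, hGF, hGQ, hGE⟩ := layout_one_three_iff.1 hL
  rw [workArea, Area.cells_app, Area.cells_app, Set.disjoint_union_right, Set.disjoint_union_right]
  exact ⟨⟨Area.disjoint_slice hGQ (by omega), Area.disjoint_slice hGF (by omega)⟩, hGE⟩

lemma Kept.notMem {x : ℕ} (h : Kept n l k F Q E x) : x ∉ (Q.slice k l).cells ∧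
    x ∉ (F.slice k l).cells ∧ x ∉ (workArea n l k F Q E).cells := by
  obtain ⟨h1, h2, h3⟩ := h
  refine ⟨fun h' => h1 (Q.slice_subset_slice le_rfl (by omega) h'),
    fun h' => h2 (F.slice_subset_slice hlk (by omega) h'), ?_⟩
  rw [workArea, Area.cells_app, Area.cells_app]
  rintro ((h' | h') | h')
  · exact h1 (Q.slice_subset_slice (by omega) (by omega) h')
  · exact h2 (F.slice_subset_slice (by omega) (by omega) h')
  · exact h3 h'

lemma kept_Q {j : ℕ} (hj : j < k) : Kept n l k F Q E (Q.addr j) := by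
  obtain ⟨-, ⟨hFf, hQf, hEf⟩, ⟨⟨hFQ, hFE⟩, hQE⟩, -⟩ := layout_one_three_iff.1 hL
  exact ⟨hQf.addr_notMem_slice (by omega) (by omega) (by omega),
    Area.notMem_slice (Area.addr_notMem hFQ.symm (by omega)) (by omega),
    Area.addr_notMem hQE (by omega)⟩

lemma kept_F {j : ℕ} (hjn : j < n) (hj : j < l ∨ k + l ≤ j) : Kept n l k F Q E (F.addr j) := by
  obtain ⟨-, ⟨hFf, hQf, hEf⟩, ⟨⟨hFQ, hFE⟩, hQE⟩, -⟩ := layout_one_three_iff.1 hL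
  exact ⟨Area.notMem_slice (Area.addr_notMem hFQ (by omega)) (by omega),
    hFf.addr_notMem_slice (by omega) (by omega) (by omega), Area.addr_notMem hFE (by omega)⟩

lemma kept_of_notMem {x : ℕ} (h1 : x ∉ F.cells) (h2 : x ∉ Q.cells) (h3 : x ∉ E.cells) :
    Kept n l k F Q E x :=
  ⟨Area.notMem_slice h2 (by omega), Area.notMem_slice h1 (by omega), h3⟩

lemma kept_G {j : ℕ} (hj : j < G.len) : Kept n l k F Q E (G.addr j) := by
  obtain ⟨-, -, -, hGF, hGQ, hGE⟩ := layout_one_three_iff.1 hL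
  exact kept_of_notMem hF hQ hL hlk hk (Area.addr_notMem hGF hj) (Area.addr_notMem hGQ hj)
    (Area.addr_notMem hGE hj)

lemma eval_workView {ν : ℕ → ℕ} (h0 : ν 0 = n) (h1 : ν 1 = l) (h2 : ν 2 = k) :
    workView.eval (frame [G, F, Q, E]) ν = workArea n l k F Q E := by
  rw [workView, eval_append, eval_append,
    eval_chunk (A := Q) (a := k + l) (n := n - (k + l)) rfl (by simp [NExpr.eval, h1, h2])
      (by simp [NExpr.eval, h0]; omega) (by omega),
    eval_chunk (A := F) (a := l) (n := k - l) rfl (by simp [NExpr.eval, h1])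
      (by simp [NExpr.eval, h2]; omega) (by omega)]
  rfl

end Work

section Steps

variable (hmp : ComputesMP mp T (fun n => cm * n) d w)
  (hsp : ComputesSP sp T' (fun n => cm * n) d w)
  (hF : F.len = n) (hQ : Q.len = n) (hG : G.len = n) (hL : Layout [G] [F, Q, E])
  (hl : 1 ≤ l) (hlk : l ≤ k) (hk : k + l ≤ n) (hW : n ≤ W) (hwW : w * n ≤ W)
  (hE : cm * l + d ≤ (n - 2 * l : ℕ) + E.len)

-- As k grows, F gains the idle cells that Q loses: (n−k−l) + (k−l) = n−2l, independently of k.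
include hF hQ hL hlk hk hE in
lemma space_workArea : cm * l + d ≤ (workArea n l k F Q E).len := by
  simp only [workArea, Area.app_len, Area.slice_len]
  rw [show n - (k + l) + (k - l) = n - 2 * l by omega]
  push_cast
  exact hE

include hmp hF hQ hG hL hl hlk hk hW hwW hE

/-- The 2l−1 entries of G from k−i−l+1 on are those that meet Q_{[i..i+l[} in the degrees k, …,
k+l−1. The product is put into Q_{[k..k+l[}, which is still free. -/
lemma wp_updateStep {ν : ℕ → ℕ} {i : ℕ} (h0 : ν 0 = n) (h1 : ν 1 = l) (h2 : ν 2 = k) (h3 : ν 3 = i)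
    (hi : i + l ≤ k) :
    Wp W (updateStep mp) (frame [G, F, Q, E]) ν μ fun ν' μ' t =>
      ν' 0 = n ∧ ν' 1 = l ∧ ν' 2 = k ∧ ν' 3 = i + l ∧ (t : ℝ) ≤ T l + l ∧
      (∀ x, Kept n l k F Q E x → μ' x = μ x) ∧ ∀ u < l, μ' (F.addr (k + u)) = μ (F.addr (k + u)) -
        ∑ j ∈ Finset.range l, μ (Q.addr (i + j)) * μ (G.addr (k + u - (i + j))) := by
  obtain ⟨hGw, ⟨hFf, hQf, hEf⟩, ⟨⟨hFQ, hFE⟩, hQE⟩, hGF, hGQ, hGE⟩ := layout_one_three_iff.1 hL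
  have hwl : w * l ≤ W := (Nat.mul_le_mul_left w (by omega)).trans hwW
  have vQ : ((View.param 2).chunk (.var 2) (.plus (.var 2) (.var 1))).eval (frame [G, F, Q, E]) ν =
      Q.slice k l := eval_chunk (A := Q) rfl h2 (by simp [NExpr.eval, h1, h2]) (by omega)
  have vF : ((View.param 1).chunk (.var 2) (.plus (.var 2) (.var 1))).eval (frame [G, F, Q, E]) ν =
      F.slice k l := eval_chunk (A := F) rfl h2 (by simp [NExpr.eval, h1, h2]) (by omega)
  refine Wp.seq (Wp.call_two (hmp l W hl hwl (G.slice (k - i - l + 1) (2 * l - 1))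
    (Q.slice i l).ro (Q.slice k l) (workArea n l k F Q E) μ rfl rfl rfl
    (space_workArea hF hQ hL hlk hk hE) ?_) ?_ ?_ (map_four ?_ ?_ vQ
    (eval_workView hF hQ hL hlk hk h0 h1 h2)) ?_)
  · refine layout_two_two hGw rfl (hQf.slice (by omega)) (free_workArea hF hQ hL hlk hk)
      (disjoint_workArea_Q hF hQ hL hlk hk (by omega)) ?_ ?_ ?_ ?_
    · exact Area.slice_disjoint (Area.disjoint_slice hGQ (by omega)) (by omega)
    · exact Area.slice_disjoint (disjoint_workArea_G hF hQ hL hlk hk) (by omega)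
    · rw [Area.cells_ro]
      exact hQf.disjoint_slice (by omega) (by omega) (by omega)
    · rw [Area.cells_ro]
      exact disjoint_workArea_Q hF hQ hL hlk hk (by omega)
  · simp [NExpr.eval, h1]; omega
  · simp [NExpr.eval, h1]
  · exact eval_chunk (A := G) rfl (by simp [NExpr.eval, h1, h2, h3])
      (by simp [NExpr.eval, h1, h2, h3]; omega) (by omega)
  · exact congrArg Area.ro (eval_chunk (A := Q) rfl h3 (by simp [NExpr.eval, h1, h3]) (by omega))
  intro μ1 t1 ht1 hf1 hp1
  have hFl : (F.slice k l).cells ⊆ F.cells := F.cells_slice_subset (by omega)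
  refine Wp.seq (Wp.call (as := [l]) (l := [F.slice k l, Q.slice k l, F.slice k l]) ?_ ?_
    (map_three vF vQ vF)
    (wp_subProg (n := l) (by omega) (by simp) (by simp) (by simp) (hFf.slice (by omega)) ?_ ?_ ?_))
  · simp [NExpr.eval, h1]; omega
  · simp [NExpr.eval, h1]
  · intro i hi j hj h
    have := hFf.2 _ _ (by omega) (by omega) h
    omega
  · intro i hi j hj h
    exact Area.addr_notMem hFQ (by omega : k + i < F.len) (by
      simp only [Area.slice_addr] at h
      exact h ▸ Q.addr_mem (by omega))
  intro _ μ2 hp2 hf2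
  refine Wp.setPtr (by simp [NExpr.eval, h1, h3]; omega) ⟨by simp [h0], by simp [h1], by simp [h2],
    by simp [NExpr.eval, h1, h3], by push_cast; linarith, fun x hx => ?_, fun u hu => ?_⟩
  · obtain ⟨g1, g2, g3⟩ := hx.notMem hF hQ hL hlk hk
    rw [hf2 x (fun h => g2 (by simpa [Area.slice] using h)), hf1 x g1 g3]
  · have g1 := hp1 u hu
    have g2 := hp2 u hu
    simp only [Area.slice_addr, Area.ro_addr] at g1 g2
    rw [g2, g1, hf1 (F.addr (k + u))]
    · congr 1
      refine Finset.sum_congr rfl fun j hj => ?_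
      rw [Finset.mem_range] at hj
      congr 3
      omega
    · exact Area.notMem_slice (Area.addr_notMem hFQ (by omega)) (by omega)
    · exact fun h => Set.disjoint_left.1 (disjoint_workArea_F hF hQ hL hlk hk (s := k) (t := l)
        (by omega) (by omega)) ((F.slice k l).addr_mem (i := u) hu) h

include hsp

/-- With k = bl there are b earlier blocks, hence b middle products and subtractions. They leave in
F_{[k..k+l[} the residual of `quotient_extend`, and one short product with the inverse finishes the
block. -/
lemma wp_blockStep {ν : ℕ → ℕ} {b : ℕ} (h0 : ν 0 = n) (h1 : ν 1 = l) (h2 : ν 2 = k)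
    (hb : k = b * l)
    (hr : IsInverse (fun i => μ (G.addr i)) (fun i => μ (F.addr i)) l) :
    Wp W (blockStep mp sp) (frame [G, F, Q, E]) ν μ fun ν' μ' t =>
      ν' 0 = n ∧ ν' 1 = l ∧ ν' 2 = k + l ∧ (t : ℝ) ≤ b * (T l + l) + T' l ∧
      (∀ x, Kept n l k F Q E x → μ' x = μ x) ∧ ∀ t, k ≤ t → t < k + l →
        ∑ j ∈ Finset.range (t + 1), μ' (Q.addr j) * μ (G.addr (t - j)) = μ (F.addr t) := by
  obtain ⟨hGw, ⟨hFf, hQf, hEf⟩, ⟨⟨hFQ, hFE⟩, hQE⟩, hGF, hGQ, hGE⟩ := layout_one_three_iff.1 hL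
  have hwl : w * l ≤ W := (Nat.mul_le_mul_left w (by omega)).trans hwW
  refine Wp.seq (Wp.setPtr (by simp [NExpr.eval]) (Wp.seq ?_))
  refine Wp.whileLt b (fun i ν' μ' s => ν' 0 = n ∧ ν' 1 = l ∧ ν' 2 = k ∧ ν' 3 = i * l ∧
    (s : ℝ) ≤ i * (T l + l) ∧ (∀ x, Kept n l k F Q E x → μ' x = μ x) ∧
    ∀ u < l, μ' (F.addr (k + u)) = μ (F.addr (k + u)) -
        ∑ j ∈ Finset.range (i * l), μ (Q.addr j) * μ (G.addr (k + u - j))) ?_ ?_ ?_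
  · simp [h0, h1, h2, NExpr.eval]
  · rintro i hi ν' μ1 s ⟨g0, g1, g2, g3, gs, gk, gF⟩
    have hil : i * l + l ≤ k := by
      rw [hb, ← Nat.succ_mul]
      exact Nat.mul_le_mul_right l hi
    refine ⟨by simp [NExpr.eval, g2, g3]; omega, (wp_updateStep hmp hF hQ hG hL hl hlk hk hW hwW hE
      g0 g1 g2 g3 hil).mono ?_⟩
    rintro ν'' μ2 t ⟨e0, e1, e2, e3, et, ek, eF⟩
    refine ⟨e0, e1, e2, by rw [e3]; ring, by push_cast; linarith,
      fun x hx => (ek x hx).trans (gk x hx), fun u hu => ?_⟩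
    rw [eF u hu, gF u hu, Nat.succ_mul, Finset.sum_range_add, sub_sub]
    congr 2
    refine Finset.sum_congr rfl fun j hj => ?_
    rw [Finset.mem_range] at hj
    rw [gk _ (kept_Q hF hQ hL hlk hk (by omega)), gk _ (kept_G hF hQ hL hlk hk (by omega))]
  rintro ν' μ1 s ⟨g0, g1, g2, g3, gs, gk, gF⟩
  rw [← hb] at g3 gF
  refine ⟨by simp [NExpr.eval, g2, g3], ?_⟩
  refine Wp.seq (Wp.call_two (hsp l W hl hwl (F.slice k l).ro (F.slice 0 l).ro (Q.slice k l)
    (workArea n l k F Q E) μ1 rfl rfl rfl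
    (space_workArea hF hQ hL hlk hk hE) ?_) ?_ ?_ (map_four ?_ ?_ ?_
    (eval_workView hF hQ hL hlk hk g0 g1 g2)) ?_)
  · refine layout_two_two rfl rfl (hQf.slice (by omega)) (free_workArea hF hQ hL hlk hk)
      (disjoint_workArea_Q hF hQ hL hlk hk (by omega)) ?_ ?_ ?_ ?_ <;> rw [Area.cells_ro]
    · exact Area.slice_disjoint (Area.disjoint_slice hFQ (by omega)) (by omega)
    · exact disjoint_workArea_F hF hQ hL hlk hk (by omega) (by omega)
    · exact Area.slice_disjoint (Area.disjoint_slice hFQ (by omega)) (by omega)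
    · exact disjoint_workArea_F hF hQ hL hlk hk (by omega) (by omega)
  · simp [NExpr.eval, g1]; omega
  · simp [NExpr.eval, g1]
  · exact congrArg Area.ro (eval_chunk (A := F) rfl g2 (by simp [NExpr.eval, g1, g2]) (by omega))
  · exact congrArg Area.ro (eval_chunk (A := F) rfl rfl (by simp [NExpr.eval, g1]) (by omega))
  · exact eval_chunk (A := Q) rfl g2 (by simp [NExpr.eval, g1, g2]) (by omega)
  intro μ2 t2 ht2 hf2 hp2
  have hkept : ∀ x, Kept n l k F Q E x → μ2 x = μ x := fun x hx => by
    obtain ⟨c1, -, c3⟩ := hx.notMem hF hQ hL hlk hk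
    rw [hf2 x c1 c3, gk x hx]
  refine Wp.setPtr (by simp [NExpr.eval, g1, g2]; omega) ⟨by simp [g0], by simp [g1],
    by simp [NExpr.eval, g1, g2], by push_cast; linarith, hkept, ?_⟩
  -- F plays two roles: it is the dividend at indices from k on and the inverse at indices below l ≤
  -- k.
  have := quotient_extend (fun i => μ (G.addr i)) (fun i => μ (F.addr i)) (fun i => μ2 (Q.addr i))
    (fun i => μ (F.addr i)) k l hr fun u hu => ?_
  · intro t ht1 ht2
    have := this (t - k) (by omega)
    rwa [show k + (t - k) = t by omega] at this
  · have g := hp2 u hu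
    simp only [Area.slice_addr, Area.ro_addr, zero_add] at g
    rw [g]
    refine Finset.sum_congr rfl fun v hv => ?_
    rw [Finset.mem_range] at hv
    rw [gF v (by omega), gk _ (kept_F hF hQ hL hlk hk (by omega) (by omega))]
    congr 2
    refine Finset.sum_congr rfl fun j hj => ?_
    rw [Finset.mem_range] at hj
    rw [hkept _ (kept_Q hF hQ hL hlk hk (by omega))]

end Steps

end

/-! ### Assembly of the blocks and total cost of the division with erasing -/

section

variable {mp sp : Prog K} {T T' : ℕ → ℝ} {cm α β : ℝ} {d w W n l q : ℕ} {G F Q E : Area}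
  {μ : ℕ → K}

/-- The last step of `divEraseProg`. -/
lemma wp_extend_tail (hF : F.len = n) (hQ : Q.len = n) (hG : G.len = n)
    (hL : Layout [G] [F, Q, E]) (hn : 1 ≤ n) (hW : n ≤ W) (hE : 3 ≤ E.len)
    (hu : IsUnit (μ (G.addr 0))) {ν : ℕ → ℕ} {e : NExpr} {k : ℕ} (he : e.eval ν = k) (hk : k ≤ n)
    (h0 : ν 0 = n) {f : ℕ → K} (hf : ∀ t, k ≤ t → t < n → μ (F.addr t) = f t) (hsol : ∀ t < k,
      ∑ j ∈ Finset.range (t + 1), μ (Q.addr j) * μ (G.addr (t - j)) = f t) :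
    Wp W (.call (extendProg K) [e, .var 0] [.param 0, .readOnly (.param 1), .param 2, .param 3])
      (frame [G, F, Q, E]) ν μ fun _ μ' t => (t : ℝ) ≤ (n - k : ℕ) * (2 * n) + 1 ∧
        (∀ x, x ∉ Q.cells → x ∉ E.cells → μ' x = μ x) ∧ ∀ t < n,
        ∑ j ∈ Finset.range (t + 1), μ' (Q.addr j) * μ (G.addr (t - j)) = f t := by
  obtain ⟨hGw, ⟨hFf, hQf, hEf⟩, ⟨⟨hFQ, hFE⟩, hQE⟩, hGF, hGQ, hGE⟩ := layout_one_three_iff.1 hL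
  refine Wp.call_two (runs_extendProg (k := k) (e := n) (G := G) (F := F.ro) (Q := Q) (E := E)
    hk hn hW hG.ge hF.ge hQ.ge hE
    (layout_two_two hGw rfl hQf hEf hQE hGQ hGE hFQ hFE) hu) ?_ ?_ rfl ?_
  · simp [he, NExpr.eval, h0]; omega
  · simp [he, NExpr.eval, h0]
  · intro μ' t ht hfr hp
    refine ⟨ht, hfr, fun t ht => ?_⟩
    rcases lt_or_ge t k with h | h
    · rw [← hsol t h]
      refine Finset.sum_congr rfl fun j hj => ?_
      rw [Finset.mem_range] at hj
      rw [hp.1 j (by omega)]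
    · rw [← hf t h ht]
      exact hp.2 t h ht

/-- The first block of `divEraseProg`. -/
lemma wp_first_block (hsp : ComputesSP sp T' (fun n => cm * n) d w)
    (hF : F.len = n) (hQ : Q.len = n) (hG : G.len = n) (hL : Layout [G] [F, Q, E]) (hl : 1 ≤ l)
    (hln : 2 * l ≤ n) (hW : n ≤ W) (hwW : w * n ≤ W) (hE : cm * l + d ≤ (n - 2 * l : ℕ) + E.len)
    {ν : ℕ → ℕ} (h0 : ν 0 = n) (h1 : ν 1 = l)
    (hr : IsInverse (fun i => μ (G.addr i)) (fun i => μ (Q.addr (n - l + i))) l)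
    {p : Prog K} {Φ : (ℕ → ℕ) → (ℕ → K) → ℕ → Prop}
    (hp : ∀ (μ' : ℕ → K) (t : ℕ), (t : ℝ) ≤ T' l →
      (∀ x, x ∉ F.cells → x ∉ Q.cells → x ∉ E.cells → μ' x = μ x) →
      (∀ i, l ≤ i → i < n → μ' (F.addr i) = μ (F.addr i)) →
      IsInverse (fun i => μ (G.addr i)) (fun i => μ' (F.addr i)) l →
      (∀ u < l, ∑ j ∈ Finset.range (u + 1), μ' (Q.addr j) * μ (G.addr (u - j)) = μ (F.addr u)) →
      Wp W p (frame [G, F, Q, E]) ν μ' fun ν'' μ'' t' => Φ ν'' μ'' (t + t')) :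
    Wp W (.seq (.call sp [.var 1]
      [.readOnly ((View.param 1).chunk (.lit 0) (.var 1)),
        .readOnly ((View.param 2).chunk (.minus (.var 0) (.var 1)) (.var 0)),
        (View.param 2).chunk (.lit 0) (.var 1),
        .append ((View.param 2).chunk (.var 1) (.minus (.var 0) (.var 1))) (.param 3)]) <|
      .seq (.call (copyProg K) [.var 1]
        [(View.param 2).chunk (.minus (.var 0) (.var 1)) (.var 0),
          (View.param 1).chunk (.lit 0) (.var 1)]) p) (frame [G, F, Q, E]) ν μ Φ := by
  obtain ⟨hGw, ⟨hFf, hQf, hEf⟩, ⟨⟨hFQ, hFE⟩, hQE⟩, hGF, hGQ, hGE⟩ := layout_one_three_iff.1 hL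
  have hwl : w * l ≤ W := (Nat.mul_le_mul_left w (by omega)).trans hwW
  have hs : l + (n - 2 * l) ≤ Q.len := by omega
  have vF : ((View.param 1).chunk (.lit 0) (.var 1)).eval (frame [G, F, Q, E]) ν = F.slice 0 l :=
    eval_chunk (A := F) rfl rfl (by simp [NExpr.eval, h1]) (by omega)
  have vI : ((View.param 2).chunk (.minus (.var 0) (.var 1)) (.var 0)).eval (frame [G, F, Q, E]) ν =
      Q.slice (n - l) l :=
    eval_chunk (A := Q) rfl (by simp [NExpr.eval, h0, h1]) (by simp [NExpr.eval, h0]; omega)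
      (by omega)
  refine Wp.seq (Wp.call_two (hsp l W hl hwl (F.slice 0 l).ro (Q.slice (n - l) l).ro (Q.slice 0 l)
    ((Q.slice l (n - 2 * l)).app E) μ rfl rfl rfl ?_ ?_) ?_ ?_ (map_four (congrArg Area.ro vF)
      (congrArg Area.ro vI)
      (eval_chunk (A := Q) rfl rfl (by simp [NExpr.eval, h1]) (by omega))
      (congrArg (fun a => Area.app a E) (eval_chunk (A := Q) rfl h1
        (by simp [NExpr.eval, h0, h1]; omega) hs))) ?_)
  · simp only [Area.app_len, Area.slice_len]
    push_cast
    exact hE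
  · refine layout_two_two rfl rfl (hQf.slice (by omega)) ((hQf.slice hs).app hEf
      (Area.slice_disjoint hQE hs)) ?_ ?_ ?_ ?_ ?_ <;>
    simp only [Area.cells_ro, Area.cells_app, Set.disjoint_union_right]
    · exact ⟨hQf.disjoint_slice (by omega) hs (by omega), Area.slice_disjoint hQE (by omega)⟩
    · exact Area.slice_disjoint (Area.disjoint_slice hFQ (by omega)) (by omega)
    · exact ⟨Area.slice_disjoint (Area.disjoint_slice hFQ hs) (by omega),
        Area.slice_disjoint hFE (by omega)⟩
    · exact hQf.disjoint_slice (by omega) (by omega) (by omega)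
    · exact ⟨hQf.disjoint_slice (by omega) hs (by omega), Area.slice_disjoint hQE (by omega)⟩
  · simp [NExpr.eval, h1]; omega
  · simp [NExpr.eval, h1]
  intro μ1 t1 ht1 hf1 hp1
  have hf1' : ∀ x, x ∉ Q.cells → x ∉ E.cells → μ1 x = μ x := fun x hx hx' => by
    refine hf1 x (Area.notMem_slice hx (by omega)) ?_
    rw [Area.cells_app]
    rintro (h | h)
    · exact Area.notMem_slice hx hs h
    · exact hx' h
  have hI : ∀ i < l, μ1 (Q.addr (n - l + i)) = μ (Q.addr (n - l + i)) := fun i hi => by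
    refine hf1 _ (hQf.addr_notMem_slice (by omega) (by omega) (by omega)) ?_
    rw [Area.cells_app]
    rintro (h | h)
    · exact hQf.addr_notMem_slice hs (by omega) (by omega) h
    · exact Area.addr_notMem hQE (by omega) h
  refine Wp.seq (Wp.call (as := [l]) (l := [Q.slice (n - l) l, F.slice 0 l]) ?_ ?_ (by
    rw [List.map_cons, vI, List.map_cons, vF, List.map_nil])
    (wp_copyProg (n := l) (by omega) (by simp) (by simp) (hFf.slice (by omega)) ?_ ?_))
  · simp [NExpr.eval, h1]; omega
  · simp [NExpr.eval, h1]
  · intro i hi j hj h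
    simp only [Area.slice_addr] at h
    exact Area.addr_notMem hFQ (by omega : 0 + i < F.len) (h ▸ Q.addr_mem (by omega))
  intro _ μ2 hp2 hf2
  simp only [Area.slice_addr, Area.ro_addr, zero_add] at hp1 hp2
  rw [show (F.slice 0 l).slice 0 l = F.slice 0 l by simp [Area.slice]] at hf2
  have hQ2 : ∀ i < n, μ2 (Q.addr i) = μ1 (Q.addr i) := fun i hi =>
    hf2 _ (Area.notMem_slice (Area.addr_notMem hFQ.symm (by omega)) (by omega))
  simp only [zero_add]
  refine hp μ2 t1 ht1 (fun x hx hx' hx'' => ?_) (fun i hi hi' => ?_) (fun u hu => ?_) ?_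
  · rw [hf2 x (Area.notMem_slice hx (by omega)), hf1' x hx' hx'']
  · rw [hf2 _ (hFf.addr_notMem_slice (by omega) (by omega) (by omega)),
      hf1' _ (Area.addr_notMem hFQ (by omega)) (Area.addr_notMem hFE (by omega))]
  · rw [← hr u hu]
    refine Finset.sum_congr rfl fun v hv => ?_
    rw [Finset.mem_range] at hv
    show μ2 (F.addr v) * _ = μ (Q.addr (n - l + v)) * _
    rw [hp2 v (by omega), hI v (by omega)]
  · have := quotient_extend (fun i => μ (G.addr i)) (fun i => μ (F.addr i))
      (fun i => μ2 (Q.addr i)) (fun i => μ (Q.addr (n - l + i))) 0 l hr fun u hu => ?_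
    · intro u hu
      simpa using this u hu
    · rw [zero_add, hQ2 u (by omega), hp1 u hu]
      refine Finset.sum_congr rfl fun v hv => ?_
      simp

/-- The blocks account for q(q−1)/2 middle and q short products of size l, the inversion for one
more of each. With l ≤ n/q this gives the two rates; subtractions, the last coefficients and lower
order terms go into (3q+10)n. -/
lemma divErase_cost {s t t₁ t₂ n l q : ℝ} (hα : 0 ≤ α) (hβ : 0 ≤ β) (hn : 1 ≤ n) (hq : 2 ≤ q)
    (hl : q * l ≤ n) (ht₁ : t₁ ≤ (α + β + 8) * l) (ht₂ : t₂ ≤ β * l)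
    (hs : s ≤ (q - 1) * (q - 1 + 1) / 2 * ((α + 1) * l) + (q - 1) * (β * l))
    (ht : t ≤ q * (2 * n) + 1) :
    0 + (t₁ + (t₂ + (0 + (s + t)))) ≤
      α * (n * ((q - 1) / 2 + 1 / q)) + β * (n * (1 + 1 / q)) + (3 * q + 10) * n := by
  have b4 : l ≤ n / q := by
    rw [le_div_iff₀ (by linarith)]
    linarith
  have b5 : n / q ≤ n := div_le_self (by linarith) (by linarith)
  set A : ℝ := α * (q * (q - 1) / 2 + 1) + β * (q + 1) + (q * (q - 1) / 2 + 8) with hA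
  have b6 : A * l ≤ A * (n / q) := by
    refine mul_le_mul_of_nonneg_left b4 ?_
    have : 0 ≤ q * (q - 1) / 2 := by
      have : 0 ≤ q - 1 := by linarith
      positivity
    positivity
  have b7 : A * (n / q) = α * (n * ((q - 1) / 2 + 1 / q)) + β * (n * (1 + 1 / q)) +
      ((q - 1) / 2 * n + 8 * (n / q)) := by
    rw [hA]
    field_simp
  have b8 : 1 ≤ q * n := by nlinarith
  have b9 : t₁ + t₂ + s ≤ A * l := by
    rw [hA]
    linarith
  linarith

/-- The inverse is first built in the last l cells of Q, with the other n−l cells as work space, and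
moves to F_{[0..l[} when these entries of F have been used. Every later product finds the n−2l idle
cells of Q and F. -/
lemma runs_divEraseProg (hcm : 0 ≤ cm) (hmp : ComputesMP mp T (fun n => cm * n) d w)
    (hsp : ComputesSP sp T' (fun n => cm * n) d w) (hα : 0 ≤ α) (hβ : 0 ≤ β)
    (hT : ∀ a, 1 ≤ a → a ≤ n → T a ≤ α * a) (hT' : ∀ a, 1 ≤ a → a ≤ n → T' a ≤ β * a)
    (hq : cm + 2 ≤ q) (hn : 1 ≤ n) (hW : n ≤ W) (hwW : w * n ≤ W) (hG : G.len = n) (hF : F.len = n)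
    (hQ : Q.len = n) (hE : 4 + d ≤ E.len) (hL : Layout [G] [F, Q, E])
    (hu : IsUnit (μ (G.addr 0))) :
    Runs W (divEraseProg mp sp q) [n] [G] [F, Q, E] μ
      (α * (n * ((q - 1) / 2 + 1 / q)) + β * (n * (1 + 1 / q)) + (3 * q + 10) * n) fun μ' =>
      ∀ i < n, ∑ j ∈ Finset.range (i + 1), μ' (Q.addr j) * μ (G.addr (i - j)) = μ (F.addr i) := by
  obtain ⟨hGw, ⟨hFf, hQf, hEf⟩, ⟨⟨hFQ, hFE⟩, hQE⟩, hGF, hGQ, hGE⟩ := layout_one_three_iff.1 hL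
  have hn1 : (1 : ℝ) ≤ n := by exact_mod_cast hn
  have hq2 : (2 : ℝ) ≤ q := by linarith
  have hq2' : 2 ≤ q := by exact_mod_cast hq2
  have hGc : ∀ {i}, i < n → G.addr i ∉ F.cells ∧ G.addr i ∉ Q.cells ∧ G.addr i ∉ E.cells :=
    fun hi => ⟨Area.addr_notMem hGF (by omega), Area.addr_notMem hGQ (by omega),
      Area.addr_notMem hGE (by omega)⟩
  refine Runs.of_wp (Wp.ifLt (fun h => ?_) fun h => ?_)
  · refine (wp_extend_tail hF hQ hG hL hn hW (by omega) hu (k := 0) rfl (by omega) rfl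
      (fun t _ _ => rfl) (fun t ht => by omega)).mono ?_
    rintro ν' μ' t ⟨ht, hf, hp⟩
    refine ⟨?_, fun x hx => ?_, hp⟩
    · simp only [NExpr.eval, pointers_zero] at h
      -- In sizes below the constant q even 2n²+1 operations are linear in n.
      have h' : (n : ℝ) ≤ q := by exact_mod_cast h.le
      have h1 : 0 ≤ α * (n * (((q : ℝ) - 1) / 2 + 1 / q)) := by
        have : 0 ≤ ((q : ℝ) - 1) / 2 := by linarith
        positivity
      have h2 : 0 ≤ β * (n * (1 + 1 / (q : ℝ))) := by positivity
      rw [Nat.sub_zero] at ht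
      nlinarith
    · simp only [List.mem_cons, List.not_mem_nil, or_false, forall_eq_or_imp, forall_eq] at hx
      exact hf x hx.2.1 hx.2.2
  simp only [NExpr.eval, pointers_zero, not_lt] at h
  obtain ⟨l, hl⟩ : ∃ l, n / q = l := ⟨_, rfl⟩
  have hl1 : 1 ≤ l := hl ▸ Nat.div_pos h (by omega)
  have hqln : q * l ≤ n := hl ▸ Nat.mul_div_le n q
  have hnq : n - q * l ≤ q := by
    have := Nat.div_add_mod n q
    have := Nat.mod_lt n (by omega : 0 < q)
    rw [hl] at *
    omega
  have hln : 2 * l ≤ n := (Nat.mul_le_mul_right l hq2').trans hqln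
  have hqln' : (q * l : ℝ) ≤ n := by exact_mod_cast hqln
  -- This is what q is chosen for: (c_m+2)l ≤ ql ≤ n.
  have hcml : cm * l + 2 * l ≤ n := by nlinarith [(Nat.cast_nonneg l : (0 : ℝ) ≤ l)]
  have hEr : (4 + d : ℝ) ≤ E.len := by exact_mod_cast hE
  have hspace : cm * l + d ≤ (n - 2 * l : ℕ) + E.len := by
    rw [Nat.cast_sub hln]
    push_cast
    linarith
  refine Wp.seq (Wp.setPtr (by simp [NExpr.eval, hl]; omega) (Wp.seq ?_))
  have e0 : NExpr.eval (pointers [n]) (.quot (.var 0) (.lit q)) = l := by simp [NExpr.eval, hl]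
  rw [e0]
  set ν := Function.update (pointers [n]) 1 l with hν
  have h0 : ν 0 = n := by simp [hν]
  have h1 : ν 1 = l := by simp [hν]
  have hQ1 : n - l + l ≤ Q.len := by omega
  have hQ0 : 0 + (n - l) ≤ Q.len := by omega
  refine Wp.call_runs (runs_inverseProg (G := G) (O := Q.slice (n - l) l)
    (E := (Q.slice 0 (n - l)).app E) (n := l) hcm hmp hsp hα hβ
    (fun a ha ha' => hT a ha (by omega)) (fun a ha ha' => hT' a ha (by omega)) hl1 (by omega)
    ((Nat.mul_le_mul_left w (by omega)).trans hwW) (by omega) le_rfl ?_ hGw (hQf.slice hQ1)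
    ((hQf.slice hQ0).app hEf (Area.slice_disjoint hQE hQ0)) ?_ (Area.disjoint_slice hGQ hQ1) ?_ hu)
    ?_ ?_ (map_three rfl (eval_chunk (A := Q) rfl (by simp [NExpr.eval, h0, h1])
      (by simp [NExpr.eval, h0]; omega) hQ1) (congrArg (fun a => Area.app a E)
      (eval_chunk (A := Q) rfl rfl (by simp [NExpr.eval, h0, h1]) hQ0))) ?_
  · simp only [Area.app_len, Area.slice_len]
    push_cast [Nat.cast_sub (by omega : l ≤ n)]
    linarith
  · rw [Area.cells_app, Set.disjoint_union_right]
    exact ⟨hQf.disjoint_slice hQ1 hQ0 (by omega), Area.slice_disjoint hQE hQ1⟩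
  · rw [Area.cells_app, Set.disjoint_union_right]
    exact ⟨Area.disjoint_slice hGQ hQ0, hGE⟩
  · simp [NExpr.eval, h1]; omega
  · simp [NExpr.eval, h1]
  intro μ1 t1 ht1 hf1 hr1
  have hf1' : ∀ x, x ∉ Q.cells → x ∉ E.cells → μ1 x = μ x := fun x hx hx' => by
    refine hf1 x ?_
    simp only [List.mem_cons, List.not_mem_nil, or_false, forall_eq_or_imp, forall_eq,
      Area.cells_app]
    exact ⟨Area.notMem_slice hx hQ1, fun h => h.elim (Area.notMem_slice hx hQ0) hx'⟩
  have hF1 : ∀ i < n, μ1 (F.addr i) = μ (F.addr i) := fun i hi =>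
    hf1' _ (Area.addr_notMem hFQ (by omega)) (Area.addr_notMem hFE (by omega))
  have hG1 : ∀ i < n, μ1 (G.addr i) = μ (G.addr i) := fun i hi => hf1' _ (hGc hi).2.1 (hGc hi).2.2
  have congrG : ∀ {μ' : ℕ → K}, (∀ i < n, μ' (G.addr i) = μ (G.addr i)) → ∀ (f : ℕ → K) (u : ℕ),
      u < n → ∑ v ∈ Finset.range (u + 1), f v * μ' (G.addr (u - v)) =
        ∑ v ∈ Finset.range (u + 1), f v * μ (G.addr (u - v)) := by
    intro μ' h f u hu
    exact Finset.sum_congr rfl fun v hv => by rw [h _ (by omega)]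
  refine wp_first_block hsp hF hQ hG hL hl1 hln hW hwW hspace h0 h1 ?_ ?_
  · intro u hu
    rw [← hr1 u hu]
    exact congrG hG1 _ u (by omega)
  intro μ2 t2 ht2 hf2 hF2 hr2 hq2f
  have hG2 : ∀ i < n, μ2 (G.addr i) = μ (G.addr i) := fun i hi => by
    rw [hf2 _ (hGc hi).1 (hGc hi).2.1 (hGc hi).2.2, hG1 i hi]
  refine Wp.seq (Wp.setPtr (by simp [NExpr.eval, h1]; omega) (Wp.seq ?_))
  -- After i turns i+1 blocks are known, since the first one was treated apart. The turns so far
  -- used 1, 2, …, i middle products, whence i(i+1)/2.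
  refine Wp.whileLt (q - 1) (fun i ν' μ' s => ν' 0 = n ∧ ν' 1 = l ∧ ν' 2 = (i + 1) * l ∧
    (s : ℝ) ≤ i * (i + 1) / 2 * ((α + 1) * l) + i * (β * l) ∧
    (∀ x, x ∉ F.cells → x ∉ Q.cells → x ∉ E.cells → μ' x = μ x) ∧
    (∀ t, (i + 1) * l ≤ t → t < n → μ' (F.addr t) = μ (F.addr t)) ∧
    IsInverse (fun i => μ (G.addr i)) (fun i => μ' (F.addr i)) l ∧
    ∀ t < (i + 1) * l, ∑ j ∈ Finset.range (t + 1), μ' (Q.addr j) * μ (G.addr (t - j)) =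
      μ (F.addr t)) ?_ ?_ ?_
  · refine ⟨by simp [h0], by simp [h1], by simp [NExpr.eval, h1], by simp, fun x hx hx' hx'' => ?_,
      fun t ht ht' => ?_, fun u hu => ?_, fun t ht => ?_⟩
    · rw [hf2 x hx hx' hx'', hf1' x hx' hx'']
    · rw [hF2 t (by omega) ht', hF1 t ht']
    · rw [← hr2 u hu]
      exact (congrG hG1 _ u (by omega)).symm
    · rw [← hF1 t (by omega), ← hq2f t (by omega)]
      exact (congrG hG1 _ t (by omega)).symm
  · rintro i hi ν' μ3 s ⟨g0, g1, g2, gs, gf, gF, gr, gq⟩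
    have hk1 : (i + 1) * l + l ≤ n := by
      rw [← Nat.succ_mul]
      exact (Nat.mul_le_mul_right l (by omega)).trans hqln
    have hk0 : l ≤ (i + 1) * l := Nat.le_mul_of_pos_left l (by omega)
    have hG3 : ∀ i < n, μ3 (G.addr i) = μ (G.addr i) := fun i hi =>
      gf _ (hGc hi).1 (hGc hi).2.1 (hGc hi).2.2
    refine ⟨?_, (wp_blockStep hmp hsp hF hQ hG hL hl1 hk0 hk1 hW hwW hspace g0 g1 g2 rfl
      (fun u hu => ?_)).mono ?_⟩
    · simp only [NExpr.eval, g1, g2]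
      exact Nat.mul_lt_mul_of_pos_right (by omega) (by omega)
    · rw [← gr u hu]
      exact congrG hG3 _ u (by omega)
    rintro ν'' μ4 t ⟨c0, c1, c2, ct, ck, cq⟩
    refine ⟨c0, c1, by rw [c2]; ring, ?_, fun x hx hx' hx'' => ?_, fun t ht ht' => ?_,
      fun u hu => ?_, fun t ht => ?_⟩
    · have b1 := hT l hl1 (by omega)
      have b2 := hT' l hl1 (by omega)
      have b3 : ((i + 1 : ℕ) : ℝ) * (T l + l) ≤ (i + 1 : ℕ) * ((α + 1) * l) := by
        gcongr
        linarith
      push_cast at b3 ct ⊢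
      linarith
    · rw [ck x (kept_of_notMem hF hQ hL hk0 hk1 hx hx' hx''), gf x hx hx' hx'']
    · have : (i + 1) * l + l ≤ t := by rw [← Nat.succ_mul]; exact ht
      rw [ck _ (kept_F hF hQ hL hk0 hk1 ht' (Or.inr this)), gF t (by omega) ht']
    · rw [← gr u hu]
      refine Finset.sum_congr rfl fun v hv => ?_
      rw [Finset.mem_range] at hv
      show μ4 (F.addr v) * _ = μ3 (F.addr v) * _
      rw [ck _ (kept_F hF hQ hL hk0 hk1 (by omega) (Or.inl (by omega)))]
    · rw [Nat.succ_mul] at ht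
      rcases lt_or_ge t ((i + 1) * l) with h | h
      · rw [← gq t h]
        refine Finset.sum_congr rfl fun v hv => ?_
        rw [Finset.mem_range] at hv
        rw [ck _ (kept_Q hF hQ hL hk0 hk1 (by omega))]
      · rw [← gF t h (by omega), ← cq t h ht]
        exact (congrG hG3 _ t (by omega)).symm
  rintro ν' μ3 s ⟨g0, g1, g2, gs, gf, gF, gr, gq⟩
  rw [show q - 1 + 1 = q by omega] at *
  have hG3 : ∀ i < n, μ3 (G.addr i) = μ (G.addr i) := fun i hi =>
    gf _ (hGc hi).1 (hGc hi).2.1 (hGc hi).2.2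
  refine ⟨by simp [NExpr.eval, g1, g2], ?_⟩
  refine (wp_extend_tail hF hQ hG hL hn hW (by omega) ?_ (e := .var 2) g2 hqln g0 gF fun t ht => ?_).mono ?_
  · rwa [hG3 0 hn]
  · rw [← gq t ht]
    exact congrG hG3 _ t (by omega)
  rintro ν'' μ4 t ⟨ht, hf, hp⟩
  refine ⟨?_, fun x hx => ?_, fun i hi => ?_⟩
  · have b2 := hT' l hl1 (by omega)
    -- At most q coefficients are left for the quadratic method, at 2n operations each.
    have b3 : ((n - q * l : ℕ) : ℝ) * (2 * n) ≤ q * (2 * n) := by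
      have : ((n - q * l : ℕ) : ℝ) ≤ q := by exact_mod_cast hnq
      gcongr
    rw [Nat.cast_sub (by omega), Nat.cast_one] at gs
    push_cast
    exact divErase_cost hα hβ hn1 hq2 hqln' ht1 (ht2.trans b2) gs (by linarith)
  · simp only [List.mem_cons, List.not_mem_nil, or_false, forall_eq_or_imp, forall_eq] at hx
    rw [hf x hx.2.1 hx.2.2, gf x hx.1 hx.2.1 hx.2.2]
  · rw [← hp i hi]
    exact (congrG hG3 _ i hi).symm

end

/-! ### Euclidean division -/

lemma layout_two_three_iff {a b q r e : Area} : Layout [a, b] [q, r, e] ↔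
    (a.writable = false ∧ b.writable = false) ∧ (q.Free ∧ r.Free ∧ e.Free) ∧
    ((Disjoint q.cells r.cells ∧ Disjoint q.cells e.cells) ∧ Disjoint r.cells e.cells) ∧
    (Disjoint a.cells q.cells ∧ Disjoint a.cells r.cells ∧ Disjoint a.cells e.cells) ∧
    Disjoint b.cells q.cells ∧ Disjoint b.cells r.cells ∧ Disjoint b.cells e.cells := by
  simp [layout_iff]

/-- Division with erasing, in terms of coefficients, with explicit constants. -/
def ComputesDiv (p : Prog K) (T : ℕ → ℝ) (d w : ℕ) : Prop :=
  ∀ n W : ℕ, 1 ≤ n → w * n ≤ W → ∀ (G F Q E : Area) (μ : ℕ → K),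
    G.len = n → F.len = n → Q.len = n → d ≤ E.len → Layout [G] [F, Q, E] →
    IsUnit (μ (G.addr 0)) →
    Runs W p [n] [G] [F, Q, E] μ (T n) fun μ' => ∀ i < n,
      ∑ j ∈ Finset.range (i + 1), μ' (Q.addr j) * μ (G.addr (i - j)) = μ (F.addr i)

/-- The area described by `viewH`. -/
def areaH (R E : Area) : Area := R.app (E.slice 0 1)

/-- The area described by `viewE`. -/
def areaE (E : Area) : Area := E.slice 1 (E.len - 1)

/-- The coefficient of `X ^ t` in `b X ^ u`. -/
def shiftCoeff (b : ℕ → K) (t u : ℕ) : K := if u ≤ t then b (t - u) else 0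

lemma coeff_poly_mul (Q : Area) (μ : ℕ → K) (P : K[X]) (t : ℕ) :
    (Q.poly μ * P).coeff t =
      ∑ u ∈ Finset.range Q.len, μ (Q.addr u) * shiftCoeff P.coeff t u := by
  simp [Area.poly, Finset.sum_mul, mul_assoc, coeff_X_pow_mul', shiftCoeff]

section

variable {divErase sp : Prog K} {T T' : ℕ → ℝ} {d w dd dw sd sw W m n : ℕ} {A B Q R E : Area}
  {μ : ℕ → K} {ν : ℕ → ℕ}

section Steps

variable (hdiv : ComputesDiv divErase T dd dw) (hsp : ComputesSP sp T' (fun _ => 0) sd sw)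
  (hA : A.len = m + n) (hB : B.len = n) (hQ : Q.len = m + 1) (hR : R.len = n - 1)
  (hE : dd + sd + 1 ≤ E.len) (hL : Layout [A, B] [Q, R, E]) (hn : 1 ≤ n) (hnm : n ≤ m)
  (hW : (dw + sw + 1) * (m + n) ≤ W)

include hR hE hL in
lemma free_areaH : (areaH R E).Free := by
  obtain ⟨-, ⟨hQf, hRf, hEf⟩, ⟨⟨hQR, hQE⟩, hRE⟩, -⟩ := layout_two_three_iff.1 hL
  exact hRf.app (hEf.slice (by omega)) (Area.disjoint_slice hRE (by omega))

include hR hn in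
lemma areaH_len : (areaH R E).len = n := by
  simp [areaH, hR]; omega

include hE in
lemma notMem_areaH {x : ℕ} (h : x ∉ R.cells) (h' : x ∉ E.cells) : x ∉ (areaH R E).cells := by
  rw [areaH, Area.cells_app]
  exact fun hx => hx.elim h (Area.notMem_slice h' (by omega))

include hE in
lemma eval_viewH : viewH.eval (frame [A, B, Q, R, E]) ν = areaH R E :=
  congrArg (Area.app R) (eval_take (A := E) rfl rfl (by omega))

include hE hL in
lemma disjoint_areaH_areaE : Disjoint (areaH R E).cells (areaE E).cells := by
  obtain ⟨-, ⟨hQf, hRf, hEf⟩, ⟨⟨hQR, hQE⟩, hRE⟩, -⟩ := layout_two_three_iff.1 hL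
  rw [areaH, Area.cells_app, Set.disjoint_union_left]
  exact ⟨Area.disjoint_slice hRE (by omega), hEf.disjoint_slice (by omega) (by omega) (by omega)⟩

include hdiv hA hB hQ hR hE hL hn hnm hW

/-- Read backwards, the quotient of the r leading coefficients prescribes the r top degrees of the
product of B with the new block. The sum may run over all u < r, because for u < e the index n−1+e−u
exceeds n−1 and the coefficient of B is zero. -/
lemma wp_divStep {s t : NExpr} {vH vB : View} {H' B' : Area} {a r : ℕ} (hs : s.eval ν = a)
    (ht : t.eval ν = a + r) (hr : 1 ≤ r) (hrn : r ≤ n) (har : a + r ≤ m + 1)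
    (hvH : vH.eval (frame [A, B, Q, R, E]) ν = H') (hvB : vB.eval (frame [A, B, Q, R, E]) ν = B')
    (hH' : H'.len = r) (hB' : B'.len = r) (hHf : H'.Free)
    (hHc : H'.cells ⊆ (areaH R E).cells) (hBa : ∀ i < r, B'.addr i = B.addr (n - r + i))
    (hu : IsUnit (μ (B.addr (n - 1)))) :
    Wp W (divStep divErase s t vH vB) (frame [A, B, Q, R, E]) ν μ fun ν' μ' c =>
      ν' = ν ∧ (c : ℝ) ≤ T r ∧
      (∀ x, x ∉ R.cells → x ∉ E.cells → x ∉ (Q.slice a r).cells → μ' x = μ x) ∧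
      ∀ e < r, ∑ u ∈ Finset.range r, μ' (Q.addr (a + u)) * (B.poly μ).coeff (n - 1 + e - u) =
        μ (H'.addr e) := by
  obtain ⟨-, ⟨hQf, hRf, hEf⟩, ⟨⟨hQR, hQE⟩, hRE⟩, -, hBQ, hBR, hBE⟩ := layout_two_three_iff.1 hL
  have hBc : B'.cells ⊆ B.cells := by
    rintro x ⟨i, hi, rfl⟩
    rw [hBa i (by omega)]
    exact B.addr_mem (by omega)
  have hQH : Disjoint Q.cells (areaH R E).cells := by
    rw [areaH, Area.cells_app, Set.disjoint_union_right]
    exact ⟨hQR, Area.disjoint_slice hQE (by omega)⟩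
  have hBH : Disjoint B.cells (areaH R E).cells := by
    rw [areaH, Area.cells_app, Set.disjoint_union_right]
    exact ⟨hBR, Area.disjoint_slice hBE (by omega)⟩
  have h1E : 1 + (E.len - 1) ≤ E.len := by omega
  have haQ : a + r ≤ Q.len := by omega
  have hwW : dw * r ≤ W := by
    refine le_trans ?_ hW
    exact Nat.mul_le_mul (by omega) (by omega)
  have hrW : r ≤ W := by nlinarith
  refine Wp.call_runs (hdiv r W hr hwW B'.rev.ro H'.rev (Q.slice a r).rev (areaE E) μ hB' hH' rfl
    ?_ ?_ ?_) ?_ ?_ (map_four ?_ ?_ ?_ rfl) ?_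
  · simp [areaE]; omega
  · rw [layout_one_three_iff]
    simp only [Area.cells_ro, Area.cells_rev]
    exact ⟨rfl, ⟨hHf.rev, (hQf.slice haQ).rev, hEf.slice h1E⟩,
      ⟨⟨(Area.slice_disjoint (hQH.mono_right hHc) haQ).symm,
        (disjoint_areaH_areaE hE hL).mono_left hHc⟩,
        Area.slice_disjoint (Area.disjoint_slice hQE h1E) haQ⟩,
      hBH.mono hBc hHc, (Area.disjoint_slice hBQ haQ).mono_left hBc,
      (Area.disjoint_slice hBE h1E).mono_left hBc⟩
  · simp only [Area.ro_addr, Area.rev_addr, hB', hBa _ (by omega : r - 1 - 0 < r)]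
    rwa [show n - r + (r - 1 - 0) = n - 1 by omega]
  · simp [NExpr.eval, hs, ht]; omega
  · simp [NExpr.eval, hs, ht]
  · exact congrArg (fun x => x.rev.ro) hvB
  · exact congrArg Area.rev hvH
  · exact congrArg Area.rev (eval_chunk (A := Q) rfl hs ht haQ)
  intro μ' c hc hf hp
  refine ⟨rfl, hc, fun x hx hx' hx'' => ?_, fun e he => ?_⟩
  · refine hf x ?_
    simp only [List.mem_cons, List.not_mem_nil, or_false, forall_eq_or_imp, forall_eq,
      Area.cells_rev]
    exact ⟨fun h => notMem_areaH hE hx hx' (hHc h), hx'', Area.notMem_slice hx' h1E⟩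
  · have h := hp (r - 1 - e) (by omega)
    simp only [Area.rev_addr, Area.ro_addr, Area.slice_addr, Area.slice_len, hB', hH'] at h
    rw [show r - 1 - (r - 1 - e) = e by omega] at h
    rw [← h, ← Finset.sum_range_reflect, show r = r - 1 - e + 1 + e by omega,
      Finset.sum_range_add]
    rw [← show r = r - 1 - e + 1 + e by omega]
    rw [Finset.sum_eq_zero (s := Finset.range e), add_zero]
    · refine Finset.sum_congr rfl fun j hj => ?_
      rw [Finset.mem_range] at hj
      rw [hBa _ (by omega), Area.coeff_poly, if_pos (by omega)]
      congr 3
      omega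
    · intro j hj
      rw [Finset.mem_range] at hj
      rw [Area.coeff_poly, if_neg (by omega), mul_zero]

omit hdiv
include hsp

/-- For n = 1 the remainder has size 0, and product routines are specified only from size 1 on;
hence the case distinction in the cost. -/
lemma wp_spStep {s : NExpr} {a : ℕ} (h1 : ν 1 = n) (hs : s.eval ν = a) (ha : a + (n - 1) ≤ m + 1) :
    Wp W (spStep sp s) (frame [A, B, Q, R, E]) ν μ fun ν' μ' c =>
      ν' = ν ∧ (c : ℝ) ≤ (if n ≤ 1 then 0 else T' (n - 1)) ∧
      (∀ x, x ∉ R.cells → x ∉ E.cells → μ' x = μ x) ∧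
      ∀ i < n - 1, μ' (R.addr i) =
        ∑ j ∈ Finset.range (i + 1), μ (Q.addr (a + j)) * (B.poly μ).coeff (i - j) := by
  obtain ⟨-, ⟨hQf, hRf, hEf⟩, ⟨⟨hQR, hQE⟩, hRE⟩, -, hBQ, hBR, hBE⟩ := layout_two_three_iff.1 hL
  have h1E : 1 + (E.len - 1) ≤ E.len := by omega
  have haQ : a + (n - 1) ≤ Q.len := by omega
  have hwW : sw * (n - 1) ≤ W := by
    refine le_trans ?_ hW
    exact Nat.mul_le_mul (by omega) (by omega)
  have hnW : n - 1 ≤ W := by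
    have : m + n ≤ W := by nlinarith
    omega
  have hE' : (0 : ℝ) + sd ≤ (areaE E).len := by
    rw [zero_add]
    exact_mod_cast (by simp [areaE]; omega : sd ≤ (areaE E).len)
  refine Wp.ifLt (fun h => ?_) fun h => Wp.skip ⟨rfl, ?_, fun _ _ _ => rfl, fun i hi => ?_⟩
  · simp only [NExpr.eval, ptrN, h1] at h
    refine Wp.call_two (hsp (n - 1) W (by omega) hwW (Q.slice a (n - 1)).ro (B.slice 0 (n - 1)).ro
      R (areaE E) μ rfl rfl hR hE' ?_) ?_ ?_ (map_four
      (congrArg Area.ro (eval_chunk (A := Q) rfl hs (by simp [NExpr.eval, hs, h1, ptrN]) haQ))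
      (congrArg Area.ro (eval_chunk (A := B) rfl rfl (by simp [NExpr.eval, h1, ptrN])
        (by omega))) rfl rfl) ?_
    · refine layout_two_two rfl rfl hRf (hEf.slice h1E) (Area.disjoint_slice hRE h1E) ?_ ?_ ?_ ?_
        <;> rw [Area.cells_ro]
      · exact Area.slice_disjoint hQR haQ
      · exact Area.slice_disjoint (Area.disjoint_slice hQE h1E) haQ
      · exact Area.slice_disjoint hBR (by omega)
      · exact Area.slice_disjoint (Area.disjoint_slice hBE h1E) (by omega)
    · simp [NExpr.eval, h1, ptrN]; omega
    · simp [NExpr.eval, h1, ptrN]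
    intro μ' c hc hf hp
    refine ⟨rfl, by rwa [if_neg (by omega)], fun x hx hx' => hf x hx (Area.notMem_slice hx' h1E),
      fun i hi => ?_⟩
    rw [hp i hi]
    refine Finset.sum_congr rfl fun j hj => ?_
    rw [Finset.mem_range] at hj
    rw [Area.coeff_poly, if_pos (by omega)]
    simp
  · simp only [NExpr.eval, ptrN, h1] at h
    rw [if_pos (by omega), Nat.cast_zero]
  · simp only [NExpr.eval, ptrN, h1] at h
    omega

include hdiv

/-- The short product lies in R, that is in H_{[0..n-1[}, while the difference goes to H_{[1..n[}:
an upward shift by one cell, which `wp_subProg` permits. The identities refer to Q after the turn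
and to A, B, H before it. -/
lemma wp_euclLoopBody {k : ℕ} (h0 : ν 0 = m) (h1 : ν 1 = n) (h2 : ν 2 = k) (hk : n < k)
    (hkm : k ≤ m + 1) (hu : IsUnit (μ (B.addr (n - 1)))) :
    Wp W (euclLoopBody divErase sp) (frame [A, B, Q, R, E]) ν μ fun ν' μ' c =>
      ν' 0 = m ∧ ν' 1 = n ∧ ν' 2 = k - n ∧
      (c : ℝ) ≤ T n + (if n ≤ 1 then 0 else T' (n - 1)) + n ∧
      (∀ x, x ∉ R.cells → x ∉ E.cells → x ∉ (Q.slice (k - n) n).cells → μ' x = μ x) ∧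
      (∀ e < n, ∑ u ∈ Finset.range n, μ' (Q.addr (k - n + u)) *
        (B.poly μ).coeff (n - 1 + e - u) = μ ((areaH R E).addr e)) ∧
      (∀ e < n - 1, μ' ((areaH R E).addr (e + 1)) = μ (A.addr (k - n + e)) -
        ∑ j ∈ Finset.range (e + 1), μ' (Q.addr (k - n + j)) * (B.poly μ).coeff (e - j)) ∧
      μ' ((areaH R E).addr 0) = μ (A.addr (k - n - 1)) := by
  obtain ⟨-, ⟨hQf, hRf, hEf⟩, ⟨⟨hQR, hQE⟩, hRE⟩, ⟨hAQ, hAR, hAE⟩, hBQ, hBR, hBE⟩ :=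
    layout_two_three_iff.1 hL
  have hHf : (areaH R E).Free := free_areaH hR hE hL
  have hHl : (areaH R E).len = n := areaH_len hR hn
  have hmW : m + n ≤ W := by nlinarith
  have hkQ : k - n + n ≤ Q.len := by omega
  have hAx : ∀ i < m + n, A.addr i ∉ Q.cells ∧ A.addr i ∉ R.cells ∧ A.addr i ∉ E.cells :=
    fun i hi => ⟨Area.addr_notMem hAQ (by omega), Area.addr_notMem hAR (by omega),
      Area.addr_notMem hAE (by omega)⟩
  have hQx : ∀ i < m + 1, Q.addr i ∉ R.cells ∧ Q.addr i ∉ E.cells :=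
    fun i hi => ⟨Area.addr_notMem hQR (by omega), Area.addr_notMem hQE (by omega)⟩
  have hBp : ∀ μ' : ℕ → K, (∀ x, x ∉ R.cells → x ∉ E.cells → x ∉ (Q.slice (k - n) n).cells →
      μ' x = μ x) → B.poly μ' = B.poly μ := by
    intro μ' h
    refine Finset.sum_congr rfl fun i hi => ?_
    rw [Finset.mem_range] at hi
    rw [h _ (Area.addr_notMem hBR hi) (Area.addr_notMem hBE hi)
      (Area.notMem_slice (Area.addr_notMem hBQ hi) hkQ)]
  refine Wp.seq ((wp_divStep hdiv hA hB hQ hR hE hL hn hnm hW (a := k - n) (r := n)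
    (by simp [NExpr.eval, ptrK, ptrN, h1, h2]) (by simp [NExpr.eval, ptrK, h2]; omega) hn le_rfl
    (by omega) (eval_viewH hE) (B' := B) rfl hHl hB hHf subset_rfl
    (fun i hi => by rw [Nat.sub_self, zero_add]) hu).mono ?_)
  rintro ν' μ1 c1 ⟨rfl, hc1, hf1, hp1⟩
  refine Wp.seq ((wp_spStep hsp hA hB hQ hR hE hL hn hnm hW (a := k - n) h1
    (by simp [NExpr.eval, ptrK, ptrN, h1, h2]) (by omega)).mono ?_)
  rintro ν'' μ2 c2 ⟨rfl, hc2, hf2, hp2⟩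
  have hf2' : ∀ x, x ∉ R.cells → x ∉ E.cells → x ∉ (Q.slice (k - n) n).cells → μ2 x = μ x :=
    fun x hx hx' hx'' => by rw [hf2 x hx hx', hf1 x hx hx' hx'']
  have vH : viewH.eval (frame [A, B, Q, R, E]) ν'' = areaH R E := eval_viewH hE
  refine Wp.seq (Wp.call (as := [n - 1]) (l := [A.slice (k - n) (n - 1),
    (areaH R E).slice 0 (n - 1), (areaH R E).slice 1 (n - 1)]) ?_ ?_
    (map_three (eval_chunk (A := A) rfl (by simp [NExpr.eval, ptrK, ptrN, h1, h2])
        (by simp [NExpr.eval, ptrK, h2]; omega) (by omega))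
      (eval_chunk vH rfl (by simp [NExpr.eval, ptrN, h1]) (by omega))
      (eval_chunk vH rfl (by simp [NExpr.eval, ptrN, h1]; omega) (by omega)))
    (wp_subProg (n := n - 1) (by omega) (by simp) (by simp) (by simp) (hHf.slice (by omega))
      ?_ ?_ ?_))
  · simp [NExpr.eval, ptrN, h1]; omega
  · simp [NExpr.eval, ptrN, h1]
  · intro i hi j hj h
    obtain ⟨-, h3, h4⟩ := hAx (k - n + j) (by omega)
    refine notMem_areaH hE h3 h4 ?_
    simp only [Area.slice_addr] at h
    rw [← h]
    exact (areaH R E).addr_mem (by omega)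
  · intro i hi j hj h
    have := hHf.2 _ _ (by omega) (by omega) h
    omega
  intro _ μ3 hp3 hf3
  rw [show ((areaH R E).slice 1 (n - 1)).slice 0 (n - 1) = (areaH R E).slice 1 (n - 1) by
    simp [Area.slice]] at hf3
  refine Wp.seq (Wp.call (as := [1]) (l := [A.slice (k - n - 1) 1, (areaH R E).slice 0 1]) ?_ rfl
    (congrArg₂ (fun x y => [x, y]) (eval_chunk (A := A) rfl
        (by simp [NExpr.eval, ptrK, ptrN, h1, h2])
        (by simp [NExpr.eval, ptrK, ptrN, h1, h2]; omega) (by omega))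
      (eval_chunk vH rfl rfl (by omega)))
    (wp_copyProg (n := 1) (by omega) (by simp) (by simp) (hHf.slice (by omega)) ?_ ?_))
  · simp [NExpr.eval]; omega
  · intro i hi j hj h
    obtain ⟨-, h3, h4⟩ := hAx (k - n - 1 + j) (by omega)
    refine notMem_areaH hE h3 h4 ?_
    simp only [Area.slice_addr] at h
    rw [← h]
    exact (areaH R E).addr_mem (by omega)
  intro _ μ4 hp4 hf4
  rw [show ((areaH R E).slice 0 1).slice 0 1 = (areaH R E).slice 0 1 by simp [Area.slice]] at hf4
  have hf34 : ∀ x, x ∉ R.cells → x ∉ E.cells → μ4 x = μ2 x := fun x hx hx' => by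
    have := notMem_areaH hE hx hx'
    rw [hf4 x (Area.notMem_slice this (by omega)), hf3 x (Area.notMem_slice this (by omega))]
  have hA2 : ∀ i < m + n, μ2 (A.addr i) = μ (A.addr i) := fun i hi => by
    obtain ⟨g1, g2, g3⟩ := hAx i hi
    exact hf2' _ g2 g3 (Area.notMem_slice g1 hkQ)
  have hQ41 : ∀ i < m + 1, μ4 (Q.addr i) = μ1 (Q.addr i) := fun i hi => by
    obtain ⟨g1, g2⟩ := hQx i hi
    rw [hf34 _ g1 g2, hf2 _ g1 g2]
  refine Wp.setPtr (by simp [NExpr.eval, ptrK, ptrN, h1, h2]; omega) ⟨by simp [h0], by simp [h1],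
    by simp [NExpr.eval, ptrK, ptrN, h1, h2], ?_, fun x hx hx' hx'' => ?_, fun e he => ?_,
    fun e he => ?_, ?_⟩
  · have : ((n - 1 : ℕ) : ℝ) ≤ n := by exact_mod_cast Nat.sub_le n 1
    push_cast
    linarith
  · rw [hf34 x hx hx', hf2' x hx hx' hx'']
  · rw [← hp1 e he]
    refine Finset.sum_congr rfl fun u hu => ?_
    rw [Finset.mem_range] at hu
    rw [hQ41 _ (by omega)]
  · have g := hp3 e he
    simp only [Area.slice_addr, zero_add] at g
    rw [hf4 _ (hHf.addr_notMem_slice (by omega) (by omega) (by omega)),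
      show (areaH R E).addr (e + 1) = (areaH R E).addr (1 + e) by rw [add_comm], g,
      hA2 _ (by omega)]
    have : (areaH R E).addr e = R.addr e := Area.app_addr_left _ _ (by omega)
    rw [this, hp2 e he, hBp μ1 hf1]
    congr 1
    refine Finset.sum_congr rfl fun u hu => ?_
    rw [Finset.mem_range] at hu
    rw [hQ41 _ (by omega)]
  · have g := hp4 0 (by omega)
    simp only [Area.slice_addr, add_zero] at g
    obtain ⟨g1, g2, g3⟩ := hAx (k - n - 1) (by omega)
    rw [g, hf3 _ (Area.notMem_slice (notMem_areaH hE g2 g3) (by omega)), hA2 _ (by omega)]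

end Steps

end

/-- The invariant of the main loop of `inPlaceEuclDiv`: `a - b q` vanishes from degree `k + n - 1` on
and `h` consists of its `n` coefficients from degree `k - 1` on, where only the coefficients of the
quotient from `k` on are considered. -/
def EuclInv (m n : ℕ) (a b : ℕ → K) (k : ℕ) (q h : ℕ → K) : Prop :=
  (∀ t, k + n - 1 ≤ t → t < m + n → ∑ u ∈ Finset.Ico k (m + 1), q u * shiftCoeff b t u = a t) ∧
  ∀ e < n, h e = a (k - 1 + e) - ∑ u ∈ Finset.Ico k (m + 1), q u * shiftCoeff b (k - 1 + e) u

/-! ### Algebra of the loop invariant -/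

section

variable {m n k r s : ℕ} {a b q q' h h' : ℕ → K}

lemma sum_shiftCoeff_eq (hs : s + r = k) (hk : k ≤ m + 1) (hq : ∀ u, k ≤ u → u ≤ m → q' u = q u)
    (t : ℕ) : ∑ u ∈ Finset.Ico s (m + 1), q' u * shiftCoeff b t u =
      (∑ u ∈ Finset.range r, q' (s + u) * shiftCoeff b t (s + u)) +
        ∑ u ∈ Finset.Ico k (m + 1), q u * shiftCoeff b t u := by
  rw [← Finset.sum_Ico_consecutive _ (by omega : s ≤ k) hk, Finset.sum_Ico_eq_sum_range]
  congr 1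
  · rw [show k - s = r by omega]
  · refine Finset.sum_congr rfl fun u hu => ?_
    rw [Finset.mem_Ico] at hu
    rw [hq u hu.1 (by omega)]

/-- After a block of `r` coefficients of the quotient, `a - b q` vanishes on `r` more degrees. -/
lemma EuclInv.high (hI : EuclInv m n a b k q h) (hn : 1 ≤ n) (hb : ∀ i, n ≤ i → b i = 0)
    (hs : s + r = k) (hr : 1 ≤ r) (hrn : r ≤ n) (hk : k ≤ m + 1)
    (hq : ∀ u, k ≤ u → u ≤ m → q' u = q u)
    (hd : ∀ e < r, ∑ u ∈ Finset.range r, q' (s + u) * b (n - 1 + e - u) = h (n - r + e)) :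
    ∀ t, s + n - 1 ≤ t → t < m + n →
      ∑ u ∈ Finset.Ico s (m + 1), q' u * shiftCoeff b t u = a t := by
  intro t ht ht'
  rw [sum_shiftCoeff_eq hs hk hq]
  rcases lt_or_ge t (k + n - 1) with h1 | h1
  · have h2 := hd (t - (s + n - 1)) (by omega)
    have h3 := hI.2 (n - r + (t - (s + n - 1))) (by omega)
    rw [show k - 1 + (n - r + (t - (s + n - 1))) = t by omega] at h3
    have h4 : ∑ u ∈ Finset.range r, q' (s + u) * shiftCoeff b t (s + u) =
        ∑ u ∈ Finset.range r, q' (s + u) * b (n - 1 + (t - (s + n - 1)) - u) := by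
      refine Finset.sum_congr rfl fun u hu => ?_
      rw [Finset.mem_range] at hu
      rw [shiftCoeff, if_pos (by omega)]
      congr 2
      omega
    rw [h4, h2, h3]
    ring
  -- For u < k the degree of b X^u is below k+n−1, so the new block leaves these degrees alone.
  · rw [Finset.sum_eq_zero, zero_add]
    · exact hI.1 t h1 ht'
    · intro u hu
      rw [Finset.mem_range] at hu
      rw [shiftCoeff, if_pos (by omega), hb _ (by omega), mul_zero]

lemma sum_shiftCoeff_of_lt (h : ∀ u, s ≤ u → u ≤ m → k < u) :
    ∑ u ∈ Finset.Ico s (m + 1), q u * shiftCoeff b k u = 0 := by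
  refine Finset.sum_eq_zero fun u hu => ?_
  rw [Finset.mem_Ico] at hu
  rw [shiftCoeff, if_neg (by have := h u hu.1 (by omega); omega), mul_zero]

/-- The low coefficients of the product of `b` with the quotient. -/
lemma sum_shiftCoeff_low {i : ℕ} (hi : s + i ≤ m) :
    ∑ u ∈ Finset.Ico s (m + 1), q u * shiftCoeff b (s + i) u =
      ∑ j ∈ Finset.range (i + 1), q (s + j) * b (i - j) := by
  rw [← Finset.sum_Ico_consecutive _ (by omega : s ≤ s + i + 1) (by omega : s + i + 1 ≤ m + 1),
    Finset.sum_Ico_eq_sum_range, sum_shiftCoeff_of_lt (fun u hu _ => by omega), add_zero,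
    show s + i + 1 - s = i + 1 by omega]
  refine Finset.sum_congr rfl fun j hj => ?_
  rw [Finset.mem_range] at hj
  rw [shiftCoeff, if_pos (by omega)]
  congr 2
  omega

/-- The new H covers the degrees k−n−1, …, k−2, where quotient coefficients of index ≥ k are
invisible: only A and the new block matter. In the lowest of these degrees even the new block is
invisible, so that entry is copied from A. -/
lemma EuclInv.step (hI : EuclInv m n a b k q h) (hn : 1 ≤ n) (hb : ∀ i, n ≤ i → b i = 0)
    (hnk : n < k) (hk : k ≤ m + 1) (hq : ∀ u, k ≤ u → u ≤ m → q' u = q u)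
    (hd : ∀ e < n, ∑ u ∈ Finset.range n, q' (k - n + u) * b (n - 1 + e - u) = h e)
    (hh : ∀ e < n - 1, h' (e + 1) = a (k - n + e) -
      ∑ j ∈ Finset.range (e + 1), q' (k - n + j) * b (e - j))
    (hh0 : h' 0 = a (k - n - 1)) : EuclInv m n a b (k - n) q' h' := by
  refine ⟨hI.high hn hb (by omega) hn le_rfl hk hq fun e he => ?_, fun e he => ?_⟩
  · rw [hd e he, Nat.sub_self, zero_add]
  · rcases e with _ | e
    · rw [add_zero, hh0, sum_shiftCoeff_of_lt (fun u hu _ => by omega), sub_zero]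
    · rw [hh e (by omega), show k - n - 1 + (e + 1) = k - n + e by omega,
        sum_shiftCoeff_low (by omega)]

end

/-! ### Correctness and cost of the Euclidean division -/

section

variable {divErase sp : Prog K} {T T' : ℕ → ℝ} {d w dd dw sd sw W m n : ℕ} {A B Q R E : Area}
  {μ : ℕ → K} {ν : ℕ → ℕ}

/-- After ⌊m/n⌋ turns k has dropped from m+1 to (m mod n)+1, which lies between 1 and n, so the last
block is never empty. With it A and BQ agree from degree n−1 on; the final short product and
subtraction yield the degrees below. -/
lemma runs_inPlaceEuclDiv (hdiv : ComputesDiv divErase T dd dw)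
    (hsp : ComputesSP sp T' (fun _ => 0) sd sw)
    (hA : A.len = m + n) (hB : B.len = n) (hQ : Q.len = m + 1) (hR : R.len = n - 1)
    (hE : dd + sd + 1 ≤ E.len) (hL : Layout [A, B] [Q, R, E]) (hn : 1 ≤ n) (hnm : n ≤ m)
    (hW : (dw + sw + 1) * (m + n) ≤ W) (hu : IsUnit (μ (B.addr (n - 1)))) :
    Runs W (inPlaceEuclDiv divErase sp) [m, n] [A, B] [Q, R, E] μ
      ((m / n : ℕ) * (T n + (if n ≤ 1 then 0 else T' (n - 1)) + n) + T (m % n + 1) +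
        (if n ≤ 1 then 0 else T' (n - 1)) + n)
      fun μ' => A.poly μ = B.poly μ * Q.poly μ' + R.poly μ' := by
  obtain ⟨-, ⟨hQf, hRf, hEf⟩, ⟨⟨hQR, hQE⟩, hRE⟩, ⟨hAQ, hAR, hAE⟩, hBQ, hBR, hBE⟩ :=
    layout_two_three_iff.1 hL
  have hHf : (areaH R E).Free := free_areaH hR hE hL
  have hHl : (areaH R E).len = n := areaH_len hR hn
  have hmW : m + n ≤ W := by nlinarith
  set S : ℝ := if n ≤ 1 then 0 else T' (n - 1) with hS
  have hAx : ∀ i < m + n, A.addr i ∉ Q.cells ∧ A.addr i ∉ R.cells ∧ A.addr i ∉ E.cells :=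
    fun i hi => ⟨Area.addr_notMem hAQ (by omega), Area.addr_notMem hAR (by omega),
      Area.addr_notMem hAE (by omega)⟩
  have hQx : ∀ i < m + 1, Q.addr i ∉ R.cells ∧ Q.addr i ∉ E.cells :=
    fun i hi => ⟨Area.addr_notMem hQR (by omega), Area.addr_notMem hQE (by omega)⟩
  have hAa : ∀ {μ' : ℕ → K}, (∀ x, x ∉ Q.cells → x ∉ R.cells → x ∉ E.cells → μ' x = μ x) →
      ∀ i < m + n, μ' (A.addr i) = μ (A.addr i) :=
    fun h i hi => h _ (hAx i hi).1 (hAx i hi).2.1 (hAx i hi).2.2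
  have hBb : ∀ {μ' : ℕ → K}, (∀ x, x ∉ Q.cells → x ∉ R.cells → x ∉ E.cells → μ' x = μ x) →
      B.poly μ' = B.poly μ := by
    intro μ' h
    refine Finset.sum_congr rfl fun i hi => ?_
    rw [Finset.mem_range] at hi
    rw [h _ (Area.addr_notMem hBQ hi) (Area.addr_notMem hBR hi) (Area.addr_notMem hBE hi)]
  have hb0 : ∀ i, n ≤ i → (B.poly μ).coeff i = 0 := fun i hi => by
    rw [Area.coeff_poly, if_neg (by omega)]
  have hum : ∀ {μ' : ℕ → K}, (∀ x, x ∉ Q.cells → x ∉ R.cells → x ∉ E.cells → μ' x = μ x) →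
      IsUnit (μ' (B.addr (n - 1))) := fun h => by
    rwa [h _ (Area.addr_notMem hBQ (by omega)) (Area.addr_notMem hBR (by omega))
      (Area.addr_notMem hBE (by omega))]
  refine Runs.of_wp (Wp.seq (Wp.call (as := [n]) (l := [A.slice m n, areaH R E]) ?_ rfl
    (congrArg₂ (fun x y => [x, y]) (eval_chunk (A := A) rfl rfl rfl (by omega)) (eval_viewH hE))
    (wp_copyProg (n := n) (by omega) le_rfl hHl.ge hHf ?_ ?_)))
  · simp [NExpr.eval, ptrN]; omega
  · intro i hi j hj h
    obtain ⟨-, h3, h4⟩ := hAx (m + j) (by omega)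
    refine notMem_areaH hE h3 h4 ?_
    simp only [Area.slice_addr] at h
    rw [← h]
    exact (areaH R E).addr_mem (by omega)
  intro _ μ1 hp1 hf1
  have hf1' : ∀ x, x ∉ Q.cells → x ∉ R.cells → x ∉ E.cells → μ1 x = μ x := fun x _ hx hx' =>
    hf1 x (Area.notMem_slice (notMem_areaH hE hx hx') (by omega))
  refine Wp.seq (Wp.setPtr (by simp [NExpr.eval, ptrM]; omega) (Wp.seq ?_))
  have hdm : n * (m / n) + m % n = m := Nat.div_add_mod m n
  refine Wp.whileLt (m / n) (fun i ν' μ' c => ν' 0 = m ∧ ν' 1 = n ∧ ν' 2 = m + 1 - i * n ∧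
    (c : ℝ) ≤ i * (T n + S + n) ∧ (∀ x, x ∉ Q.cells → x ∉ R.cells → x ∉ E.cells → μ' x = μ x) ∧
    EuclInv m n (fun i => μ (A.addr i)) (B.poly μ).coeff (m + 1 - i * n)
      (fun i => μ' (Q.addr i)) fun i => μ' ((areaH R E).addr i)) ?_ ?_ ?_
  · refine ⟨by simp, by simp, by simp [NExpr.eval, ptrM], by simp, hf1', fun t h1 h2 => by omega,
      fun e he => ?_⟩
    have := hp1 e he
    simp only [Area.slice_addr] at this
    simp [this]
  · rintro i hi ν' μ2 c ⟨g0, g1, g2, gc, gf, gI⟩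
    have hin : i * n + n ≤ m := by
      rw [← Nat.succ_mul]
      exact (Nat.mul_le_mul_right n hi).trans (Nat.div_mul_le_self m n)
    refine ⟨by simp [NExpr.eval, ptrN, ptrK, g1, g2]; omega,
      (wp_euclLoopBody hdiv hsp hA hB hQ hR hE hL hn hnm hW g0 g1 g2 (by omega) (by omega)
        (hum gf)).mono ?_⟩
    rintro ν'' μ3 c' ⟨e0, e1, e2, ec, ef, eq1, eh, eh0⟩
    have hk : m + 1 - i * n - n = m + 1 - (i + 1) * n := by rw [Nat.succ_mul]; omega
    rw [hBb gf] at eq1 eh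
    refine ⟨e0, e1, by rw [e2, hk], by push_cast; linarith, fun x hx hx' hx'' => ?_, ?_⟩
    · rw [ef x hx' hx'' (Area.notMem_slice hx (by omega)), gf x hx hx' hx'']
    · rw [← hk]
      refine gI.step hn hb0 (by omega) (by omega) (fun u h1 h2 => ?_) eq1 (fun e he => ?_) ?_
      · exact ef _ (hQx u (by omega)).1 (hQx u (by omega)).2
          (hQf.addr_notMem_slice (by omega) (by omega) (by omega))
      · rw [eh e he, hAa gf _ (by omega)]
      · rw [eh0, hAa gf _ (by omega)]
  rintro ν' μ2 c ⟨g0, g1, g2, gc, gf, gI⟩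
  have hr : m + 1 - m / n * n = m % n + 1 := by rw [mul_comm]; omega
  have hrn : m % n + 1 ≤ n := Nat.mod_lt m (by omega)
  rw [hr] at g2 gI
  set r := m % n + 1 with hr'
  have hrm : r ≤ m + 1 := by omega
  refine ⟨by simp [NExpr.eval, ptrN, ptrK, g1, g2]; omega, ?_⟩
  have hHs : n - r + r ≤ (areaH R E).len := by omega
  refine Wp.seq ((wp_divStep hdiv hA hB hQ hR hE hL hn hnm hW (a := 0) (r := r)
    (H' := (areaH R E).slice (n - r) r) (B' := B.slice (n - r) r) rfl
    (by simp [NExpr.eval, ptrK, g2]) (by omega) hrn (by omega)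
    (eval_chunk (eval_viewH hE) (by simp [NExpr.eval, ptrK, ptrN, g1, g2])
      (by simp [NExpr.eval, ptrN, g1]; omega) hHs)
    (eval_chunk (A := B) rfl (by simp [NExpr.eval, ptrK, ptrN, g1, g2])
      (by simp [NExpr.eval, ptrN, g1]; omega) (by omega)) rfl rfl (hHf.slice hHs)
    ((areaH R E).cells_slice_subset hHs) (fun i hi => rfl) (hum gf)).mono ?_)
  rintro ν'' μ3 c3 ⟨rfl, hc3, hf3, hp3⟩
  simp only [zero_add, Area.slice_addr] at hp3
  rw [hBb gf] at hp3
  have hf3' : ∀ x, x ∉ Q.cells → x ∉ R.cells → x ∉ E.cells → μ3 x = μ x :=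
    fun x hx hx' hx'' => by
      rw [hf3 x hx' hx'' (Area.notMem_slice hx (by omega)), gf x hx hx' hx'']
  have high := gI.high (q' := fun i => μ3 (Q.addr i)) (s := 0) (r := r) hn hb0 (by omega)
    (by omega) hrn hrm (fun u h1 h2 => hf3 _ (hQx u (by omega)).1 (hQx u (by omega)).2
      (hQf.addr_notMem_slice (by omega) (by omega) (by omega)))
    (fun e he => by simpa only [zero_add] using hp3 e he)
  refine Wp.seq ((wp_spStep hsp hA hB hQ hR hE hL hn hnm hW (a := 0) g1 rfl (by omega)).mono ?_)
  rintro ν3 μ4 c4 ⟨rfl, hc4, hf4, hp4⟩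
  rw [hBb hf3'] at hp4
  have hf4' : ∀ x, x ∉ Q.cells → x ∉ R.cells → x ∉ E.cells → μ4 x = μ x :=
    fun x hx hx' hx'' => by rw [hf4 x hx' hx'', hf3' x hx hx' hx'']
  refine Wp.call (as := [n - 1]) (l := [A.slice 0 (n - 1), R, R]) ?_ ?_
    (map_three (eval_chunk (A := A) rfl rfl (by simp [NExpr.eval, ptrN, g1]) (by omega)) rfl rfl)
    (wp_subProg (n := n - 1) (by omega) (by simp) hR.ge hR.ge hRf ?_ ?_ ?_)
  · simp [NExpr.eval, ptrN, g1]; omega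
  · simp [NExpr.eval, ptrN, g1]
  · intro i hi j hj h
    simp only [Area.slice_addr] at h
    exact (hAx (0 + j) (by omega)).2.1 (h ▸ R.addr_mem (by omega))
  · intro i hi j hj h
    have := hRf.2 _ _ (by omega) (by omega) h
    omega
  intro _ μ5 hp5 hf5
  have hf5' : ∀ x, x ∉ R.cells → μ5 x = μ4 x := fun x hx =>
    hf5 x (Area.notMem_slice hx (by omega))
  refine ⟨?_, fun x hx => ?_, ?_⟩
  · have : ((n - 1 : ℕ) : ℝ) ≤ n := by exact_mod_cast Nat.sub_le n 1
    push_cast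
    linarith
  · simp only [List.mem_cons, List.not_mem_nil, or_false, forall_eq_or_imp, forall_eq] at hx
    rw [hf5' x hx.2.1, hf4' x hx.1 hx.2.1 hx.2.2]
  · ext t
    have hQ5 : ∑ u ∈ Finset.range Q.len, μ5 (Q.addr u) * shiftCoeff (B.poly μ).coeff t u =
        ∑ u ∈ Finset.Ico 0 (m + 1), μ3 (Q.addr u) * shiftCoeff (B.poly μ).coeff t u := by
      rw [hQ, Finset.range_eq_Ico]
      refine Finset.sum_congr rfl fun u hu => ?_
      rw [Finset.mem_Ico] at hu
      obtain ⟨g1, g2⟩ := hQx u hu.2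
      rw [hf5' _ g1, hf4 _ g1 g2]
    rw [coeff_add, mul_comm, coeff_poly_mul, hQ5, Area.coeff_poly, Area.coeff_poly, hA, hR]
    rcases lt_or_ge t (n - 1) with h1 | h1
    · have := sum_shiftCoeff_low (m := m) (q := fun i => μ3 (Q.addr i)) (b := (B.poly μ).coeff)
        (s := 0) (i := t) (by omega)
      simp only [zero_add] at this hp4
      have h5 := hp5 t h1
      simp only [Area.slice_addr, zero_add] at h5
      rw [if_pos (by omega), if_pos h1, this, h5, hp4 t h1, hAa hf4' t (by omega)]
      ring
    · rw [if_neg (by omega : ¬ t < n - 1), add_zero]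
      rcases lt_or_ge t (m + n) with h2 | h2
      · rw [if_pos h2, high t (by omega) h2]
      · rw [if_neg (by omega), Finset.sum_eq_zero]
        intro u hu
        rw [Finset.mem_Ico] at hu
        rw [shiftCoeff, if_pos (by omega), hb0 _ (by omega), mul_zero]

/-- Nothing is asked of `T`, so part (i) is immediate from this explicit bound. -/
lemma ComputesDiv.isEuclDiv (hdiv : ComputesDiv divErase T dd dw)
    (hsp : ComputesSP sp T' (fun _ => 0) sd sw) :
    IsEuclDiv (inPlaceEuclDiv divErase sp) fun m n =>
      (m / n : ℕ) * (T n + (if n ≤ 1 then 0 else T' (n - 1)) + n) + T (m % n + 1) +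
        (if n ≤ 1 then 0 else T' (n - 1)) + n :=
  ⟨dd + sd + 1, dw + sw + 1, fun _ _ _ hn hnm hW _ _ _ _ _ _ hA hB hQ hR hE hL hu =>
    runs_inPlaceEuclDiv hdiv hsp hA hB hQ hR hE hL hn hnm hW hu⟩

end

/-! ### The complexity bounds -/

lemma IsEuclDiv.mono {p : Prog K} {T T' : ℕ → ℕ → ℝ} (h : IsEuclDiv p T)
    (hT : ∀ m n, 1 ≤ n → n ≤ m → T m n ≤ T' m n) : IsEuclDiv p T' := by
  obtain ⟨d, w, h⟩ := h
  exact ⟨d, w, fun m n W hn hnm hW A B Q R E μ hA hB hQ hR hE hL hu =>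
    (h m n W hn hnm hW A B Q R E μ hA hB hQ hR hE hL hu).mono (hT m n hn hnm) fun _ => id⟩

lemma ComputesDiv.mono {p : Prog K} {T T' : ℕ → ℝ} {d w : ℕ} (h : ComputesDiv p T d w)
    (hT : ∀ n, 1 ≤ n → T n ≤ T' n) : ComputesDiv p T' d w :=
  fun n W hn hW G F Q E μ hG hF hQ hE hL hu =>
    (h n W hn hW G F Q E μ hG hF hQ hE hL hu).mono (hT n hn) fun _ => id

/-- A bound that is met by an actual run cannot be negative. This yields M ≥ 0, which the growth
condition alone does not imply (M(n) = −n satisfies it). -/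
lemma ComputesSP.cost_nonneg {p : Prog K} {T : ℕ → ℝ} {d w : ℕ}
    (h : ComputesSP p T (fun _ => 0) d w) {n : ℕ} (hn : 1 ≤ n) : 0 ≤ T n := by
  -- Some admissible layout is needed: residue classes modulo 3 are disjoint, and the two read-only
  -- inputs may coincide.
  have hL : Layout [⟨n, fun i => 3 * i, false⟩, ⟨n, fun i => 3 * i, false⟩]
      [⟨n, fun i => 3 * i + 1, true⟩, ⟨d, fun i => 3 * i + 2, true⟩] := by
    refine layout_two_two rfl rfl ⟨rfl, fun i j _ _ h => ?_⟩ ⟨rfl, fun i j _ _ h => ?_⟩ ?_ ?_ ?_ ?_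
      ?_
    · simp only at h; omega
    · simp only at h; omega
    all_goals
      rw [Set.disjoint_left]
      rintro x ⟨i, -, rfl⟩ ⟨j, -, h⟩
      simp only at h
      omega
  obtain ⟨_, _, t, -, ht, -⟩ := h n (w * n) hn le_rfl _ _ _ _ (fun _ => 0) rfl rfl rfl (by simp) hL
  exact t.cast_nonneg.trans ht

/-- The growth condition makes M(n)/n a common rate per coefficient for all products of size at most
n; this is the origin of α and β. -/
lemma computesDiv_divEraseProg {M : ℕ → ℝ} {lm lu cm : ℝ} {mp sp : Prog K} {d w q : ℕ}
    (hM : ∀ a b : ℕ, 1 ≤ a → a ≤ b → M a ≤ M b / b * a) (hM0 : ∀ n, 1 ≤ n → 0 ≤ M n)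
    (hlm : 0 < lm) (hlu : 0 < lu) (hcm : 0 ≤ cm) (hq : cm + 2 ≤ q)
    (hmp : ComputesMP mp (fun n => lm * M n) (fun n => cm * n) d w)
    (hsp : ComputesSP sp (fun n => lu * M n) (fun n => cm * n) d w) :
    ComputesDiv (divEraseProg mp sp q)
      (fun n => (lm * (((q : ℝ) - 1) / 2 + 1 / q) + lu * (1 + 1 / q)) * M n + (3 * q + 10) * n)
      (4 + d) (w + 1) := by
  intro n W hn hW G F Q E μ hG hF hQ hE hL hu
  have hn' : (n : ℝ) ≠ 0 := by positivity
  have hg : 0 ≤ M n / n := div_nonneg (hM0 n hn) n.cast_nonneg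
  refine (runs_divEraseProg (α := lm * (M n / n)) (β := lu * (M n / n)) hcm hmp hsp (by positivity)
    (by positivity) (fun a ha han => ?_) (fun a ha han => ?_) hq hn (by nlinarith)
    (by nlinarith) hG hF hQ hE hL hu).mono (le_of_eq ?_) fun _ => id
  · rw [mul_assoc]
    exact mul_le_mul_of_nonneg_left (hM a n ha han) hlm.le
  · rw [mul_assoc]
    exact mul_le_mul_of_nonneg_left (hM a n ha han) hlu.le
  · field_simp

/-- The division with erasing leaves room for the short products of `inPlaceEuclDiv`. -/
lemma divErase_rate_lt {lm ls c q : ℝ} (hlm : 0 < lm) (hls : 0 < ls) (hq : 2 ≤ q) (hc : 3 ≤ c)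
    (hqc : q < c) : lm * ((q - 1) / 2 + 1 / q) + min lm ls * (1 + 1 / q) <
      lm * ((c + 1) / 2 + 1 / c) + ls * (1 / c) := by
  set u := min lm ls with hu
  have hu0 : 0 < u := lt_min hlm hls
  have h1 : u ≤ lm := min_le_left _ _
  have h2 : u ≤ ls := min_le_right _ _
  set x := 1 / c with hx
  set y := 1 / q with hy
  have hx0 : 0 < x := by positivity
  have hxy : y - x = (c - q) * (x * y) := by
    rw [hx, hy]
    field_simp
  have hxy6 : x * y ≤ 1 / 6 := by
    have : x ≤ 1 / 3 := one_div_le_one_div_of_le (by norm_num) hc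
    have : y ≤ 1 / 2 := one_div_le_one_div_of_le (by norm_num) hq
    have : 0 < y := by positivity
    nlinarith
  have hyx : y - x ≤ (c - q) * (1 / 6) := by
    rw [hxy]
    exact mul_le_mul_of_nonneg_left hxy6 (by linarith)
  have h3 : u * x ≤ ls * x := mul_le_mul_of_nonneg_right h2 hx0.le
  have h4 : u * (1 + (c - q) / 2 + x - y) ≤ lm * (1 + (c - q) / 2 + x - y) :=
    mul_le_mul_of_nonneg_right h1 (by linarith)
  -- 2(y−x) ≤ (c−q)/3 < (c−q)/2.
  have h5 : 0 < u * ((c - q) / 2 + x + x - y - y) := mul_pos hu0 (by linarith)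
  linarith

/-- The block sizes add up to an + r = m+1. The a+1 short products have total size at most (a+1)n ≤
2m, which gives the coefficient 2 of λ_s. -/
lemma eucl_cost {δ ls g C₀ a r n m Mn Mr S : ℝ} (hδ : 0 ≤ δ) (hls : 0 ≤ ls)
    (hg : 0 ≤ g) (hC₀ : 0 ≤ C₀) (ha : 0 ≤ a) (hn : 1 ≤ n) (hm : a * n + r = m + 1)
    (ham : a * n ≤ m) (hnm : n ≤ m)
    (hMn : Mn ≤ g * n) (hMr : Mr ≤ g * r) (hS : S ≤ ls * (g * n)) :
    a * (δ * Mn + C₀ * n + S + n) + (δ * Mr + C₀ * r) + S + n ≤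
      δ * g * (m + 1) + 2 * (ls * g) * m + (2 * C₀ + 2) * m := by
  have h1 : a * (δ * Mn + C₀ * n + S + n) ≤ a * (δ * (g * n) + C₀ * n + ls * (g * n) + n) := by
    gcongr
  have h2 : δ * Mr ≤ δ * (g * r) := by gcongr
  have h3 : ls * g * (a * n + n) ≤ ls * g * (2 * m) := by
    have : 0 ≤ ls * g := by positivity
    gcongr
    linarith
  have h4 : C₀ * (m + 1) ≤ C₀ * (2 * m) := by
    gcongr
    linarith
  have h5 : δ * g * (a * n + r) = δ * g * (m + 1) := by rw [hm]
  have h6 : C₀ * (a * n + r) = C₀ * (m + 1) := by rw [hm]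
  linarith

end PolyRAM

theorem mainTheorem4 {K : Type*} [CommRing K]
    (M : ℕ → ℝ)
    (hM : ∀ (α : ℝ) (a b : ℕ), 1 ≤ α → 1 ≤ a → (b : ℝ) = α * a → α * M a ≤ M b)
    (lm ls cm cs c : ℝ) (hlm : 0 < lm) (hls : 0 < ls) (hcm : 0 ≤ cm) (hcs : 0 ≤ cs)
    (hc : c = max (cm + 3) (cs + 2))
    (mp sp spInPlace : PolyRAM.Prog K)
    (hmp : PolyRAM.IsMiddleProduct mp (fun n => lm * M n) (fun n => cm * n))
    (hsp : PolyRAM.IsShortProduct sp (fun n => ls * M n) (fun n => cs * n))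
    (hspInPlace : PolyRAM.IsShortProduct spInPlace (fun n => ls * M n) (fun _ => 0)) :
    (∀ (divErase : PolyRAM.Prog K) (T : ℕ → ℝ), PolyRAM.IsDivErase divErase T →
      ∃ T' : ℕ → ℕ → ℝ,
        PolyRAM.IsEuclDiv (PolyRAM.inPlaceEuclDiv divErase spInPlace) T') ∧
    ∃ (divErase : PolyRAM.Prog K) (C : ℝ),
      PolyRAM.IsDivErase divErase
        (fun n => (lm * ((c + 1) / 2 + 1 / c) + ls * (1 + 1 / c)) * M n + C * n) ∧
      PolyRAM.IsEuclDiv (PolyRAM.inPlaceEuclDiv divErase spInPlace)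
        (fun m n => (lm * ((c + 1) / 2 + 1 / c) + ls * (2 + 1 / c)) * M m
          + C * (m * max 1 (Real.logb 2 n))) := by
  obtain ⟨sd, sw, hsp'⟩ := hspInPlace.computesSP
  refine ⟨fun divErase T hdiv => ?_, ?_⟩
  · obtain ⟨dd, dw, hdiv⟩ := PolyRAM.isDivErase_iff.1 hdiv
    exact ⟨_, PolyRAM.ComputesDiv.isEuclDiv hdiv hsp'⟩
  have hMr : ∀ a b : ℕ, 1 ≤ a → a ≤ b → M a ≤ M b / b * a := by
    intro a b ha hab
    have ha' : (0 : ℝ) < a := by exact_mod_cast ha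
    have hb' : (0 : ℝ) < b := by exact_mod_cast ha.trans hab
    have h := hM (b / a) a b ((one_le_div ha').2 (by exact_mod_cast hab)) ha (by field_simp)
    rw [div_mul_eq_mul_div, div_le_iff₀ ha'] at h
    rw [div_mul_eq_mul_div, le_div_iff₀ hb']
    linarith
  have hM0 : ∀ n, 1 ≤ n → 0 ≤ M n := fun n hn =>
    nonneg_of_mul_nonneg_right (hsp'.cost_nonneg hn) hls
  obtain ⟨md, mw, hmp'⟩ := hmp.computesMP
  have hlu : 0 < min lm ls := lt_min hlm hls
  have hcn : ∀ n : ℕ, 0 ≤ cm * n := fun n => by positivity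
  -- Both candidates respect the space bound c_m n + O(1). Taking the cheaper one bounds the short
  -- product term of the division by λ_m as well as by λ_s, as `divErase_rate_lt` requires.
  obtain ⟨sp', d', w', hsp''⟩ : ∃ (p : PolyRAM.Prog K) (d w : ℕ),
      PolyRAM.ComputesSP p (fun n => min lm ls * M n) (fun n => cm * n) d w := by
    rcases le_total ls lm with h | h
    · refine ⟨spInPlace, sd, sw, ?_⟩
      rw [min_eq_right h]
      exact hsp'.mono (fun _ _ => le_rfl) hcn le_rfl le_rfl
    · refine ⟨PolyRAM.shortOfMiddle mp, md + 1, mw + 1, ?_⟩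
      rw [min_eq_left h]
      exact hmp'.computesSP hcn
  -- The least integer q ≥ c_m+2; it is smaller than c_m+3 ≤ c.
  set q : ℕ := ⌈cm⌉₊ + 2 with hq
  have hq1 : cm + 2 ≤ q := by
    rw [hq]
    push_cast
    linarith [Nat.le_ceil cm]
  have hq2 : (2 : ℝ) ≤ q := by linarith
  have hc3 : cm + 3 ≤ c := hc ▸ le_max_left _ _
  have hqc : (q : ℝ) < c := by
    rw [hq]
    push_cast
    linarith [Nat.ceil_lt_add_one hcm]
  have hdiv := PolyRAM.computesDiv_divEraseProg hMr hM0 hlm hlu hcm hq1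
    (hmp'.mono (fun _ _ => le_rfl) (fun _ => le_rfl) (le_max_left md d') (le_max_left mw w'))
    (hsp''.mono (fun _ _ => le_rfl) (fun _ => le_rfl) (le_max_right md d') (le_max_right mw w'))
  have hrate := PolyRAM.divErase_rate_lt hlm hls hq2 (by linarith) hqc
  set δ : ℝ := lm * (((q : ℝ) - 1) / 2 + 1 / q) + min lm ls * (1 + 1 / q) with hδ
  set δ' : ℝ := lm * ((c + 1) / 2 + 1 / c) + ls * (1 / c) with hδ'
  set C₀ : ℝ := 3 * q + 10 with hC₀
  have hδ0 : 0 ≤ δ := by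
    have : (0 : ℝ) ≤ (q - 1) / 2 := by linarith
    positivity
  -- The quotient has m+1 coefficients, and the excess δM(m)/m need not be O(m). For m > m₀ the gap
  -- absorbs it, since (δ'−δ)m ≥ δ; for the finitely many smaller m it is at most δg₀, because
  -- M(m)/m is nondecreasing.
  obtain ⟨m₀, hm₀⟩ := exists_nat_ge (δ / (δ' - δ))
  have hm₁ : δ ≤ (δ' - δ) * (m₀ + 1 : ℕ) := by
    rw [div_le_iff₀ (by linarith)] at hm₀
    push_cast
    linarith
  set g₀ : ℝ := M (m₀ + 1) / (m₀ + 1 : ℕ) with hg₀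
  have hg₀0 : 0 ≤ g₀ := div_nonneg (hM0 _ (by omega)) (Nat.cast_nonneg _)
  have hC : C₀ ≤ δ * g₀ + 2 * C₀ + 2 := by
    have : 0 ≤ δ * g₀ := by positivity
    linarith
  refine ⟨PolyRAM.divEraseProg mp sp' q, δ * g₀ + 2 * C₀ + 2, ?_, ?_⟩
  · refine PolyRAM.isDivErase_iff.2 ⟨_, _, hdiv.mono fun n hn => ?_⟩
    have h1 := hM0 n hn
    have h2 : δ ≤ lm * ((c + 1) / 2 + 1 / c) + ls * (1 + 1 / c) := by linarith
    gcongr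
  · refine (hdiv.isEuclDiv hsp').mono fun m n hn hnm => ?_
    have hm : 1 ≤ m := hn.trans hnm
    have hn' : (1 : ℝ) ≤ n := by exact_mod_cast hn
    have hm' : (1 : ℝ) ≤ m := by exact_mod_cast hm
    have hg : 0 ≤ M m / m := div_nonneg (hM0 m hm) m.cast_nonneg
    have hrn : m % n < n := Nat.mod_lt m (by omega)
    have hS : (if n ≤ 1 then (0 : ℝ) else ls * M (n - 1)) ≤ ls * (M m / m * n) := by
      split_ifs with h
      · positivity
      · refine mul_le_mul_of_nonneg_left ((hMr (n - 1) m (by omega) (by omega)).trans ?_) hls.le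
        gcongr
        omega
    have hcost := PolyRAM.eucl_cost (a := (m / n : ℕ)) (r := (m % n + 1 : ℕ)) (m := m) (C₀ := C₀)
      hδ0 hls.le hg (by positivity) (Nat.cast_nonneg _) hn'
      (by
        have := Nat.div_add_mod' m n
        exact_mod_cast (by omega : m / n * n + (m % n + 1) = m + 1))
      (by exact_mod_cast Nat.div_mul_le_self m n) (by exact_mod_cast hnm) (hMr n m hn hnm)
      (hMr (m % n + 1) m (by omega) (by omega)) hS
    refine hcost.trans ?_
    have h1 : δ * (M m / m) ≤ (δ' - δ) * (M m / m) * m + δ * g₀ * m := by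
      have hε : 0 ≤ δ' - δ := by linarith
      rcases le_total (m₀ + 1) m with h | h
      · have : (δ' - δ) * (m₀ + 1 : ℕ) ≤ (δ' - δ) * m := by gcongr
        have : δ * (M m / m) ≤ (δ' - δ) * m * (M m / m) := by
          gcongr
          linarith
        have : 0 ≤ δ * g₀ * m := by positivity
        linarith
      · have h2 : M m / m ≤ g₀ := by
          rw [div_le_iff₀ (by linarith)]
          exact hMr m (m₀ + 1) hm h
        have : δ * (M m / m) ≤ δ * g₀ := by gcongr
        have : δ * g₀ * 1 ≤ δ * g₀ * m := by gcongr
        have : 0 ≤ (δ' - δ) * (M m / m) * m := by positivity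
        linarith
    -- The error obtained is O(m); the logarithm only weakens it, and the maximum with 1 covers n =
    -- 1.
    have h3 : (m : ℝ) ≤ m * max 1 (Real.logb 2 n) :=
      le_mul_of_one_le_right (by linarith) (le_max_left _ _)
    have h4 : (δ * g₀ + 2 * C₀ + 2) * m ≤ (δ * g₀ + 2 * C₀ + 2) * (m * max 1 (Real.logb 2 n)) := by
      have : 0 ≤ δ * g₀ + 2 * C₀ + 2 := by positivity
      gcongr
    have h5 : (lm * ((c + 1) / 2 + 1 / c) + ls * (2 + 1 / c)) * M m =
        (δ' + 2 * ls) * (M m / m * m) := by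
      rw [div_mul_cancel₀ _ (by positivity), hδ']
      ring
    rw [h5]
    linarith
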